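/- **Setting.** Graphs are finite, simple and undirected. For an edge $\{u,v\}$, the pair $(u,\{u,v\})$ is a half-edge incident to $u$; a $(\mathcal V,\mathcal E)$-labeling of a graph labels its nodes by $\mathcal V$ and its half-edges by $\mathcal E$. Write $\mathcal N_s[A]$ for the set of nodes at distance at most $s$ from $A$, and $G_s(v)$ for the labeled subgraph of $G$ consisting of the nodes at distance at most $s$ from $v$ and the edges with an endpoint at distance at most $s-1$ from $v$. Let $\mathcal L(\mathcal V,\mathcal E,s,\Delta)$ be the family of $(\mathcal V,\mathcal E)$-labeled graphs $(H,v)$ with a distinguished node $v$, of maximum degree at most $\Delta$, in which all nodes are at distance at most $s$ from $v$ and each edge has an endpoint at distance at most $s-1$ from $v$ (considered up to isomorphism). **Locally optimal problems.** Let $r,\Delta\in\mathbb N$, let $\mathcal V_{in},\mathcal E_{in}$ be finite sets and $\mathcal V_{out},\mathcal E_{out}$ finite nonempty sets, and put $\mathcal V=\mathcal V_{in}\times\mathcal V_{out}$, $\mathcal E=\mathcal E_{in}\times\mathcal E_{out}$. A locally optimal problem (LOP) consists of an isomorphism-invariant potential $\Psi:\mathcal L(\mathcal V,\mathcal E,r,\Delta)\to\mathbb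 R_{\ge0}$ and an isomorphism-invariant set $\mathcal C\subseteq\mathcal L(\mathcal V,\mathcal E,2r,\Delta)$ such that for every $(\mathcal V,\mathcal E)$-labeled graph $G$ of maximum degree at most $\Delta$ with labeling $\ell$ and every node $v$: $(G_{2r}(v),v)\in\mathcal C$ if and only if there is no labeling $\ell'$ that differs from $\ell$ only in the output labels of $v$ and of its incident half-edges and satisfies $\Psi_{\ell'}(G_r(v),v)<\Psi_\ell(G_r(v),v)$ and $\sum_{u\in\mathcal N_r[v]}\Psi_{\ell'}(G_r(u),u)<\sum_{u\in\mathcal N_r[v]}\Psi_{\ell}(G_r(u),u)$. Given a graph of maximum degree at most $\Delta$ with input labels, an output labeling is valid if $(G_{2r}(v),v)\in\mathcal C$ for every node $v$. Let $\operatorname{Pot}(G,\ell)=\sum_{v}\Psi_\ell(G_r(v),v)$. If $\ell'$ arises from $\ell$ by changing output labels only on nodes of a set $A$ and on half-edges incident to $A$, and $\operatorname{Pot}(G,\ell')<\operatorname{Pot}(G,\ell)$, then $(A,\ell')$ is an improving set with improving ratio $(\operatorname{Pot}(G,\ell)-\operatorname{Pot}(G,\ell'))/|A|$ (and $0$ if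 $A=\emptyset$). Let $\lambda$ be the minimum of the decrease $\sum_{u\in\mathcal N_r[v]}\bigl(\Psi_{\ell}(H_r(u),u)-\Psi_{\ell'}(H_r(u),u)\bigr)$ over all $(H,v)\in\mathcal L(\mathcal V,\mathcal E,2r,\Delta)\setminus\mathcal C$ (with labeling $\ell$) and all relabelings $\ell'$ of $v$ as above that improve it ($\lambda=1$ if there are none). **The algorithm**, with constants $c,c_1,c_2,c_3>0$, on graphs $G$ with $n$ nodes. Put $\varepsilon=\lambda/(100c_1\log n)$ and $\rho=10c_2\varepsilon^2/(c\log^2 n)$. Start with an arbitrary output labeling and $R=\lambda/4$, and perform $\lceil c_1\log n\rceil$ phases. In each phase: 1. MPX clustering: each node $u$ draws an independent shift $s_u\sim\operatorname{Exp}(\rho/2)$, and each node $v$ joins the cluster of a node $u$ that minimizes $\operatorname{dist}(u,v)-s_u$. 2. In each cluster $C$, with $H=G[C]$, choose any maximal sequence of successive relabelings of $H$ by improving sets $A_1,\dots,A_k$ of $H$, each of improving ratio at least $R$ in $H$ with respect to the preceding labeling, such that $\mathcal N_{2r+1}[A_i]\subseteq C$ and any two nodes of $A_i$ are at distance at most $c_3\log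 n/\varepsilon$ in $G$. All nodes of $C$ adopt the resulting labels. 3. Increase $R$ by $\lambda/(20c_1\log n)$. **LOCAL model.** The nodes know $n$ and the problem; they have adversarially chosen distinct identifiers from $\{1,\dots,n^a\}$ (with $a$ constant), adversarially chosen distinct port numbers from $\{1,\dots,\Delta\}$ for their incident edges, and independent private random sources. They run the same algorithm in synchronous rounds, with messages and local computation of unbounded size. **Theorem.** For every LOP there are constants $c,c_1,c_2,c_3>0$ and $K$, depending only on the LOP, such that the algorithm can be implemented as a randomized LOCAL algorithm solving the LOP in $O(\log^6 n)$ rounds with high probability: for every $n\ge2$ and every $n$-node graph of maximum degree at most $\Delta$, with any input labels, identifiers and ports, with probability at least $1-1/n$ all nodes terminate within $K\log^6 n$ rounds, their outputs are a possible result of the algorithm for the shifts drawn, and every possible result of the algorithm for these shifts (whatever the initial labeling and the choice of maximal sequences) is a valid solution. -/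

import Mathlib

open scoped NNReal ENNReal

namespace LocalOpt

/-! ### Labeled graphs and centered graphs -/

/-- A labeling of the nodes and half-edges of `G`.  For an edge `{u, v}`, the half-edge
`(u, {u, v})`, which is incident to `u`, is given by the ordered pair `(u, v)`. -/
@[ext] structure Labeling {V : Type} (G : SimpleGraph V) (N H : Type) where
  node : V → N
  half : ∀ u v : V, G.Adj u v → H

/-- Pairing an input labeling with an output labeling. -/
def Labeling.prod {V : Type} {G : SimpleGraph V} {N H N' H' : Type}
    (inp : Labeling G N H) (out : Labeling G N' H') : Labeling G (N × N') (H × H') where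
  node v := (inp.node v, out.node v)
  half u v h := (inp.half u v h, out.half u v h)

/-- Restriction of a labeling to the subgraph induced by `C`. -/
def Labeling.restrict {V : Type} {G : SimpleGraph V} {N H : Type}
    (l : Labeling G N H) (C : Set V) : Labeling (G.induce C) N H where
  node v := l.node v
  half u v h := l.half u v h

/-- All nodes have degree at most `Δ`. -/
def DegreeLE {V : Type} (G : SimpleGraph V) (Δ : ℕ) : Prop :=
  ∀ v, (G.neighborSet v).encard ≤ Δ

/-- A finite labeled graph with a distinguished node. -/
structure CenteredGraph (N H : Type) where
  V : Type
  finite : Finite V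
  graph : SimpleGraph V
  lab : Labeling graph N H
  center : V

/-- Isomorphism of labeled centered graphs. -/
def CenteredGraph.Iso {N H : Type} (A B : CenteredGraph N H) : Prop :=
  ∃ φ : A.graph ≃g B.graph, φ A.center = B.center ∧
    (∀ v, B.lab.node (φ v) = A.lab.node v) ∧
    ∀ u v (h : A.graph.Adj u v),
      B.lab.half (φ u) (φ v) (φ.map_adj_iff.2 h) = A.lab.half u v h

/-- The family `𝓛(N, H, r, Δ)` of labeled centered graphs of radius at most `r` and degree at
most `Δ`: all nodes are at distance at most `r` from the center, and every edge has an endpoint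
at distance at most `r - 1` from the center. -/
def centeredFamily (N H : Type) (r Δ : ℕ) : Set (CenteredGraph N H) :=
  {A | DegreeLE A.graph Δ ∧ (∀ u, A.graph.edist A.center u ≤ r) ∧
    ∀ u v, A.graph.Adj u v →
      A.graph.edist A.center u < r ∨ A.graph.edist A.center v < r}

/-- The labeled centered graph `(G_r(v), v)`: all nodes at distance at most `r` from `v` and all
edges with an endpoint at distance at most `r - 1` from `v`. -/
def ball {V : Type} [Finite V] {N H : Type} (G : SimpleGraph V) (l : Labeling G N H)
    (r : ℕ) (v : V) : CenteredGraph N H where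
  V := {u : V // G.edist v u ≤ r}
  finite := inferInstance
  graph :=
    { Adj := fun a b => G.Adj a b ∧ (G.edist v a < r ∨ G.edist v b < r)
      symm := ⟨fun _ _ h => ⟨h.1.symm, h.2.symm⟩⟩
      loopless := ⟨fun _ h => G.loopless.irrefl _ h.1⟩ }
  lab :=
    { node := fun a => l.node a
      half := fun a b h => l.half a b h.1 }
  center := ⟨v, by simp⟩

/-! ### Potentials and locally optimal problems -/

section Potential

variable {N H : Type}

/-- The cost `c_v = Ψ_ℓ(G_r(v), v)` of a node. -/
noncomputable def cost (Ψ : CenteredGraph N H → ℝ≥0) (r : ℕ) {V : Type} [Finite V]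
    (G : SimpleGraph V) (l : Labeling G N H) (v : V) : ℝ :=
  Ψ (ball G l r v)

/-- `Pot(G, ℓ)`, the sum of the costs of all nodes of the finite graph `G`. -/
noncomputable def pot (Ψ : CenteredGraph N H → ℝ≥0) (r : ℕ) {V : Type} [Finite V]
    (G : SimpleGraph V) (l : Labeling G N H) : ℝ :=
  ∑ᶠ v : V, cost Ψ r G l v

/-- `Pot(G_r(v), ℓ)`, the sum of the costs (in `G`) of the nodes at distance at most `r`
from `v`. -/
noncomputable def localPot (Ψ : CenteredGraph N H → ℝ≥0) (r : ℕ) {V : Type} [Finite V]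
    (G : SimpleGraph V) (l : Labeling G N H) (v : V) : ℝ :=
  ∑ᶠ u ∈ {u : V | G.edist v u ≤ r}, cost Ψ r G l u

end Potential

/-- `out'` is obtained from `out` by relabeling nodes of `A` and half-edges incident to nodes
of `A`. -/
def IsRelabeling {V : Type} {G : SimpleGraph V} {N H : Type} (A : Set V)
    (out out' : Labeling G N H) : Prop :=
  ∀ v, v ∉ A → out'.node v = out.node v ∧ ∀ w h, out'.half v w h = out.half v w h

section LOP

variable {Vin Ein Vout Eout : Type}

/-- The change of the output of the single node `v` (and of its incident half-edges) from `out`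
to `out'` strictly improves both the cost of `v` and the potential around `v`. -/
def IsLocalImprovement (Ψ : CenteredGraph (Vin × Vout) (Ein × Eout) → ℝ≥0) (r : ℕ)
    {V : Type} [Finite V] (G : SimpleGraph V) (inp : Labeling G Vin Ein)
    (out out' : Labeling G Vout Eout) (v : V) : Prop :=
  IsRelabeling {v} out out' ∧
    cost Ψ r G (inp.prod out') v < cost Ψ r G (inp.prod out) v ∧
    localPot Ψ r G (inp.prod out') v < localPot Ψ r G (inp.prod out) v

variable (Vin Ein Vout Eout) in
/-- A locally optimal problem with radius `r` and degree bound `Δ`: a `(2r, Δ)`-set of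
constraints and a potential `Ψ`, both invariant under isomorphism, such that the constraint holds
at a node exactly if the node admits no local improvement.  Only the values of `Ψ` on
`𝓛(Vin × Vout, Ein × Eout, r, Δ)` matter. -/
structure LOP (r Δ : ℕ) where
  constraints : Set (CenteredGraph (Vin × Vout) (Ein × Eout))
  constraints_subset : constraints ⊆ centeredFamily _ _ (2 * r) Δ
  constraints_iso : ∀ A B, A.Iso B → A ∈ constraints → B ∈ constraints
  Ψ : CenteredGraph (Vin × Vout) (Ein × Eout) → ℝ≥0
  Ψ_iso : ∀ A B, A ∈ centeredFamily _ _ r Δ → A.Iso B → Ψ A = Ψ B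
  mem_constraints_iff : ∀ (V : Type) [Finite V] (G : SimpleGraph V), DegreeLE G Δ →
    ∀ (inp : Labeling G Vin Ein) (out : Labeling G Vout Eout) (v : V),
      ball G (inp.prod out) (2 * r) v ∈ constraints ↔
        ¬ ∃ out', IsLocalImprovement Ψ r G inp out out' v

namespace LOP

variable {r Δ : ℕ}

/-- `out` solves the problem on the graph `G` with input `inp`. -/
def Solves (P : LOP Vin Ein Vout Eout r Δ) {V : Type} [Finite V] (G : SimpleGraph V)
    (inp : Labeling G Vin Ein) (out : Labeling G Vout Eout) : Prop :=
  ∀ v, ball G (inp.prod out) (2 * r) v ∈ P.constraints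

/-- The improvements of the potential that are possible by a local improvement of the center of
some labeled centered graph in `𝓛(Vin × Vout, Ein × Eout, 2r, Δ)` that violates the
constraints.  (The relabeled set is a single node, so that these are improving ratios.) -/
def localImprovements (P : LOP Vin Ein Vout Eout r Δ) : Set ℝ :=
  {x | ∃ (V : Type) (_ : Finite V) (G : SimpleGraph V) (inp : Labeling G Vin Ein)
    (out out' : Labeling G Vout Eout) (v : V),
    (⟨V, ‹_›, G, inp.prod out, v⟩ : CenteredGraph _ _) ∈ centeredFamily _ _ (2 * r) Δ ∧
    (⟨V, ‹_›, G, inp.prod out, v⟩ : CenteredGraph _ _) ∉ P.constraints ∧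
    IsLocalImprovement P.Ψ r G inp out out' v ∧
    x = localPot P.Ψ r G (inp.prod out) v - localPot P.Ψ r G (inp.prod out') v}

open Classical in
/-- The minimum improving ratio `λ` of the problem.  If the constraints cannot be violated, there
is nothing to minimize over, and the value is `1` by convention. -/
noncomputable def minRatio (P : LOP Vin Ein Vout Eout r Δ) : ℝ :=
  if P.localImprovements.Nonempty then sInf P.localImprovements else 1

/-- `Imp(A, out, out') = Pot(G, out) - Pot(G, out')` (which does not depend on `A`). -/
noncomputable def imp (P : LOP Vin Ein Vout Eout r Δ) {V : Type} [Finite V]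
    (G : SimpleGraph V) (inp : Labeling G Vin Ein) (out out' : Labeling G Vout Eout) : ℝ :=
  pot P.Ψ r G (inp.prod out) - pot P.Ψ r G (inp.prod out')

/-- `(A, out')` is an improving set of `G` with respect to `out`. -/
def IsImprovingSet (P : LOP Vin Ein Vout Eout r Δ) {V : Type} [Finite V]
    (G : SimpleGraph V) (inp : Labeling G Vin Ein) (A : Finset V)
    (out out' : Labeling G Vout Eout) : Prop :=
  IsRelabeling (A : Set V) out out' ∧
    pot P.Ψ r G (inp.prod out') < pot P.Ψ r G (inp.prod out)

/-- The improving ratio `IR(A, out, out')`; it is `0` for empty `A`. -/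
noncomputable def improvingRatio (P : LOP Vin Ein Vout Eout r Δ) {V : Type} [Finite V]
    (G : SimpleGraph V) (inp : Labeling G Vin Ein) (A : Finset V)
    (out out' : Labeling G Vout Eout) : ℝ :=
  P.imp G inp out out' / A.card

/-! ### The algorithm -/

/-- One step of a sequence of `R`-improving sets in the graph `G[C]` induced by a cluster `C`,
from the labeling `out` to the labeling `out'` of `G[C]`.  The set `A` that is relabeled has
improving ratio at least `R` in `G[C]`, its radius-`(2r+1)` neighborhood in `G` lies in `C`, and
any two of its nodes are at distance at most `D` in `G`. -/
def Step (P : LOP Vin Ein Vout Eout r Δ) {V : Type} [Finite V] (G : SimpleGraph V)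
    (inp : Labeling G Vin Ein) (C : Set V) (R D : ℝ)
    (out out' : Labeling (G.induce C) Vout Eout) : Prop :=
  ∃ A : Finset C,
    P.IsImprovingSet (G.induce C) (inp.restrict C) A out out' ∧
    R ≤ P.improvingRatio (G.induce C) (inp.restrict C) A out out' ∧
    (∀ a ∈ A, ∀ u : V, G.edist a u ≤ (2 * r + 1 : ℕ) → u ∈ C) ∧
    ∀ a ∈ A, ∀ b ∈ A, G.Reachable (a : V) b ∧ (G.dist (a : V) b : ℝ) ≤ D

/-- There is a maximal sequence of steps in `G[C]` that starts with the labeling `out` and ends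
with the labeling `out'`. -/
def MaximalSequence (P : LOP Vin Ein Vout Eout r Δ) {V : Type} [Finite V] (G : SimpleGraph V)
    (inp : Labeling G Vin Ein) (C : Set V) (R D : ℝ)
    (out out' : Labeling (G.induce C) Vout Eout) : Prop :=
  Relation.ReflTransGen (P.Step G inp C R D) out out' ∧
    ¬ ∃ out'', P.Step G inp C R D out' out''

/-- MPX clustering with shifts `s`: every node `v` joins the cluster of a node `u` (the center of
the cluster) that minimizes the shifted distance `dist(u, v) - s u`; nodes in other connected
components are at infinite distance. -/
def _root_.LocalOpt.IsMPX {V : Type} (G : SimpleGraph V) (s : V → ℝ) (center : V → V) : Prop :=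
  ∀ v, G.Reachable (center v) v ∧
    ∀ u, G.Reachable u v → (G.dist (center v) v : ℝ) - s (center v) ≤ (G.dist u v : ℝ) - s u

/-- One phase of the algorithm, with shifts `s`, threshold `R` and diameter bound `D`: compute an
MPX clustering, and in every cluster relabel according to some maximal sequence.  The labels of
half-edges that belong to edges between different clusters do not change. -/
def Phase (P : LOP Vin Ein Vout Eout r Δ) {V : Type} [Finite V] (G : SimpleGraph V)
    (inp : Labeling G Vin Ein) (s : V → ℝ) (R D : ℝ) (out out' : Labeling G Vout Eout) : Prop :=
  ∃ center : V → V, IsMPX G s center ∧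
    (∀ u, P.MaximalSequence G inp {v | center v = u} R D
      (out.restrict {v | center v = u}) (out'.restrict {v | center v = u})) ∧
    ∀ v w h, center v ≠ center w → out'.half v w h = out.half v w h

/-- The constants of the algorithm. -/
structure _root_.LocalOpt.Constants where
  c : ℝ
  c₁ : ℝ
  c₂ : ℝ
  c₃ : ℝ
  c_pos : 0 < c
  c₁_pos : 0 < c₁
  c₂_pos : 0 < c₂
  c₃_pos : 0 < c₃

/-- The number of phases, `c₁ log n`. -/
noncomputable def _root_.LocalOpt.Constants.phases (k : Constants) (n : ℕ) : ℕ :=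
  ⌈k.c₁ * Real.log n⌉₊

/-- `ε = λ / (100 c₁ log n)`. -/
noncomputable def eps (P : LOP Vin Ein Vout Eout r Δ) (k : Constants) (n : ℕ) : ℝ :=
  P.minRatio / (100 * k.c₁ * Real.log n)

/-- The parameter `ρ = 10 c₂ ε² / (c log² n)` of the MPX clusterings. -/
noncomputable def rho (P : LOP Vin Ein Vout Eout r Δ) (k : Constants) (n : ℕ) : ℝ :=
  10 * k.c₂ * P.eps k n ^ 2 / (k.c * Real.log n ^ 2)

/-- The threshold `R` in phase `i`, where the phases are numbered from `0`: it starts with `λ / 4`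
and increases by `λ / (20 c₁ log n)` after every phase. -/
noncomputable def threshold (P : LOP Vin Ein Vout Eout r Δ) (k : Constants) (n i : ℕ) : ℝ :=
  P.minRatio / 4 + i * (P.minRatio / (20 * k.c₁ * Real.log n))

/-- The bound `c₃ log n / ε` on the diameter of the improving sets. -/
noncomputable def diamBound (P : LOP Vin Ein Vout Eout r Δ) (k : Constants) (n : ℕ) : ℝ :=
  k.c₃ * Real.log n / P.eps k n

/-- `result` is a possible result of the algorithm on an `n`-node graph if node `v` uses the shift
`s v i` in phase `i`.  The initial output labels are arbitrary. -/
def IsResult (P : LOP Vin Ein Vout Eout r Δ) (k : Constants) (n : ℕ) {V : Type} [Finite V]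
    (G : SimpleGraph V) (inp : Labeling G Vin Ein) (s : V → Fin (k.phases n) → ℝ)
    (result : Labeling G Vout Eout) : Prop :=
  ∃ out : ℕ → Labeling G Vout Eout,
    (∀ i : Fin (k.phases n), P.Phase G inp (fun v => s v i) (P.threshold k n i)
      (P.diamBound k n) (out i) (out (i + 1))) ∧
    out (k.phases n) = result

/-- The law of the shifts: the shifts of all nodes in all phases are independent random variables
with distribution `Exp(ρ / 2)`. -/
noncomputable def shiftLaw (P : LOP Vin Ein Vout Eout r Δ) (k : Constants) (n : ℕ) (V : Type)
    [Fintype V] : MeasureTheory.Measure (V → Fin (k.phases n) → ℝ) :=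
  MeasureTheory.Measure.pi fun _ : V => MeasureTheory.Measure.pi fun _ : Fin (k.phases n) =>
    ProbabilityTheory.expMeasure (P.rho k n / 2)

end LOP

end LOP

/-! ### The LOCAL model -/

/-- What the adversary chooses in a network with graph `G`: distinct identifiers from
`{1, …, n ^ a}`, and for every node distinct port numbers of its incident links. -/
structure Network {V : Type} (G : SimpleGraph V) (Δ a : ℕ) where
  id : V → ℕ
  id_injective : Function.Injective id
  id_mem : ∀ v, id v ∈ Set.Icc 1 (Nat.card V ^ a)
  port : ∀ v w : V, G.Adj v w → Fin Δ
  port_injective : ∀ v w w' h h', port v w h = port v w' h' → w = w'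

open Classical in
/-- Data attached to the links of `v`, arranged by port numbers (`none` at unused ports). -/
noncomputable def Network.byPort {V : Type} {G : SimpleGraph V} {Δ a : ℕ} (N : Network G Δ a)
    {X : Type} (v : V) (f : ∀ w, G.Adj v w → X) (p : Fin Δ) : Option X :=
  if h : ∃ w, ∃ hw : G.Adj v w, N.port v w hw = p then some (f h.choose h.choose_spec.choose)
  else none

/-- An algorithm in the LOCAL model, run by all nodes of networks of maximum degree at most `Δ`.
A node starts with its identifier, its input label, the input labels of its incident half-edges
(arranged by ports) and its private source of randomness, a value in `S`.  In every round it
sends a message through every port, receives a message through every port that is in use, and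
updates its state.  Once it has determined its output (a label for itself and labels for its
half-edges, arranged by ports), the output does not change. -/
structure LocalAlgorithm (Δ : ℕ) (Vin Ein Vout Eout S : Type) where
  State : Type
  Msg : Type
  init : ℕ → Vin → (Fin Δ → Option Ein) → S → State
  send : State → Fin Δ → Msg
  receive : State → (Fin Δ → Option Msg) → State
  output : State → Option (Vout × (Fin Δ → Eout))
  output_stable : ∀ s m o, output s = some o → output (receive s m) = some o

namespace LocalAlgorithm

variable {Δ : ℕ} {Vin Ein Vout Eout S : Type}

/-- The states of the nodes after `t` rounds. -/
noncomputable def state (𝒜 : LocalAlgorithm Δ Vin Ein Vout Eout S) {V : Type}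
    {G : SimpleGraph V} {a : ℕ} (N : Network G Δ a) (inp : Labeling G Vin Ein) (ω : V → S) :
    ℕ → V → 𝒜.State
  | 0, v => 𝒜.init (N.id v) (inp.node v) (N.byPort v fun w h => inp.half v w h) (ω v)
  | t + 1, v => 𝒜.receive (𝒜.state N inp ω t v)
      (N.byPort v fun w h => 𝒜.send (𝒜.state N inp ω t w) (N.port w v h.symm))

/-- All nodes terminate within `T` rounds, and their outputs form the labeling `out`. -/
def OutputsWithin (𝒜 : LocalAlgorithm Δ Vin Ein Vout Eout S) {V : Type}
    {G : SimpleGraph V} {a : ℕ} (N : Network G Δ a) (inp : Labeling G Vin Ein) (ω : V → S)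
    (T : ℕ) (out : Labeling G Vout Eout) : Prop :=
  ∀ v, ∃ o, 𝒜.output (𝒜.state N inp ω T v) = some o ∧ o.1 = out.node v ∧
    ∀ w h, o.2 (N.port v w h) = out.half v w h

end LocalAlgorithm

end LocalOpt

open LocalOpt

/-!
A violated constraint at a node `v` means that relabeling `v` alone decreases the potential by at
least `λ` (`LOP.exists_improvement_of_not_mem`). The proof shows that this is impossible at the
end of the algorithm if in at least one phase a ball of radius `ℓ = Θ((log n / ε) ^ 2)` around `v`
was contained in a single cluster (`LOP.mem_constraints_of_good_phase`). Let `i` be such a phase.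
The improvements of all later phases, followed by the relabeling of `v`, form a sequence of
relabelings whose ratios all exceed the threshold of phase `i` by at least `5 ε`. Growing a ball
around `v` in steps of the diameter bound, one finds a radius for which the sets that meet only
the boundary of the ball are few compared to those that meet the ball, so that relabeling the ball
at once from the labels after phase `i` to the final labels has nearly the same ratio
(`Run.exists_ball`). A second ball growing argument cuts an improving set of small diameter out of
this ball (`IsLocalCost.exists_small_diameter`). It lies well inside the cluster of `v` in phase
`i`, which contradicts the maximality of the sequence chosen in that cluster. No assumption on the
initial labels or on the chosen sequences enters, which is why a single event handles all possible
results.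

As the exponential distribution is memoryless, the best two shifted values at `v` differ by more
than `2 ℓ`, and hence the ball is not cut, with probability at least `exp (-ρ ℓ)`
(`expMeasure_pi_gap_le`). The constant `c` makes the probability that the ball is cut at most
`1 / e` in every phase, and the phases are independent, so `3 log n` of them make it unlikely that
the ball around some node is cut in all phases.

For the round complexity, all shifts are at most `T₀ = O(log n / ρ) = O(log ^ 5 n)` with high
probability. To make the result a function of the network, ties between cluster centers are broken
by identifiers, and the maximal sequence in a cluster is chosen once for every isomorphism class
of clusters with identifiers (`Cluster.result`). By induction on the phases, the label of a node
after `i` phases is determined by its view of radius `O(i T₀)` (`labelsAgree_canonOut`). A node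
collects its view for `O(log ^ 6 n)` rounds and then outputs the canonical result of any network
that is consistent with the view (`outputsWithin_canonOut`).
-/

namespace LocalOpt

/-! ### Distances, locality of the costs, finiteness of the local data -/

section Distance

variable {V W : Type} {G : SimpleGraph V}

theorem edist_le_succ {u v : V} {t : ℕ} (h : G.edist v u ≤ (t + 1 : ℕ)) :
    u = v ∨ ∃ w, G.edist v w ≤ t ∧ G.Adj w u := by
  have hne : G.edist v u ≠ ⊤ := fun h' => by simp [h'] at h
  obtain ⟨p, hp⟩ := SimpleGraph.exists_walk_of_edist_ne_top hne
  rw [SimpleGraph.edist_comm] at hp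
  have hp' : p.reverse.length ≤ t + 1 := by
    rw [SimpleGraph.Walk.length_reverse]
    rw [SimpleGraph.edist_comm, ← hp] at h
    exact_mod_cast h
  cases hq : p.reverse with
  | nil => left; rfl
  | cons hadj q =>
    right
    refine ⟨_, ?_, hadj.symm⟩
    rw [SimpleGraph.edist_comm]
    refine le_trans q.edist_le ?_
    rw [hq, SimpleGraph.Walk.length_cons] at hp'
    exact_mod_cast Nat.le_of_succ_le_succ hp'

theorem edist_le_zero {u v : V} (h : G.edist v u ≤ (0 : ℕ)) : u = v := by
  have : G.edist v u = 0 := by simpa using h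
  exact (SimpleGraph.edist_eq_zero_iff.1 this).symm

theorem edist_adj_le {u v w : V} {t : ℕ} (h : G.edist v w ≤ t) (hadj : G.Adj w u) :
    G.edist v u ≤ (t + 1 : ℕ) := by
  refine le_trans (SimpleGraph.edist_triangle (v := w)) ?_
  rw [SimpleGraph.edist_eq_one_iff_adj.2 hadj]
  push_cast
  gcongr

theorem edist_triangle_le {u v w : V} {s t : ℕ} (h : G.edist u v ≤ s) (h' : G.edist v w ≤ t) :
    G.edist u w ≤ (s + t : ℕ) := by
  refine le_trans (SimpleGraph.edist_triangle (v := v)) ?_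
  push_cast
  gcongr

theorem edist_map_le {H : SimpleGraph W} {f : W → V}
    (hadj : ∀ a b, H.Adj a b → G.Adj (f a) (f b)) (a b : W) :
    G.edist (f a) (f b) ≤ H.edist a b := by
  by_cases h : H.edist a b = ⊤
  · simp [h]
  · obtain ⟨p, hp⟩ := SimpleGraph.exists_walk_of_edist_ne_top h
    rw [← hp]
    have := (p.map (⟨f, fun {a b} => hadj a b⟩ : H →g G)).edist_le
    rwa [SimpleGraph.Walk.length_map] at this

/-- If every edge of `G` at distance less than `r` from `f u` lifts along `f`, so does every node
at distance at most `r`, without an increase of the distance. -/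
theorem exists_lift_of_edist_le {H : SimpleGraph W} {f : W → V} {u : W} {r : ℕ}
    (hlift : ∀ w, H.edist u w < r → ∀ x, G.Adj (f w) x → ∃ y, f y = x ∧ H.Adj w y) :
    ∀ t : ℕ, t ≤ r → ∀ x, G.edist (f u) x ≤ t → ∃ y, f y = x ∧ H.edist u y ≤ t := by
  intro t
  induction t with
  | zero =>
    intro _ x hx
    exact ⟨u, (edist_le_zero hx).symm, by simp⟩
  | succ t ih =>
    intro ht x hx
    rcases edist_le_succ hx with rfl | ⟨w, hw, hadj⟩
    · exact ⟨u, rfl, by simp⟩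
    · obtain ⟨y, rfl, hy⟩ := ih (by omega) w hw
      obtain ⟨z, rfl, hz⟩ := hlift y (lt_of_le_of_lt hy (by exact_mod_cast ht)) x hadj
      exact ⟨z, rfl, edist_adj_le hy hz⟩

theorem DegreeLE.of_injective {H : SimpleGraph W} {f : W → V} {Δ : ℕ} (hG : DegreeLE G Δ)
    (hf : Function.Injective f) (hadj : ∀ a b, H.Adj a b → G.Adj (f a) (f b)) :
    DegreeLE H Δ := by
  intro v
  rw [← hf.encard_image]
  refine le_trans (Set.encard_le_encard ?_) (hG (f v))
  rintro _ ⟨w, hw, rfl⟩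
  exact hadj _ _ hw

theorem ncard_ball_le [Finite V] {Δ : ℕ} (hG : DegreeLE G Δ) (r : ℕ) (v : V) :
    {u | G.edist v u ≤ r}.ncard ≤ (Δ + 1) ^ r := by
  induction r with
  | zero =>
    have : {u | G.edist v u ≤ (0 : ℕ)} ⊆ {v} := fun u hu => edist_le_zero hu
    exact (Set.ncard_le_ncard this).trans (by simp)
  | succ r ih =>
    have hsub : {u | G.edist v u ≤ (r + 1 : ℕ)} ⊆
        ⋃ w ∈ {w | G.edist v w ≤ r}, insert w (G.neighborSet w) := by
      intro u hu
      simp only [Set.mem_iUnion]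
      rcases edist_le_succ hu with rfl | ⟨w, hw, hadj⟩
      · exact ⟨u, by simp, by simp⟩
      · exact ⟨w, hw, Or.inr hadj⟩
    have hfin : {w | G.edist v w ≤ r}.Finite := Set.toFinite _
    have hdeg : ∀ w, (insert w (G.neighborSet w)).ncard ≤ Δ + 1 := by
      intro w
      refine (Set.ncard_insert_le _ _).trans ?_
      have := hG w
      rw [← (Set.toFinite (G.neighborSet w)).cast_ncard_eq] at this
      have : (G.neighborSet w).ncard ≤ Δ := by exact_mod_cast this
      omega
    calc _ ≤ (⋃ w ∈ {w | G.edist v w ≤ r}, insert w (G.neighborSet w)).ncard :=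
          Set.ncard_le_ncard hsub
      _ = (⋃ w ∈ hfin.toFinset, insert w (G.neighborSet w)).ncard := by simp
      _ ≤ ∑ w ∈ hfin.toFinset, (insert w (G.neighborSet w)).ncard :=
          Finset.set_ncard_biUnion_le _ _
      _ ≤ ∑ w ∈ hfin.toFinset, (Δ + 1) := Finset.sum_le_sum fun w _ => hdeg w
      _ = {w | G.edist v w ≤ r}.ncard * (Δ + 1) := by
          rw [Finset.sum_const, smul_eq_mul, Set.ncard_eq_toFinset_card _ hfin]
      _ ≤ (Δ + 1) ^ (r + 1) := by rw [pow_succ]; gcongr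

end Distance

/-- The labels of `v` and of its incident half-edges are the same in `l` and `l'`. -/
def AgreeAt {V N H : Type} {G : SimpleGraph V} (l l' : Labeling G N H) (v : V) : Prop :=
  l'.node v = l.node v ∧ ∀ w h, l'.half v w h = l.half v w h

theorem AgreeAt.prod {V : Type} {G : SimpleGraph V} {N H N' H' : Type} {inp : Labeling G N H}
    {l l' : Labeling G N' H'} {v : V}
    (h : AgreeAt l l' v) : AgreeAt (inp.prod l) (inp.prod l') v :=
  ⟨by simp [Labeling.prod, h.1], fun w hw => by simp [Labeling.prod, h.2 w hw]⟩

section Cost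

variable {N H : Type} {V W : Type} [Finite V] [Finite W] {G : SimpleGraph V}
  {Ψ : CenteredGraph N H → ℝ≥0} {r : ℕ}

theorem cost_congr {l l' : Labeling G N H} {u : V}
    (h : ∀ w, G.edist u w ≤ r → AgreeAt l l' w) : cost Ψ r G l u = cost Ψ r G l' u := by
  have : ball G l r u = ball G l' r u := by
    unfold ball
    congr 2
    · funext a; exact ((h a a.2).1).symm
    · funext a b hab; exact ((h a a.2).2 _ hab.1).symm
  rw [cost, cost, this]

theorem edist_ball_center_le (G : SimpleGraph V) (l : Labeling G N H) (r : ℕ) (v : V) :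
    ∀ t : ℕ, t ≤ r → ∀ u (hu : G.edist v u ≤ r), G.edist v u ≤ t →
      (ball G l r v).graph.edist (ball G l r v).center ⟨u, hu⟩ ≤ t := by
  intro t
  induction t with
  | zero =>
    intro _ u hu h
    obtain rfl := edist_le_zero h
    exact (SimpleGraph.edist_self).le.trans (by simp)
  | succ t ih =>
    intro ht u hu h
    rcases edist_le_succ h with rfl | ⟨w, hw, hadj⟩
    · exact (SimpleGraph.edist_self).le.trans (by simp)
    · have hwr : G.edist v w ≤ r := hw.trans (by exact_mod_cast (by omega : t ≤ r))
      exact edist_adj_le (ih (by omega) w hwr hw)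
        ⟨hadj, Or.inl (lt_of_le_of_lt hw (by exact_mod_cast ht))⟩

theorem edist_ball_center (G : SimpleGraph V) (l : Labeling G N H) (r : ℕ) (v : V) (u : V)
    (hu : G.edist v u ≤ r) :
    (ball G l r v).graph.edist (ball G l r v).center ⟨u, hu⟩ = G.edist v u := by
  apply le_antisymm
  · obtain ⟨t, ht⟩ := ENat.ne_top_iff_exists.1 (ne_top_of_le_ne_top (ENat.natCast_ne_top r) hu)
    rw [← ht] at hu ⊢
    exact edist_ball_center_le G l r v t (by exact_mod_cast hu) u _ ht.symm.le
  · exact edist_map_le (f := fun a : {u : V // G.edist v u ≤ r} => (a : V))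
      (H := (ball G l r v).graph) (fun a b h => h.1) (ball G l r v).center ⟨u, hu⟩

theorem ball_mem_centeredFamily {Δ : ℕ} (hG : DegreeLE G Δ) (l : Labeling G N H) (r : ℕ) (v : V) :
    ball G l r v ∈ centeredFamily N H r Δ := by
  refine ⟨?_, ?_, ?_⟩
  · exact hG.of_injective (f := fun a : {u : V // G.edist v u ≤ r} => (a : V))
      Subtype.val_injective fun a b h => h.1
  · rintro ⟨u, hu⟩
    exact (edist_ball_center G l r v u hu).trans_le hu
  · rintro ⟨u, hu⟩ ⟨w, hw⟩ h
    rw [edist_ball_center, edist_ball_center]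
    exact h.2

/-- The cost of a node is determined by its neighborhood: `f` embeds a graph on `W` into `G`, and
all edges of `G` that are close to `f u` come from edges on `W`. -/
theorem cost_eq_of_lift {Δ : ℕ}
    (hΨ : ∀ A B, A ∈ centeredFamily N H r Δ → A.Iso B → Ψ A = Ψ B)
    (hG : DegreeLE G Δ) {F : SimpleGraph W} {f : W → V} (hf : Function.Injective f)
    (hadj : ∀ a b, F.Adj a b → G.Adj (f a) (f b)) {u : W}
    (hlift : ∀ w, F.edist u w < r → ∀ x, G.Adj (f w) x → ∃ y, f y = x ∧ F.Adj w y)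
    {lW : Labeling F N H} {l : Labeling G N H} (hnode : ∀ w, lW.node w = l.node (f w))
    (hhalf : ∀ a b h, lW.half a b h = l.half (f a) (f b) (hadj a b h)) :
    cost Ψ r F lW u = cost Ψ r G l (f u) := by
  unfold cost
  congr 1
  apply hΨ _ _ (ball_mem_centeredFamily (hG.of_injective hf hadj) lW r u)
  have hle : ∀ a, F.edist u a ≤ r → G.edist (f u) (f a) ≤ r := fun a ha =>
    (edist_map_le hadj u a).trans ha
  have hdist : ∀ (t : ℕ), t ≤ r → ∀ a, G.edist (f u) (f a) ≤ t → F.edist u a ≤ t := by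
    intro t ht a ha
    obtain ⟨y, hy, h⟩ := exists_lift_of_edist_le hlift t ht _ ha
    rwa [hf hy] at h
  let φ : {a : W // F.edist u a ≤ r} → {b : V // G.edist (f u) b ≤ r} :=
    fun a => ⟨f a, hle a a.2⟩
  have hφ : Function.Bijective φ := by
    constructor
    · intro a b h
      exact Subtype.ext (hf (congrArg Subtype.val h))
    · rintro ⟨b, hb⟩
      obtain ⟨y, rfl, hy⟩ := exists_lift_of_edist_le hlift r le_rfl _ hb
      exact ⟨⟨y, hy⟩, rfl⟩
  have hlt : ∀ a, F.edist u a < r ↔ G.edist (f u) (f a) < r := by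
    intro a
    constructor
    · exact fun h => lt_of_le_of_lt (edist_map_le hadj u a) h
    · intro h
      obtain ⟨t, ht⟩ := ENat.ne_top_iff_exists.1 (ne_top_of_lt h)
      rw [← ht] at h
      have h1 : t < r := by exact_mod_cast h
      exact lt_of_le_of_lt (hdist t h1.le a ht.symm.le) (by exact_mod_cast h1)
  have hadj' : ∀ a b : W, F.edist u a < r → G.Adj (f a) (f b) → F.Adj a b := by
    intro a b ha h
    obtain ⟨y, hy, hy'⟩ := hlift a ha _ h
    rwa [hf hy] at hy'
  refine ⟨⟨Equiv.ofBijective φ hφ, ?_⟩, ?_, ?_, ?_⟩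
  · rintro ⟨a, ha⟩ ⟨b, hb⟩
    constructor
    · rintro ⟨h1, h2⟩
      have h2' : F.edist u a < r ∨ F.edist u b < r := h2.imp (hlt a).2 (hlt b).2
      refine ⟨?_, h2'⟩
      rcases h2' with h2' | h2'
      · exact hadj' a b h2' h1
      · exact (hadj' b a h2' h1.symm).symm
    · rintro ⟨h1, h2⟩
      exact ⟨hadj _ _ h1, h2.imp (hlt a).1 (hlt b).1⟩
  · rfl
  · intro w; exact (hnode _).symm
  · intro a b h; exact (hhalf _ _ h.1).symm

theorem cost_nonneg (l : Labeling G N H) (v : V) : 0 ≤ cost Ψ r G l v := NNReal.coe_nonneg _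

end Cost

section Finiteness

variable {N H : Type} [Finite N] [Finite H]

instance {V : Type} [Finite V] (G : SimpleGraph V) : Finite (Labeling G N H) :=
  Finite.of_injective (fun l => (l.node, l.half)) fun l l' h => by
    simp only [Prod.mk.injEq] at h
    exact Labeling.ext h.1 h.2

/-- Up to isomorphism there are only finitely many labeled centered graphs of bounded radius and
degree, so an isomorphism-invariant potential takes only finitely many values on them. -/
theorem finite_image_centeredFamily {r Δ : ℕ} {Ψ : CenteredGraph N H → ℝ≥0}
    (hΨ : ∀ A B, A ∈ centeredFamily N H r Δ → A.Iso B → Ψ A = Ψ B) :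
    (Ψ '' centeredFamily N H r Δ).Finite := by
  let b := (Δ + 1) ^ r + 1
  let X := Σ m : Fin b, Σ G : SimpleGraph (Fin m), Labeling G N H × Fin m
  let g : X → ℝ≥0 := fun x => Ψ ⟨Fin x.1, inferInstance, x.2.1, x.2.2.1, x.2.2.2⟩
  refine (Set.finite_range g).subset ?_
  rintro _ ⟨A, hA, rfl⟩
  have := A.finite
  have hcard : Nat.card A.V < b := by
    have h1 := ncard_ball_le hA.1 r A.center
    rw [Set.eq_univ_of_forall (s := {u | A.graph.edist A.center u ≤ r}) hA.2.1,
      Set.ncard_univ] at h1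
    exact Nat.lt_succ_of_le h1
  let e : A.V ≃ Fin (Nat.card A.V) := Finite.equivFin A.V
  let G' : SimpleGraph (Fin (Nat.card A.V)) := A.graph.comap e.symm
  let l' : Labeling G' N H := ⟨fun v => A.lab.node (e.symm v), fun u v h => A.lab.half _ _ h⟩
  refine ⟨⟨⟨Nat.card A.V, hcard⟩, G', l', e A.center⟩, ?_⟩
  refine (hΨ A _ hA ⟨⟨e, ?_⟩, rfl, ?_, ?_⟩).symm
  · intro a b
    simp [G']
  · intro v
    change A.lab.node (e.symm (e v)) = _
    rw [e.symm_apply_apply]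
  · intro u v h
    change A.lab.half (e.symm (e u)) (e.symm (e v)) _ = _
    congr 1 <;> simp

theorem finite_sums_card_le {S : Set ℝ} (hS : S.Finite) (m : ℕ) :
    ∃ F : Set ℝ, F.Finite ∧ ∀ (ι : Type) (t : Finset ι) (f : ι → ℝ), t.card ≤ m →
      (∀ i ∈ t, f i ∈ S) → ∑ i ∈ t, f i ∈ F := by
  induction m with
  | zero =>
    refine ⟨{0}, Set.finite_singleton _, fun ι t f ht _ => ?_⟩
    rw [Finset.card_eq_zero.1 (Nat.le_zero.1 ht)]
    simp
  | succ m ih =>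
    obtain ⟨F, hF, h⟩ := ih
    refine ⟨insert 0 (Set.image2 (· + ·) S F), (hS.image2 _ hF).insert _, fun ι t f ht hf => ?_⟩
    classical
    rcases t.eq_empty_or_nonempty with rfl | ⟨i, hi⟩
    · simp
    · right
      refine ⟨f i, hf i hi, ∑ j ∈ t.erase i, f j, h ι _ f ?_ ?_, Finset.add_sum_erase _ _ hi⟩
      · rw [Finset.card_erase_of_mem hi]; omega
      · exact fun j hj => hf j (Finset.mem_of_mem_erase hj)

end Finiteness

namespace LOP

variable {Vin Ein Vout Eout : Type} {r Δ : ℕ} {V : Type} [Finite V] {G : SimpleGraph V}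

section

variable [Finite Vin] [Finite Ein] [Finite Vout] [Finite Eout]

theorem exists_cost_bound (P : LOP Vin Ein Vout Eout r Δ) : ∃ M : ℝ, 0 ≤ M ∧
    ∀ (V : Type) [Finite V] (G : SimpleGraph V), DegreeLE G Δ → ∀ l v, cost P.Ψ r G l v ≤ M := by
  obtain ⟨M, hM⟩ := (finite_image_centeredFamily P.Ψ_iso).bddAbove
  refine ⟨M, M.coe_nonneg, fun V _ G hG l v => ?_⟩
  exact_mod_cast hM ⟨_, ball_mem_centeredFamily hG l r v, rfl⟩

theorem finite_localImprovements (P : LOP Vin Ein Vout Eout r Δ) : P.localImprovements.Finite := by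
  let S : Set ℝ := (fun x : ℝ≥0 => (x : ℝ)) '' (P.Ψ '' centeredFamily _ _ r Δ)
  have hS : S.Finite := (finite_image_centeredFamily P.Ψ_iso).image _
  obtain ⟨F, hF, h⟩ := finite_sums_card_le hS ((Δ + 1) ^ r)
  refine (hF.image2 (· - ·) hF).subset ?_
  rintro _ ⟨V, _, G, inp, out, out', v, hv, -, -, rfl⟩
  have key : ∀ l : Labeling G (Vin × Vout) (Ein × Eout), localPot P.Ψ r G l v ∈ F := by
    intro l
    have hfin : {u | G.edist v u ≤ r}.Finite := Set.toFinite _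
    rw [localPot, finsum_mem_eq_finite_toFinset_sum _ hfin]
    refine h V _ _ ?_ ?_
    · rw [← Set.ncard_eq_toFinset_card _ hfin]
      exact ncard_ball_le hv.1 r v
    · intro u _
      exact ⟨_, ⟨_, ball_mem_centeredFamily hv.1 l r u, rfl⟩, rfl⟩
  exact ⟨_, key _, _, key _, rfl⟩

theorem minRatio_pos (P : LOP Vin Ein Vout Eout r Δ) : 0 < P.minRatio := by
  unfold minRatio
  split_ifs with h
  · obtain ⟨V, _, G, inp, out, out', v, -, -, hi, hx⟩ := h.csInf_mem P.finite_localImprovements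
    rw [hx]
    exact sub_pos.2 hi.2.2
  · exact one_pos

end

end LOP

/-! ### Improvements are local -/

namespace LOP

variable {Vin Ein Vout Eout : Type} {r Δ : ℕ} {V : Type} {G : SimpleGraph V}

theorem pot_eq_sum [Fintype V] {N H : Type} (Ψ : CenteredGraph N H → ℝ≥0)
    (l : Labeling G N H) : pot Ψ r G l = ∑ v, cost Ψ r G l v :=
  finsum_eq_sum_of_fintype _

theorem localPot_eq_sum [Fintype V] {N H : Type} (Ψ : CenteredGraph N H → ℝ≥0)
    (l : Labeling G N H) (v : V) [DecidablePred fun u => G.edist v u ≤ r] :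
    localPot Ψ r G l v = ∑ u with G.edist v u ≤ r, cost Ψ r G l u := by
  rw [localPot, finsum_mem_eq_finite_toFinset_sum _ (Set.toFinite _)]
  refine Finset.sum_congr ?_ fun _ _ => rfl
  ext u; simp

theorem cost_eq_of_isRelabeling [Finite V] (Ψ : CenteredGraph (Vin × Vout) (Ein × Eout) → ℝ≥0)
    (inp : Labeling G Vin Ein) {A : Set V}
    {out out' : Labeling G Vout Eout} (h : IsRelabeling A out out') {u : V}
    (hu : ∀ a ∈ A, ¬ G.edist u a ≤ r) :
    cost Ψ r G (inp.prod out) u = cost Ψ r G (inp.prod out') u :=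
  cost_congr fun w hw => AgreeAt.prod (h w fun hA => hu w hA hw)

theorem pot_sub_pot_of_isRelabeling_singleton [Finite V]
    (Ψ : CenteredGraph (Vin × Vout) (Ein × Eout) → ℝ≥0) (inp : Labeling G Vin Ein) {v : V}
    {out out' : Labeling G Vout Eout} (h : IsRelabeling {v} out out') :
    pot Ψ r G (inp.prod out) - pot Ψ r G (inp.prod out') =
      localPot Ψ r G (inp.prod out) v - localPot Ψ r G (inp.prod out') v := by
  classical
  have := Fintype.ofFinite V
  rw [pot_eq_sum, pot_eq_sum, localPot_eq_sum, localPot_eq_sum, ← Finset.sum_sub_distrib,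
    ← Finset.sum_sub_distrib, Finset.sum_filter]
  refine Finset.sum_congr rfl fun u _ => ?_
  split_ifs with hu
  · rfl
  · rw [cost_eq_of_isRelabeling Ψ inp h, sub_self]
    rintro a rfl
    rwa [SimpleGraph.edist_comm]

/-- A violated constraint in an arbitrary graph is witnessed by a change of output labels that
decreases the potential by at least the minimum ratio. -/
theorem exists_improvement_of_not_mem [Finite Vin] [Finite Ein] [Finite Vout] [Finite Eout]
    [Finite V] (P : LOP Vin Ein Vout Eout r Δ) (hG : DegreeLE G Δ) (inp : Labeling G Vin Ein)
    (out : Labeling G Vout Eout) (v : V)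
    (hv : ball G (inp.prod out) (2 * r) v ∉ P.constraints) :
    ∃ out', IsRelabeling {v} out out' ∧
      P.minRatio ≤ pot P.Ψ r G (inp.prod out) - pot P.Ψ r G (inp.prod out') := by
  classical
  have hex := hv
  rw [P.mem_constraints_iff V G hG inp out v, not_not] at hex
  obtain ⟨out', hrel, hcost, hpot⟩ := hex
  refine ⟨out', hrel, ?_⟩
  rw [pot_sub_pot_of_isRelabeling_singleton P.Ψ inp hrel]
  -- The improvement is transferred to the ball of radius `2 * r` around `v`.
  let B := ball G (inp.prod out) (2 * r) v
  let f : B.V → V := fun a => a.1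
  have hf : Function.Injective f := Subtype.val_injective
  have hadj : ∀ a b, B.graph.Adj a b → G.Adj (f a) (f b) := fun a b h => h.1
  let inpB : Labeling B.graph Vin Ein := (ball G inp (2 * r) v).lab
  let outB : Labeling B.graph Vout Eout := (ball G out (2 * r) v).lab
  let outB' : Labeling B.graph Vout Eout := (ball G out' (2 * r) v).lab
  have := B.finite
  have hcd : ∀ a : B.V, B.graph.edist B.center a = G.edist v (f a) := fun a =>
    edist_ball_center G (inp.prod out) (2 * r) v a.1 a.2
  have hB : B ∈ centeredFamily _ _ (2 * r) Δ := ball_mem_centeredFamily hG _ _ _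
  have hlift : ∀ u : B.V, B.graph.edist B.center u ≤ r → ∀ w, B.graph.edist u w < r →
      ∀ x, G.Adj (f w) x → ∃ y, f y = x ∧ B.graph.Adj w y := by
    intro u hu w hw x hx
    have h1 : G.edist v (f w) < (2 * r : ℕ) := by
      rw [← hcd]
      refine lt_of_le_of_lt (SimpleGraph.edist_triangle (v := u)) ?_
      have : ((2 * r : ℕ) : ℕ∞) = r + r := by push_cast; ring
      rw [this]
      exact ENat.add_lt_add_of_le_of_lt (ne_top_of_le_ne_top (ENat.natCast_ne_top r) hu) hu hw
    have h2 : G.edist v x ≤ (2 * r : ℕ) := by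
      refine le_trans (SimpleGraph.edist_triangle (v := f w)) ?_
      rw [SimpleGraph.edist_eq_one_iff_adj.2 hx]
      exact Order.add_one_le_of_lt h1
    exact ⟨⟨x, h2⟩, rfl, hx, Or.inl h1⟩
  have hcostB : ∀ u : B.V, B.graph.edist B.center u ≤ r →
      cost P.Ψ r B.graph (inpB.prod outB) u = cost P.Ψ r G (inp.prod out) (f u) := fun u hu =>
    cost_eq_of_lift P.Ψ_iso hG hf hadj (hlift u hu) (fun _ => rfl) fun _ _ _ => rfl
  have hcostB' : ∀ u : B.V, B.graph.edist B.center u ≤ r →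
      cost P.Ψ r B.graph (inpB.prod outB') u = cost P.Ψ r G (inp.prod out') (f u) := fun u hu =>
    cost_eq_of_lift P.Ψ_iso hG hf hadj (hlift u hu) (fun _ => rfl) fun _ _ _ => rfl
  have himage : f '' {u | B.graph.edist B.center u ≤ r} = {u | G.edist v u ≤ r} := by
    ext u
    constructor
    · rintro ⟨a, ha, rfl⟩
      exact (hcd a).symm.trans_le ha
    · intro hu
      have h2 : G.edist v u ≤ (2 * r : ℕ) := le_trans hu (by exact_mod_cast (by omega : r ≤ 2 * r))
      exact ⟨⟨u, h2⟩, (hcd ⟨u, h2⟩).trans_le hu, rfl⟩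
  have hpotB : localPot P.Ψ r B.graph (inpB.prod outB) B.center =
      localPot P.Ψ r G (inp.prod out) v := by
    rw [localPot, localPot, ← himage, finsum_mem_image hf.injOn]
    exact finsum_mem_congr rfl hcostB
  have hpotB' : localPot P.Ψ r B.graph (inpB.prod outB') B.center =
      localPot P.Ψ r G (inp.prod out') v := by
    rw [localPot, localPot, ← himage, finsum_mem_image hf.injOn]
    exact finsum_mem_congr rfl hcostB'
  have hself : B.graph.edist B.center B.center ≤ r := by rw [SimpleGraph.edist_self]; simp
  have hmem : localPot P.Ψ r G (inp.prod out) v - localPot P.Ψ r G (inp.prod out') v ∈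
      P.localImprovements := by
    refine ⟨B.V, B.finite, B.graph, inpB, outB, outB', B.center, hB, hv, ⟨?_, ?_, ?_⟩, ?_⟩
    · intro a ha
      have hne : f a ∉ ({v} : Set V) := fun h => ha (Subtype.ext h)
      exact ⟨(hrel _ hne).1, fun w h => (hrel _ hne).2 _ h.1⟩
    · rw [hcostB _ hself, hcostB' _ hself]; exact hcost
    · rw [hpotB, hpotB']; exact hpot
    · rw [hpotB, hpotB']
  rw [minRatio, if_pos ⟨_, hmem⟩]
  exact csInf_le P.finite_localImprovements.bddBelow hmem

theorem edist_induce_ge (G : SimpleGraph V) (C : Set V) (u w : C) :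
    G.edist (u : V) w ≤ (G.induce C).edist u w :=
  edist_map_le (f := fun a : C => (a : V)) (fun _ _ h => h) u w

/-- If the radius-`2r` neighborhood of `A` lies in `C`, then a relabeling of `A` changes the
potential of the graph induced by `C` as much as the potential of the entire graph. -/
theorem imp_induce [Finite V] (P : LOP Vin Ein Vout Eout r Δ) (hG : DegreeLE G Δ)
    (inp : Labeling G Vin Ein) {C : Set V} {A : Set V} {out out' : Labeling G Vout Eout}
    (h : IsRelabeling A out out')
    (hA : ∀ a ∈ A, ∀ u, G.edist a u ≤ (2 * r : ℕ) → u ∈ C) :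
    P.imp (G.induce C) (inp.restrict C) (out.restrict C) (out'.restrict C) =
      P.imp G inp out out' := by
  classical
  have := Fintype.ofFinite V
  have hC : IsRelabeling {a : C | (a : V) ∈ A} (out.restrict C) (out'.restrict C) :=
    fun v hv => ⟨(h v hv).1, fun w hw => (h v hv).2 _ hw⟩
  rw [imp, imp, pot_eq_sum, pot_eq_sum, pot_eq_sum, pot_eq_sum, ← Finset.sum_sub_distrib,
    ← Finset.sum_sub_distrib]
  rw [← Finset.sum_subset (Finset.subset_univ (Finset.univ.filter (· ∈ C)))]
  · rw [Finset.sum_subtype (p := fun x => x ∈ C) _ (by simp)]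
    refine Finset.sum_congr rfl fun u _ => ?_
    by_cases hu : ∃ a ∈ A, G.edist (u : V) a ≤ r
    · obtain ⟨a, ha, hua⟩ := hu
      have hlift : ∀ w, (G.induce C).edist u w < r → ∀ x, G.Adj (w : V) x →
          ∃ y : C, (y : V) = x ∧ (G.induce C).Adj w y := by
        intro w hw x hx
        have h1 : G.edist (u : V) w < r := lt_of_le_of_lt (edist_induce_ge G C u w) hw
        have h2 : G.edist (u : V) x ≤ r := by
          refine le_trans (SimpleGraph.edist_triangle (v := (w : V))) ?_
          rw [SimpleGraph.edist_eq_one_iff_adj.2 hx]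
          exact Order.add_one_le_of_lt h1
        have h3 := edist_triangle_le (SimpleGraph.edist_comm.trans_le hua) h2
        rw [← two_mul] at h3
        exact ⟨⟨x, hA a ha x h3⟩, rfl, hx⟩
      have key : ∀ o : Labeling G Vout Eout,
          cost P.Ψ r (G.induce C) ((inp.restrict C).prod (o.restrict C)) u =
            cost P.Ψ r G (inp.prod o) u := fun o =>
        cost_eq_of_lift (f := fun a : C => (a : V)) P.Ψ_iso hG Subtype.val_injective
          (fun _ _ h => h) hlift (fun _ => rfl) fun _ _ _ => rfl
      rw [key, key]
    · push Not at hu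
      rw [cost_eq_of_isRelabeling P.Ψ inp h fun a ha => not_le.2 (hu a ha),
        cost_eq_of_isRelabeling P.Ψ (inp.restrict C) hC, sub_self, sub_self]
      intro a ha hua
      exact absurd ((edist_induce_ge G C u a).trans hua) (not_le.2 (hu a ha))
  · intro u _ hu
    rw [cost_eq_of_isRelabeling P.Ψ inp h, sub_self]
    intro a ha hua
    refine hu ?_
    simp only [Finset.mem_filter, Finset.mem_univ, true_and]
    refine hA a ha u ?_
    rw [SimpleGraph.edist_comm]
    exact hua.trans (by exact_mod_cast (by omega : r ≤ 2 * r))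

end LOP

/-! ### Ball growing: improving sets of small diameter -/

section BallGrowing

/-- A nonnegative quantity that is bounded by less than `(1 + ε) ^ J` cannot grow by a factor
`1 + ε` in each of `J` steps. -/
theorem exists_slow_growth {f : ℕ → ℝ} {ε B : ℝ} {J : ℕ} (hε : 0 ≤ ε) (h0 : 1 ≤ f 0)
    (hB : ∀ j, f j ≤ B) (hJ : B < (1 + ε) ^ J) : ∃ j < J, f (j + 1) ≤ (1 + ε) * f j := by
  by_contra! h
  have key : ∀ j ≤ J, (1 + ε) ^ j ≤ f j := by
    intro j
    induction j with
    | zero => intro _; simpa using h0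
    | succ j ih =>
      intro hj
      refine le_trans ?_ (h j (by omega)).le
      rw [pow_succ, mul_comm]
      exact mul_le_mul_of_nonneg_left (ih (by omega)) (by linarith)
  linarith [key J le_rfl, hB J]

variable {V N H : Type} {G : SimpleGraph V}

theorem AgreeAt.symm {l l' : Labeling G N H} {v : V} (h : AgreeAt l l' v) : AgreeAt l' l v :=
  ⟨h.1.symm, fun w hw => (h.2 w hw).symm⟩

theorem AgreeAt.trans {l l' l'' : Labeling G N H} {v : V} (h : AgreeAt l l' v)
    (h' : AgreeAt l' l'' v) : AgreeAt l l'' v :=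
  ⟨h'.1.trans h.1, fun w hw => (h'.2 w hw).trans (h.2 w hw)⟩

theorem AgreeAt.refl (l : Labeling G N H) (v : V) : AgreeAt l l v := ⟨rfl, fun _ _ => rfl⟩

open Classical in
/-- The labeling that equals `l'` on `X` (and the half-edges incident to `X`) and `l` elsewhere. -/
noncomputable def Labeling.mix (X : Set V) (l l' : Labeling G N H) : Labeling G N H where
  node v := if v ∈ X then l'.node v else l.node v
  half v w h := if v ∈ X then l'.half v w h else l.half v w h

theorem mix_agreeAt_of_mem {X : Set V} {v : V} (h : v ∈ X) (l l' : Labeling G N H) :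
    AgreeAt l' (Labeling.mix X l l') v := by
  constructor <;> simp [Labeling.mix, h]

theorem mix_agreeAt_of_notMem {X : Set V} {v : V} (h : v ∉ X) (l l' : Labeling G N H) :
    AgreeAt l (Labeling.mix X l l') v := by
  constructor <;> simp [Labeling.mix, h]

theorem isRelabeling_mix (X : Set V) (l l' : Labeling G N H) :
    IsRelabeling X l (Labeling.mix X l l') := fun _ hv => mix_agreeAt_of_notMem hv l l'

/-- Node costs `c` with values in `[0, M]` that are determined by the labels in the radius-`r`
neighborhood, in a graph whose radius-`r` neighborhoods have at most `b` nodes. -/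
structure IsLocalCost (c : Labeling G N H → V → ℝ) (r : ℕ) (M : ℝ) (b : ℕ) : Prop where
  nonneg : ∀ l u, 0 ≤ c l u
  le : ∀ l u, c l u ≤ M
  congr : ∀ l l' u, (∀ w, G.edist u w ≤ r → AgreeAt l l' w) → c l u = c l' u
  ncard_le : ∀ v, {u | G.edist v u ≤ r}.ncard ≤ b

/-- The decrease of the sum of the costs. -/
def drop [Fintype V] (c : Labeling G N H → V → ℝ) (l l' : Labeling G N H) : ℝ :=
  ∑ v, (c l v - c l' v)

namespace IsLocalCost

variable {c : Labeling G N H → V → ℝ} {r : ℕ} {M : ℝ} {b : ℕ}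

theorem bound_nonneg (hc : IsLocalCost c r M b) (l : Labeling G N H) (v : V) : 0 ≤ M :=
  (hc.nonneg l v).trans (hc.le l v)

variable [Fintype V]

open Classical in
theorem card_near_le (hc : IsLocalCost c r M b) (S : Finset V) :
    (Finset.univ.filter fun u => ∃ a ∈ S, G.edist u a ≤ r).card ≤ b * S.card := by
  have hsub : (Finset.univ.filter fun u => ∃ a ∈ S, G.edist u a ≤ r) ⊆
      S.biUnion fun a => Finset.univ.filter fun u => G.edist a u ≤ r := by
    intro u hu
    simp only [Finset.mem_filter, Finset.mem_univ, true_and, Finset.mem_biUnion] at hu ⊢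
    obtain ⟨a, ha, h⟩ := hu
    exact ⟨a, ha, by rwa [SimpleGraph.edist_comm]⟩
  refine (Finset.card_le_card hsub).trans ?_
  rw [mul_comm]
  refine Finset.card_biUnion_le_card_mul _ _ _ fun a _ => ?_
  have := hc.ncard_le a
  rwa [Set.ncard_eq_toFinset_card', show {u | G.edist a u ≤ r}.toFinset =
    Finset.univ.filter fun u => G.edist a u ≤ r by ext; simp] at this

/-- If `Y` is the union of `Z`, `S`, `W`, and `Z` and `W` are far apart, then relabeling `Z` and
relabeling `W` separately is as good as relabeling `Y` up to a loss proportional to `|S|`. -/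
theorem drop_mix_le (hc : IsLocalCost c r M b) (l l' : Labeling G N H) {Y Z S W : Finset V}
    (hY : ∀ x, x ∈ Y ↔ x ∈ Z ∨ x ∈ S ∨ x ∈ W)
    (hZW : ∀ z ∈ Z, ∀ w ∈ W, ¬ G.edist z w ≤ (r + r : ℕ)) :
    drop c l (Labeling.mix Y l l') ≤ drop c l (Labeling.mix Z l l') +
      drop c l (Labeling.mix W l l') + 3 * M * b * S.card := by
  classical
  have hpoint : ∀ u, c l u - c (Labeling.mix Y l l') u ≤
      (c l u - c (Labeling.mix Z l l') u) + (c l u - c (Labeling.mix W l l') u) +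
        if ∃ a ∈ S, G.edist u a ≤ r then 3 * M else 0 := by
    intro u
    split_ifs with hS
    · linarith [hc.nonneg l u, hc.nonneg (Labeling.mix Y l l') u, hc.le l u,
        hc.le (Labeling.mix Z l l') u, hc.le (Labeling.mix W l l') u]
    · push Not at hS
      have hnS : ∀ x, G.edist u x ≤ r → x ∉ S := fun x hx hxS => absurd hx (not_le.2 (hS x hxS))
      -- Only one of `Z` and `W` can be within distance `r` of `u`.
      have aux : ∀ X X' : Finset V, (∀ x, x ∈ Y ↔ x ∈ X ∨ x ∈ S ∨ x ∈ X') →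
          (∀ x, G.edist u x ≤ r → x ∉ X') →
          c (Labeling.mix Y l l') u = c (Labeling.mix X l l') u ∧
            c (Labeling.mix X' l l') u = c l u := by
        intro X X' hX hX'
        constructor
        · apply hc.congr
          intro x hx
          by_cases hxX : x ∈ X
          · exact (mix_agreeAt_of_mem (X := (Y : Set V)) ((hX x).2 (Or.inl hxX)) l l').symm.trans
              (mix_agreeAt_of_mem (X := (X : Set V)) hxX l l')
          · have hxY : x ∉ Y := by
              rw [hX]
              rintro (h | h | h)
              exacts [hxX h, hnS x hx h, hX' x hx h]
            exact (mix_agreeAt_of_notMem (X := (Y : Set V)) hxY l l').symm.trans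
              (mix_agreeAt_of_notMem (X := (X : Set V)) hxX l l')
        · apply hc.congr
          intro x hx
          exact (mix_agreeAt_of_notMem (X := (X' : Set V)) (hX' x hx) l l').symm
      by_cases hW : ∀ x, G.edist u x ≤ r → x ∉ W
      · obtain ⟨h1, h2⟩ := aux Z W hY hW
        linarith
      · push Not at hW
        obtain ⟨w, hw, hwW⟩ := hW
        have hZ : ∀ x, G.edist u x ≤ r → x ∉ Z := fun x hx hxZ =>
          hZW x hxZ w hwW (edist_triangle_le (SimpleGraph.edist_comm.trans_le hx) hw)
        obtain ⟨h1, h2⟩ := aux W Z (fun x => by rw [hY]; tauto) hZ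
        linarith
  have hsum := Finset.sum_le_sum fun u (_ : u ∈ Finset.univ) => hpoint u
  rw [Finset.sum_add_distrib, Finset.sum_add_distrib, ← Finset.sum_filter, Finset.sum_const,
    nsmul_eq_mul] at hsum
  rcases isEmpty_or_nonempty V with hV | ⟨⟨v⟩⟩
  · simp [drop, Finset.eq_empty_of_isEmpty]
  have hcard : (((Finset.univ.filter fun u => ∃ a ∈ S, G.edist u a ≤ r).card : ℕ) : ℝ) ≤
      b * S.card := by exact_mod_cast hc.card_near_le S
  have hM := hc.bound_nonneg l v
  have : (((Finset.univ.filter fun u => ∃ a ∈ S, G.edist u a ≤ r).card : ℕ) : ℝ) * (3 * M) ≤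
      (b * S.card) * (3 * M) := mul_le_mul_of_nonneg_right hcard (by linarith)
  unfold drop
  linarith

/-- An improving set contains an improving set of small diameter and nearly the same ratio: cut
off a ball with a small boundary; either it is good enough, or the rest is at least as good as
the entire set was. -/
theorem exists_small_diameter (hc : IsLocalCost c r M b) (l l' : Labeling G N H) {ε R : ℝ}
    {J : ℕ} (hε : 0 ≤ ε) (hR : 0 ≤ R) (hJ : (Fintype.card V : ℝ) < (1 + ε) ^ J) :
    ∀ Y : Finset V, Y.Nonempty →
      (R + 3 * M * b * ε) * Y.card ≤ drop c l (Labeling.mix Y l l') →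
      ∃ Z ⊆ Y, Z.Nonempty ∧ (∀ x ∈ Z, ∀ y ∈ Z, G.edist x y ≤ (J * (r + r) + J * (r + r) : ℕ)) ∧
        R * Z.card ≤ drop c l (Labeling.mix Z l l') := by
  classical
  intro Y
  induction Y using Finset.strongInduction with
  | H Y ih =>
  rintro ⟨y, hy⟩ hdrop
  have hM := hc.bound_nonneg l y
  let f : ℕ → ℝ := fun j => ((Y.filter fun z => G.edist y z ≤ (j * (r + r) : ℕ)).card : ℝ)
  obtain ⟨j, hjJ, hj⟩ : ∃ j < J, f (j + 1) ≤ (1 + ε) * f j := by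
    refine exists_slow_growth hε ?_ (fun j => ?_) hJ
    · have : y ∈ Y.filter fun z => G.edist y z ≤ (0 * (r + r) : ℕ) := by
        simp [hy]
      exact Nat.one_le_cast.2 (Finset.card_pos.2 ⟨y, this⟩)
    · exact Nat.cast_le.2 (Finset.card_le_univ _)
  let Z := Y.filter fun z => G.edist y z ≤ (j * (r + r) : ℕ)
  let S := Y.filter fun z => G.edist y z ≤ ((j + 1) * (r + r) : ℕ) ∧
    ¬ G.edist y z ≤ (j * (r + r) : ℕ)
  let W := Y.filter fun z => ¬ G.edist y z ≤ ((j + 1) * (r + r) : ℕ)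
  have hmono : ∀ z, G.edist y z ≤ (j * (r + r) : ℕ) → G.edist y z ≤ ((j + 1) * (r + r) : ℕ) :=
    fun z hz => hz.trans (by exact_mod_cast Nat.mul_le_mul_right _ (Nat.le_succ j))
  have hyZ : y ∈ Z := by simp [Z, hy]
  have hZS : f (j + 1) = Z.card + S.card := by
    have : (Y.filter fun z => G.edist y z ≤ ((j + 1) * (r + r) : ℕ)) = Z ∪ S := by
      ext z
      simp only [Z, S, Finset.mem_union, Finset.mem_filter]
      have := hmono z
      tauto
    have hdisj : Disjoint Z S := by
      rw [Finset.disjoint_left]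
      intro z hz hz'
      exact (Finset.mem_filter.1 hz').2.2 (Finset.mem_filter.1 hz).2
    have h2 := Finset.card_union_of_disjoint hdisj
    rw [← this] at h2
    simp only [f]
    exact_mod_cast h2
  have hYcard : (Y.card : ℝ) = Z.card + S.card + W.card := by
    rw [← hZS]
    have := Finset.card_filter_add_card_filter_not (s := Y)
      (fun z => G.edist y z ≤ ((j + 1) * (r + r) : ℕ))
    rw [← this, Nat.cast_add]
  have hfj : f j = Z.card := rfl
  by_cases hZ : R * Z.card ≤ drop c l (Labeling.mix Z l l')
  · refine ⟨Z, Finset.filter_subset _ _, ⟨y, hyZ⟩, ?_, hZ⟩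
    intro x hx x' hx'
    have h1 := (Finset.mem_filter.1 hx).2
    rw [SimpleGraph.edist_comm] at h1
    refine (edist_triangle_le h1 (Finset.mem_filter.1 hx').2).trans ?_
    exact_mod_cast Nat.add_le_add (Nat.mul_le_mul_right _ hjJ.le) (Nat.mul_le_mul_right _ hjJ.le)
  · have hle := hc.drop_mix_le l l' (Y := Y) (Z := Z) (S := S) (W := W) ?_ ?_
    · have hSε : (S.card : ℝ) ≤ ε * Z.card := by rw [hZS, hfj] at hj; linarith
      have hK : 0 ≤ 3 * M * b := by positivity
      have h1 : 3 * M * b * S.card ≤ 3 * M * b * (ε * Z.card) :=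
        mul_le_mul_of_nonneg_left hSε hK
      have h2 : 0 ≤ (R + 3 * M * b * ε) * S.card := by positivity
      rw [hYcard] at hdrop
      have hW : (R + 3 * M * b * ε) * W.card < drop c l (Labeling.mix W l l') := by
        push Not at hZ
        nlinarith
      have hWY : W ⊂ Y := by
        refine Finset.ssubset_iff_subset_ne.2 ⟨Finset.filter_subset _ _, fun h => ?_⟩
        rw [← h] at hy
        exact (Finset.mem_filter.1 hy).2 (by simp)
      have hWne : W.Nonempty := by
        by_contra hne
        rw [Finset.not_nonempty_iff_eq_empty] at hne
        have : drop c l (Labeling.mix W l l') = 0 := by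
          refine Finset.sum_eq_zero fun u _ => sub_eq_zero.2 (hc.congr _ _ _ fun w _ => ?_)
          exact mix_agreeAt_of_notMem (by simp [hne]) l l'
        rw [this, hne] at hW
        simp at hW
      obtain ⟨Z', hZ', h⟩ := ih W hWY hWne hW.le
      exact ⟨Z', hZ'.trans (Finset.filter_subset _ _), h⟩
    · intro z
      simp only [Z, S, W, Finset.mem_filter]
      have := hmono z
      tauto
    · intro z hz w hw h
      refine (Finset.mem_filter.1 hw).2 ((edist_triangle_le (Finset.mem_filter.1 hz).2 h).trans ?_)
      exact_mod_cast (by ring_nf; exact le_rfl : j * (r + r) + (r + r) ≤ (j + 1) * (r + r))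

end IsLocalCost

end BallGrowing

/-! ### Sequences of improvements -/

section Sequences

variable {V N H : Type} {G : SimpleGraph V}

/-- A sequence of successive relabelings from one labeling to another, given by the list of the
relabeled sets: each set has improving ratio at least `R` and diameter at most `D`. -/
inductive Run [Fintype V] (c : Labeling G N H → V → ℝ) (R : ℝ) (D : ℕ) :
    List (Finset V) → Labeling G N H → Labeling G N H → Prop
  | nil (l : Labeling G N H) : Run c R D [] l l
  | cons {A : Finset V} {L : List (Finset V)} {l l' l'' : Labeling G N H} :
      IsRelabeling (A : Set V) l l' → R * A.card ≤ drop c l l' →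
      (∀ x ∈ A, ∀ y ∈ A, G.edist x y ≤ D) → Run c R D L l' l'' → Run c R D (A :: L) l l''

open Classical in
/-- The total size of the sets of the list `L` that satisfy `p`. -/
noncomputable def mass (p : Finset V → Prop) : List (Finset V) → ℝ
  | [] => 0
  | A :: L => (if p A then (A.card : ℝ) else 0) + mass p L

theorem mass_mono {p q : Finset V → Prop} (h : ∀ A, p A → q A) (L : List (Finset V)) :
    mass p L ≤ mass q L := by
  induction L with
  | nil => exact le_rfl
  | cons A L ih =>
    simp only [mass]
    refine add_le_add ?_ ih
    by_cases hp : p A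
    · simp [hp, h A hp]
    · rw [if_neg hp]; split_ifs <;> positivity

theorem mass_nonneg (p : Finset V → Prop) (L : List (Finset V)) : 0 ≤ mass p L := by
  induction L with
  | nil => exact le_rfl
  | cons A L ih =>
    simp only [mass]
    split_ifs <;> positivity

theorem mass_add (p q : Finset V → Prop) (hpq : ∀ A, p A → q A) (L : List (Finset V)) :
    mass p L + mass (fun A => q A ∧ ¬ p A) L = mass q L := by
  induction L with
  | nil => simp [mass]
  | cons A L ih =>
    simp only [mass]
    rw [← ih]
    by_cases hp : p A
    · simp [hp, hpq A hp]; ring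
    · by_cases hq : q A <;> simp [hp, hq]
      ring

theorem one_le_mass {p : Finset V → Prop} {A : Finset V} (hA : A.Nonempty) (hp : p A)
    {L : List (Finset V)} (hL : A ∈ L) : 1 ≤ mass p L := by
  induction L with
  | nil => simp at hL
  | cons B L ih =>
    simp only [mass]
    rcases List.mem_cons.1 hL with rfl | hL
    · rw [if_pos hp]
      have : (1 : ℝ) ≤ A.card := by exact_mod_cast hA.card_pos
      linarith [mass_nonneg p L]
    · have := ih hL
      split_ifs
      · have : (0 : ℝ) ≤ B.card := by positivity
        linarith
      · linarith

open Classical in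
theorem card_filter_exists_mem_le [Fintype V] (p : Finset V → Prop) (L : List (Finset V)) :
    ((Finset.univ.filter fun u => ∃ A ∈ L, p A ∧ u ∈ A).card : ℝ) ≤ mass p L := by
  induction L with
  | nil => simp [mass]
  | cons A L ih =>
    simp only [mass]
    have hsub : (Finset.univ.filter fun u => ∃ B ∈ A :: L, p B ∧ u ∈ B) ⊆
        (if p A then A else ∅) ∪ Finset.univ.filter fun u => ∃ B ∈ L, p B ∧ u ∈ B := by
      intro u hu
      simp only [Finset.mem_filter, Finset.mem_univ, true_and, List.mem_cons,
        Finset.mem_union] at hu ⊢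
      obtain ⟨B, rfl | hB, hp, huB⟩ := hu
      · left; rwa [if_pos hp]
      · exact Or.inr ⟨B, hB, hp, huB⟩
    have h1 := (Finset.card_le_card hsub).trans (Finset.card_union_le _ _)
    have h2 : ((if p A then A else ∅ : Finset V).card : ℝ) = if p A then (A.card : ℝ) else 0 := by
      split_ifs <;> simp
    rw [← h2]
    calc _ ≤ (((if p A then A else ∅ : Finset V).card +
          (Finset.univ.filter fun u => ∃ B ∈ L, p B ∧ u ∈ B).card : ℕ) : ℝ) := Nat.cast_le.2 h1
      _ ≤ _ := by rw [Nat.cast_add]; gcongr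

namespace Run

variable [Fintype V] {c : Labeling G N H → V → ℝ} {R : ℝ} {D : ℕ}

theorem append {L L' : List (Finset V)} {l l' l'' : Labeling G N H} (h : Run c R D L l l')
    (h' : Run c R D L' l' l'') : Run c R D (L ++ L') l l'' := by
  induction h with
  | nil => exact h'
  | cons h1 h2 h3 _ ih => exact cons h1 h2 h3 (ih h')

theorem mono {R' : ℝ} (hR : R' ≤ R) {L : List (Finset V)} {l l' : Labeling G N H}
    (h : Run c R D L l l') : Run c R' D L l l' := by
  induction h with
  | nil => exact nil _
  | cons h1 h2 h3 _ ih =>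
    exact cons h1 ((mul_le_mul_of_nonneg_right hR (by positivity)).trans h2) h3 ih

theorem diam {L : List (Finset V)} {l l' : Labeling G N H} (h : Run c R D L l l') :
    ∀ A ∈ L, ∀ x ∈ A, ∀ y ∈ A, G.edist x y ≤ D := by
  induction h with
  | nil => simp
  | cons _ _ h3 _ ih =>
    intro A hA
    rcases List.mem_cons.1 hA with rfl | hA
    exacts [h3, ih A hA]

theorem isRelabeling {L : List (Finset V)} {l l' : Labeling G N H} (h : Run c R D L l l') :
    IsRelabeling {u | ∃ A ∈ L, u ∈ A} l l' := by
  induction h with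
  | nil => exact fun _ _ => AgreeAt.refl _ _
  | cons h1 _ _ _ ih =>
    intro u hu
    refine AgreeAt.trans (h1 u fun hA => hu ⟨_, by simp, hA⟩) (ih u ?_)
    rintro ⟨A, hA, huA⟩
    exact hu ⟨A, by simp [hA], huA⟩

theorem drop_eq (l l' l'' : Labeling G N H) : drop c l l'' = drop c l l' + drop c l' l'' := by
  rw [drop, drop, drop, ← Finset.sum_add_distrib]
  exact Finset.sum_congr rfl fun _ _ => by ring

theorem mul_mass_le_drop {L : List (Finset V)} {l l' : Labeling G N H} (h : Run c R D L l l') :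
    R * mass (fun _ => True) L ≤ drop c l l' := by
  induction h with
  | nil => simp [mass, drop]
  | @cons A L l l' l'' _ h2 _ _ ih =>
    rw [drop_eq l l' l'']
    simp only [mass, if_true, mul_add]
    exact add_le_add h2 ih

variable {r : ℕ} {M : ℝ} {b : ℕ}

theorem mass_le (hc : IsLocalCost c r M b) (hR : 0 < R) {L : List (Finset V)}
    {l l' : Labeling G N H} (h : Run c R D L l l') (p : Finset V → Prop) :
    mass p L ≤ M * Fintype.card V / R := by
  rw [le_div_iff₀' hR]
  refine (mul_le_mul_of_nonneg_left (mass_mono (fun _ _ => trivial) L) hR.le).trans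
    (h.mul_mass_le_drop.trans ?_)
  calc drop c l l' ≤ ∑ _v : V, M := Finset.sum_le_sum fun u _ => by
        linarith [hc.nonneg l' u, hc.le l u]
    _ = M * Fintype.card V := by simp [mul_comm]

open Classical in
/-- The sets that meet the ball of radius `x` contribute their entire improvement to the costs in
the slightly larger ball `U`; the other sets contribute to the costs in `U` only if they are close
to it, and then by an amount that is proportional to their size. -/
theorem le_sum_ball (hc : IsLocalCost c r M b) (v : V) (x : ℕ) {L : List (Finset V)}
    {l l' : Labeling G N H} (h : Run c R D L l l') :
    R * mass (fun A => ∃ a ∈ A, G.edist v a ≤ x) L -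
      M * b * mass (fun A => (∃ a ∈ A, G.edist v a ≤ (x + (D + 2 * r) : ℕ)) ∧
        ¬ ∃ a ∈ A, G.edist v a ≤ x) L ≤
      ∑ u with G.edist v u ≤ (x + D + r : ℕ), (c l u - c l' u) := by
  have hM := hc.bound_nonneg l v
  induction h with
  | nil => simp [mass]
  | @cons A L l l' l'' h1 h2 h3 h4 ih =>
    have hsplit : ∑ u with G.edist v u ≤ (x + D + r : ℕ), (c l u - c l'' u) =
        ∑ u with G.edist v u ≤ (x + D + r : ℕ), (c l u - c l' u) +
          ∑ u with G.edist v u ≤ (x + D + r : ℕ), (c l' u - c l'' u) := by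
      rw [← Finset.sum_add_distrib]
      exact Finset.sum_congr rfl fun _ _ => by ring
    have hfar : ∀ u, (∀ a ∈ A, ¬ G.edist u a ≤ r) → c l u - c l' u = 0 := fun u hu =>
      sub_eq_zero.2 (hc.congr _ _ _ fun w hw => h1 w fun hwA => hu w hwA hw)
    simp only [mass]
    rw [hsplit]
    by_cases hin : ∃ a ∈ A, G.edist v a ≤ x
    · have : ∑ u with G.edist v u ≤ (x + D + r : ℕ), (c l u - c l' u) = drop c l l' := by
        refine Finset.sum_subset (Finset.subset_univ _) fun u _ hu => hfar u fun a ha hua => hu ?_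
        obtain ⟨a', ha', hva'⟩ := hin
        simp only [Finset.mem_filter, Finset.mem_univ, true_and]
        exact edist_triangle_le (edist_triangle_le hva' (h3 a' ha' a ha))
          (SimpleGraph.edist_comm.trans_le hua)
      rw [this, if_pos hin, if_neg (fun h => h.2 hin)]
      linarith
    · rw [if_neg hin]
      by_cases hnear : ∃ a ∈ A, G.edist v a ≤ (x + (D + 2 * r) : ℕ)
      · rw [if_pos ⟨hnear, hin⟩]
        have h5 : ∑ u with G.edist v u ≤ (x + D + r : ℕ), (c l u - c l' u) ≥ -(M * b * A.card) := by
          calc ∑ u with G.edist v u ≤ (x + D + r : ℕ), (c l u - c l' u)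
              ≥ ∑ u with G.edist v u ≤ (x + D + r : ℕ),
                  -(if ∃ a ∈ A, G.edist u a ≤ r then M else 0) := by
                refine Finset.sum_le_sum fun u _ => ?_
                split_ifs with h
                · linarith [hc.nonneg l u, hc.le l' u]
                · rw [hfar u fun a ha hua => h ⟨a, ha, hua⟩, neg_zero]
            _ = -∑ u with G.edist v u ≤ (x + D + r : ℕ),
                  if ∃ a ∈ A, G.edist u a ≤ r then M else 0 := Finset.sum_neg_distrib _
            _ ≥ -∑ u, if ∃ a ∈ A, G.edist u a ≤ r then M else 0 := by
                refine neg_le_neg (Finset.sum_le_sum_of_subset_of_nonneg (Finset.subset_univ _)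
                  fun u _ _ => ?_)
                split_ifs <;> linarith
            _ = -(M * (Finset.univ.filter fun u => ∃ a ∈ A, G.edist u a ≤ r).card) := by
                rw [← Finset.sum_filter, Finset.sum_const, nsmul_eq_mul, mul_comm]
            _ ≥ -(M * b * A.card) := by
                have : (((Finset.univ.filter fun u => ∃ a ∈ A, G.edist u a ≤ r).card : ℕ) : ℝ) ≤
                  b * A.card := by exact_mod_cast hc.card_near_le A
                have := mul_le_mul_of_nonneg_left this hM
                linarith
        linarith
      · rw [if_neg (fun h => hnear h.1)]
        have : ∑ u with G.edist v u ≤ (x + D + r : ℕ), (c l u - c l' u) = 0 := by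
          refine Finset.sum_eq_zero fun u hu => hfar u fun a ha hua => hnear ⟨a, ha, ?_⟩
          have := edist_triangle_le (Finset.mem_filter.1 hu).2 hua
          rwa [show x + D + r + r = x + (D + 2 * r) by ring] at this
        rw [this]
        linarith

open Classical in
/-- Around any node that is relabeled in a sequence of improvements, relabeling a ball from the
first to the last labeling has nearly the same improving ratio as the sequence, provided that the
sets of the sequence that touch only the boundary of the ball are small in total. -/
theorem exists_ball (hc : IsLocalCost c r M b) {ε : ℝ} {J : ℕ} (hε : 0 ≤ ε) (hR : 0 < R)
    (hεR : (3 * M * b + R) * ε ≤ R) {L : List (Finset V)} {l l' : Labeling G N H}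
    (h : Run c R D L l l') {v : V} {A : Finset V} (hA : A ∈ L) (hv : v ∈ A)
    (hJ : M * Fintype.card V / R < (1 + ε) ^ J) :
    ∃ Y : Finset V, Y.Nonempty ∧ (∀ y ∈ Y, G.edist v y ≤ (J * (D + 2 * r) + D + r : ℕ)) ∧
      (R - (3 * M * b + R) * ε) * Y.card ≤ drop c l (Labeling.mix Y l l') := by
  let f : ℕ → ℝ := fun j =>
    mass (fun A => ∃ a ∈ A, G.edist v a ≤ (j * (D + 2 * r) : ℕ)) L
  obtain ⟨j, hjJ, hj⟩ : ∃ j < J, f (j + 1) ≤ (1 + ε) * f j := by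
    refine exists_slow_growth hε (one_le_mass ⟨v, hv⟩ ⟨v, hv, ?_⟩ hA)
      (fun j => h.mass_le hc hR _) hJ
    rw [SimpleGraph.edist_self]; exact zero_le
  set x := j * (D + 2 * r) with hx
  let inner : Finset V → Prop := fun A => ∃ a ∈ A, G.edist v a ≤ x
  let near : Finset V → Prop := fun A => ∃ a ∈ A, G.edist v a ≤ (x + (D + 2 * r) : ℕ)
  let shell : Finset V → Prop := fun A => near A ∧ ¬ inner A
  have hin_near : ∀ A, inner A → near A := fun A ⟨a, ha, hva⟩ =>
    ⟨a, ha, hva.trans (by exact_mod_cast Nat.le_add_right _ _)⟩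
  have hadd : mass inner L + mass shell L = mass near L := mass_add inner near hin_near L
  have hfj : f j = mass inner L := rfl
  have hfj' : f (j + 1) = mass near L := by simp only [f, near, Nat.succ_mul, hx]
  have hshell : mass shell L ≤ ε * mass inner L := by rw [hfj, hfj'] at hj; linarith
  let Y : Finset V := Finset.univ.filter fun u =>
    G.edist v u ≤ (x + D + r : ℕ) ∧ ∃ A ∈ L, u ∈ A
  have hM := hc.bound_nonneg l v
  have hvx : G.edist v v ≤ x := by rw [SimpleGraph.edist_self]; exact zero_le
  refine ⟨Y, ⟨v, ?_⟩, ?_, ?_⟩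
  · simp only [Y, Finset.mem_filter, Finset.mem_univ, true_and]
    exact ⟨hvx.trans (by exact_mod_cast (by omega : x ≤ x + D + r)), A, hA, hv⟩
  · intro y hy
    refine (Finset.mem_filter.1 hy).2.1.trans ?_
    have : x ≤ J * (D + 2 * r) := Nat.mul_le_mul_right _ hjJ.le
    exact_mod_cast (by omega : x + D + r ≤ J * (D + 2 * r) + D + r)
  have hYcard : (Y.card : ℝ) ≤ mass near L := by
    refine le_trans (Nat.cast_le.2 (Finset.card_le_card ?_)) (card_filter_exists_mem_le near L)
    intro u hu
    simp only [Y, Finset.mem_filter, Finset.mem_univ, true_and] at hu ⊢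
    obtain ⟨hu1, A, hA, huA⟩ := hu
    exact ⟨A, hA, ⟨u, huA, hu1.trans (by exact_mod_cast (by omega))⟩, huA⟩
  -- Only the costs of nodes near a shell set can differ from the costs at both ends of the run.
  let S : Finset V := Finset.univ.filter fun u => ∃ A ∈ L, shell A ∧ u ∈ A
  have hScard : (S.card : ℝ) ≤ mass shell L := by
    convert card_filter_exists_mem_le shell L
  have hrel := h.isRelabeling
  have hpoint : ∀ u, (if G.edist v u ≤ (x + D + r : ℕ) then c l u - c l' u else 0) -
      (if ∃ a ∈ S, G.edist u a ≤ r then 2 * M else 0) ≤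
        c l u - c (Labeling.mix Y l l') u := by
    intro u
    by_cases hS : ∃ a ∈ S, G.edist u a ≤ r
    · rw [if_pos hS]
      have := hc.nonneg l u
      have := hc.nonneg l' u
      have := hc.le l u
      have := hc.le (Labeling.mix Y l l') u
      split_ifs <;> linarith
    · rw [if_neg hS]
      have hnS : ∀ w, G.edist u w ≤ r → ∀ A ∈ L, w ∈ A → near A → inner A := by
        intro w hw A hA hwA hnear
        by_contra hin
        exact hS ⟨w, by simp only [S, Finset.mem_filter, Finset.mem_univ, true_and]
                        exact ⟨A, hA, ⟨hnear, hin⟩, hwA⟩, hw⟩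
      split_ifs with hu
      · have : c (Labeling.mix Y l l') u = c l' u := by
          refine hc.congr _ _ _ fun w hw => ?_
          by_cases hwY : w ∈ (Y : Set V)
          · exact (mix_agreeAt_of_mem hwY l l').symm
          · refine (mix_agreeAt_of_notMem hwY l l').symm.trans (hrel w ?_)
            rintro ⟨A, hA, hwA⟩
            have hvw := edist_triangle_le hu hw
            rw [show x + D + r + r = x + (D + 2 * r) by ring] at hvw
            obtain ⟨a, ha, hva⟩ := hnS w hw A hA hwA ⟨w, hwA, hvw⟩
            have := edist_triangle_le hva (h.diam A hA a ha w hwA)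
            apply hwY
            simp only [Y, Finset.coe_filter, Finset.mem_univ, true_and, Set.mem_ofPred_eq]
            exact ⟨this.trans (by exact_mod_cast Nat.le_add_right _ _), A, hA, hwA⟩
        rw [this, sub_zero]
      · have : c (Labeling.mix Y l l') u = c l u := by
          refine hc.congr _ _ _ fun w hw => ?_
          refine (mix_agreeAt_of_notMem (fun hwY => hu ?_) l l').symm
          simp only [Y, Finset.coe_filter, Finset.mem_univ, true_and, Set.mem_ofPred_eq] at hwY
          obtain ⟨hvw, A, hA, hwA⟩ := hwY
          obtain ⟨a, ha, hva⟩ := hnS w hw A hA hwA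
            ⟨w, hwA, hvw.trans (by exact_mod_cast (by omega))⟩
          exact edist_triangle_le (edist_triangle_le hva (h.diam A hA a ha w hwA))
            (SimpleGraph.edist_comm.trans_le hw)
        rw [this]
        simp
  have hsum := Finset.sum_le_sum fun u (_ : u ∈ Finset.univ) => hpoint u
  rw [Finset.sum_sub_distrib, ← Finset.sum_filter, ← Finset.sum_filter, Finset.sum_const,
    nsmul_eq_mul] at hsum
  have hball := h.le_sum_ball hc v x
  have hcard : (((Finset.univ.filter fun u => ∃ a ∈ S, G.edist u a ≤ r).card : ℕ) : ℝ) ≤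
      b * mass shell L := by
    refine le_trans ?_ (mul_le_mul_of_nonneg_left hScard (by positivity))
    exact_mod_cast hc.card_near_le S
  have h1 : R * mass inner L - M * b * mass shell L - (b * mass shell L) * (2 * M) ≤
      drop c l (Labeling.mix Y l l') := by
    have := mul_le_mul_of_nonneg_right hcard (by linarith : 0 ≤ 2 * M)
    unfold drop
    linarith
  have h2 : 3 * M * b * mass shell L ≤ 3 * M * b * (ε * mass inner L) :=
    mul_le_mul_of_nonneg_left hshell (by positivity)
  have hmin := mass_nonneg inner L
  have h3 : (R - (3 * M * b + R) * ε) * Y.card ≤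
      (R - (3 * M * b + R) * ε) * ((1 + ε) * mass inner L) :=
    mul_le_mul_of_nonneg_left (by linarith) (by linarith)
  have h4 : 0 ≤ (3 * M * b + R) * ε * ε * mass inner L := by positivity
  nlinarith

end Run

end Sequences

/-! ### A phase as a sequence of improvements, and correctness of the result -/

open Classical in
/-- The labeling of `G` that equals `l` inside the cluster `C` and `B` elsewhere (in particular on
the half-edges of edges that leave `C`). -/
noncomputable def Labeling.overlay {V N H : Type} {G : SimpleGraph V} {C : Set V}
    (B : Labeling G N H) (l : Labeling (G.induce C) N H) : Labeling G N H where
  node v := if h : v ∈ C then l.node ⟨v, h⟩ else B.node v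
  half v w hvw := if h : v ∈ C ∧ w ∈ C then l.half ⟨v, h.1⟩ ⟨w, h.2⟩ hvw else B.half v w hvw

theorem restrict_overlay {V N H : Type} {G : SimpleGraph V} {C : Set V}
    (B : Labeling G N H) (l : Labeling (G.induce C) N H) : (B.overlay l).restrict C = l := by
  ext v
  · simp [Labeling.restrict, Labeling.overlay]
  · simp [Labeling.restrict, Labeling.overlay]

theorem edist_le_floor_of_dist_le {V : Type} {G : SimpleGraph V} {a b : V} {D : ℝ}
    (h : G.Reachable a b) (hD : (G.dist a b : ℝ) ≤ D) : G.edist a b ≤ (⌊D⌋₊ : ℕ) := by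
  rw [← h.coe_dist_eq_edist]
  exact_mod_cast Nat.le_floor hD

namespace LOP

variable {Vin Ein Vout Eout : Type} {r Δ : ℕ} {V : Type} [Fintype V] {G : SimpleGraph V}
  (P : LOP Vin Ein Vout Eout r Δ) (inp : Labeling G Vin Ein)

/-- The costs of the nodes as a function of the output labeling. -/
noncomputable def outCost (out : Labeling G Vout Eout) (v : V) : ℝ :=
  cost P.Ψ r G (inp.prod out) v

variable {P inp}

theorem drop_outCost (out out' : Labeling G Vout Eout) :
    drop (P.outCost inp) out out' = P.imp G inp out out' := by
  rw [imp, pot_eq_sum, pot_eq_sum, ← Finset.sum_sub_distrib]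
  rfl

theorem isLocalCost_outCost (hG : DegreeLE G Δ) {M : ℝ}
    (hM : ∀ l v, cost P.Ψ r G l v ≤ M) :
    IsLocalCost (P.outCost inp) r M ((Δ + 1) ^ r) where
  nonneg _ _ := cost_nonneg _ _
  le _ _ := hM _ _
  congr _ _ _ h := cost_congr fun w hw => (h w hw).prod
  ncard_le := ncard_ball_le hG r

theorem Step.run_overlay (hG : DegreeLE G Δ) {C : Set V} {R D : ℝ}
    {l l' : Labeling (G.induce C) Vout Eout} (B : Labeling G Vout Eout)
    (h : P.Step G inp C R D l l') :
    ∃ A : Finset V, Run (P.outCost inp) R ⌊D⌋₊ [A] (B.overlay l) (B.overlay l') := by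
  classical
  obtain ⟨A, ⟨hrel, hpot⟩, hratio, hcore, hdiam⟩ := h
  let A' : Finset V := A.map ⟨Subtype.val, Subtype.val_injective⟩
  have hmem : ∀ (a : V) (ha : a ∈ C), a ∈ A' ↔ ⟨a, ha⟩ ∈ A := by
    intro a ha
    simp [A', ha]
  have hA' : ∀ a ∈ A', ∃ ha : a ∈ C, ⟨a, ha⟩ ∈ A := by
    intro a ha
    obtain ⟨a', ha', rfl⟩ := Finset.mem_map.1 ha
    exact ⟨a'.2, ha'⟩
  have hrel' : IsRelabeling (A' : Set V) (B.overlay l) (B.overlay l') := by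
    intro v hv
    constructor
    · simp only [Labeling.overlay]
      split_ifs with hC
      · exact (hrel ⟨v, hC⟩ fun h => hv ((hmem v hC).2 h)).1
      · rfl
    · intro w hvw
      simp only [Labeling.overlay]
      split_ifs with hC
      · exact (hrel ⟨v, hC.1⟩ fun h => hv ((hmem v hC.1).2 h)).2 _ _
      · rfl
  refine ⟨A', Run.cons hrel' ?_ ?_ (Run.nil _)⟩
  · have himp := P.imp_induce hG inp (C := C) hrel' fun a ha u hu => by
      obtain ⟨haC, haA⟩ := hA' a ha
      exact hcore ⟨a, haC⟩ haA u (hu.trans (by exact_mod_cast Nat.le_succ _))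
    rw [restrict_overlay, restrict_overlay] at himp
    rw [drop_outCost, ← himp, Finset.card_map]
    have hpos : 0 < P.imp (G.induce C) (inp.restrict C) l l' := sub_pos.2 hpot
    rcases A.eq_empty_or_nonempty with rfl | hne
    · simpa using hpos.le
    · rwa [improvingRatio, le_div_iff₀ (by exact_mod_cast hne.card_pos)] at hratio
  · intro x hx y hy
    obtain ⟨hxC, hxA⟩ := hA' x hx
    obtain ⟨hyC, hyA⟩ := hA' y hy
    obtain ⟨h1, h2⟩ := hdiam _ hxA _ hyA
    exact edist_le_floor_of_dist_le h1 h2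

theorem exists_run_overlay (hG : DegreeLE G Δ) {C : Set V} {R D : ℝ}
    {l l' : Labeling (G.induce C) Vout Eout} (B : Labeling G Vout Eout)
    (h : Relation.ReflTransGen (P.Step G inp C R D) l l') :
    ∃ L, Run (P.outCost inp) R ⌊D⌋₊ L (B.overlay l) (B.overlay l') := by
  induction h with
  | refl => exact ⟨[], Run.nil _⟩
  | tail _ h ih =>
    obtain ⟨L, hL⟩ := ih
    obtain ⟨A, hA⟩ := h.run_overlay hG B
    exact ⟨_, hL.append hA⟩

/-- A phase is a sequence of improvements: the clusters can be processed one after the other. -/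
theorem Phase.exists_run (hG : DegreeLE G Δ) {s : V → ℝ} {R D : ℝ}
    {out out' : Labeling G Vout Eout} (h : P.Phase G inp s R D out out') :
    ∃ L, Run (P.outCost inp) R ⌊D⌋₊ L out out' := by
  classical
  obtain ⟨center, -, hmax, hcross⟩ := h
  have key : ∀ T : Finset V, ∃ L, Run (P.outCost inp) R ⌊D⌋₊ L out
      (Labeling.mix {v | center v ∈ T} out out') := by
    intro T
    induction T using Finset.induction_on with
    | empty =>
      refine ⟨[], ?_⟩
      have : Labeling.mix {v | center v ∈ (∅ : Finset V)} out out' = out := by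
        ext <;> simp [Labeling.mix]
      rw [this]
      exact Run.nil _
    | insert u T hu ih =>
      obtain ⟨L, hL⟩ := ih
      obtain ⟨L', hL'⟩ := exists_run_overlay hG
        (Labeling.mix {v | center v ∈ T} out out') (hmax u).1
      have h1 : (Labeling.mix {v | center v ∈ T} out out').overlay
          (out.restrict {v | center v = u}) = Labeling.mix {v | center v ∈ T} out out' := by
        ext v
        · simp only [Labeling.overlay, Labeling.mix, Labeling.restrict, Set.mem_ofPred_eq]
          split_ifs <;> simp_all
        · simp only [Labeling.overlay, Labeling.mix, Labeling.restrict, Set.mem_ofPred_eq]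
          split_ifs <;> simp_all
      have h2 : (Labeling.mix {v | center v ∈ T} out out').overlay
          (out'.restrict {v | center v = u}) =
            Labeling.mix {v | center v ∈ insert u T} out out' := by
        ext v
        · simp only [Labeling.overlay, Labeling.mix, Labeling.restrict, Set.mem_ofPred_eq,
            Finset.mem_insert]
          split_ifs <;> simp_all
        · rename_i w hvw
          simp only [Labeling.overlay, Labeling.mix, Labeling.restrict, Set.mem_ofPred_eq,
            Finset.mem_insert]
          by_cases hv : center v = u
          · by_cases hw : center w = u
            · simp [hv, hw]
            · have := hcross v w hvw (by rw [hv]; exact fun h => hw h.symm)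
              simp [hv, hw, this]
          · simp [hv]
      rw [h1, h2] at hL'
      exact ⟨_, hL.append hL'⟩
  obtain ⟨L, hL⟩ := key Finset.univ
  have : Labeling.mix {v | center v ∈ (Finset.univ : Finset V)} out out' = out' := by
    ext <;> simp [Labeling.mix]
  rw [this] at hL
  exact ⟨L, hL⟩

/-- After a maximal sequence in the cluster `C`, no set of small diameter that is well inside `C`
has improving ratio at least `R`. -/
theorem MaximalSequence.drop_lt (hG : DegreeLE G Δ) {C : Set V} {R D : ℝ} (hR : 0 < R)
    {l : Labeling (G.induce C) Vout Eout} {out out' : Labeling G Vout Eout}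
    (h : P.MaximalSequence G inp C R D l (out.restrict C)) {Z : Finset V} (hZ : Z.Nonempty)
    (hrel : IsRelabeling (Z : Set V) out out')
    (hcore : ∀ a ∈ Z, ∀ u, G.edist a u ≤ (2 * r + 1 : ℕ) → u ∈ C)
    (hdiam : ∀ a ∈ Z, ∀ b ∈ Z, ∃ d : ℕ, G.edist a b ≤ d ∧ (d : ℝ) ≤ D) :
    drop (P.outCost inp) out out' < R * Z.card := by
  classical
  by_contra! hdrop
  apply h.2
  have hpos : (0 : ℝ) < Z.card := by exact_mod_cast hZ.card_pos
  have hZC : ∀ a ∈ Z, a ∈ C := fun a ha => hcore a ha a (by simp)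
  have himp := P.imp_induce hG inp (C := C) hrel fun a ha u hu =>
    hcore a ha u (hu.trans (by exact_mod_cast Nat.le_succ _))
  rw [drop_outCost, ← himp] at hdrop
  have hcard : (Z.subtype (· ∈ C)).card = Z.card := by
    rw [Finset.card_subtype, Finset.filter_true_of_mem hZC]
  refine ⟨out'.restrict C, Z.subtype (· ∈ C), ⟨?_, ?_⟩, ?_, ?_, ?_⟩
  · intro v hv
    have hv' : (v : V) ∉ (Z : Set V) := fun h => hv (by simpa using h)
    exact ⟨(hrel v hv').1, fun w hw => (hrel v hv').2 _ hw⟩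
  · exact sub_pos.1 (lt_of_lt_of_le (mul_pos hR hpos) hdrop)
  · rwa [improvingRatio, hcard, le_div_iff₀ hpos]
  · intro a ha
    exact hcore a (by simpa using ha)
  · intro a ha b hb
    obtain ⟨d, h1, h2⟩ := hdiam a (by simpa using ha) b (by simpa using hb)
    have hre : G.Reachable (a : V) b := SimpleGraph.edist_ne_top_iff_reachable.1
      (ne_top_of_le_ne_top (ENat.natCast_ne_top d) h1)
    refine ⟨hre, le_trans ?_ h2⟩
    rw [← hre.coe_dist_eq_edist] at h1
    exact_mod_cast h1

/-- If the ball of radius `ℓ` around `v` is contained in a single cluster in at least one phase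
`i`, then the constraint at `v` holds in the end: otherwise, the improvement of `v` and all
improvements made after phase `i` would lead to an improving set near `v` that is well inside the
cluster of `v` in phase `i`, and whose ratio exceeds the threshold of phase `i`. -/
theorem mem_constraints_of_good_phase [Finite Vin] [Finite Ein] [Finite Vout] [Finite Eout]
    (hG : DegreeLE G Δ) {M : ℝ} (hM : ∀ l v, cost P.Ψ r G l v ≤ M)
    {m : ℕ} {s : ℕ → V → ℝ} {T : ℕ → ℝ} {D : ℝ} {out : ℕ → Labeling G Vout Eout}
    (hphase : ∀ i < m, P.Phase G inp (s i) (T i) D (out i) (out (i + 1)))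
    {v : V} {i : ℕ} (hi : i < m) {ε R : ℝ} {J₁ J₂ ℓ : ℕ}
    (hgood : ∀ center, IsMPX G (s i) center → ∀ u, G.edist v u ≤ ℓ → center u = center v)
    (hT : 0 < T i) (hTR : T i ≤ R) (hε : 0 ≤ ε)
    (hlater : ∀ j, i < j → j < m → R ≤ T j) (hlam : R ≤ P.minRatio)
    (hεR : (3 * M * ((Δ + 1) ^ r : ℕ) + R) * ε + 3 * M * ((Δ + 1) ^ r : ℕ) * ε ≤ R - T i)
    (hJ₁ : M * Fintype.card V / R < (1 + ε) ^ J₁) (hJ₂ : (Fintype.card V : ℝ) < (1 + ε) ^ J₂)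
    (hD : ((J₂ * (r + r) + J₂ * (r + r) : ℕ) : ℝ) ≤ D)
    (hℓ : J₁ * (⌊D⌋₊ + 2 * r) + ⌊D⌋₊ + r + (2 * r + 1) ≤ ℓ) :
    ball G (inp.prod (out m)) (2 * r) v ∈ P.constraints := by
  classical
  by_contra hv
  obtain ⟨out', hrel, hdrop⟩ := P.exists_improvement_of_not_mem hG inp (out m) v hv
  have hc := isLocalCost_outCost (P := P) (inp := inp) hG hM
  have hR : 0 < R := hT.trans_le hTR
  -- All improvements after phase `i`, followed by the improvement of `v`.
  have hrun : ∀ j, i + 1 + j ≤ m →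
      ∃ L, Run (P.outCost inp) R ⌊D⌋₊ L (out (i + 1)) (out (i + 1 + j)) := by
    intro j
    induction j with
    | zero => exact fun _ => ⟨[], Run.nil _⟩
    | succ j ih =>
      intro hj
      obtain ⟨L, hL⟩ := ih (by omega)
      obtain ⟨L', hL'⟩ := (hphase (i + 1 + j) (by omega)).exists_run hG
      exact ⟨_, hL.append (hL'.mono (hlater _ (by omega) (by omega)))⟩
  obtain ⟨L, hL⟩ := hrun (m - (i + 1)) (by omega)
  rw [show i + 1 + (m - (i + 1)) = m by omega] at hL
  have hstep : Run (P.outCost inp) R ⌊D⌋₊ [{v}] (out m) out' := by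
    refine Run.cons (by simpa using hrel) ?_ ?_ (Run.nil _)
    · rw [drop_outCost, Finset.card_singleton, Nat.cast_one, mul_one]
      exact hlam.trans hdrop
    · simp
  have hM0 := hc.bound_nonneg out' v
  obtain ⟨Y, hYne, hYball, hY⟩ := (hL.append hstep).exists_ball hc hε hR
    (by have : 0 ≤ 3 * M * ((Δ + 1) ^ r : ℕ) * ε := by positivity
        linarith)
    (v := v) (A := {v}) (by simp) (by simp) hJ₁
  obtain ⟨Z, hZY, hZne, hZdiam, hZ⟩ := hc.exists_small_diameter (out (i + 1)) out' hε hT.le hJ₂ Y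
    hYne (le_trans (mul_le_mul_of_nonneg_right (by linarith) (by positivity)) hY)
  obtain ⟨center, hmpx, hmax, -⟩ := hphase i hi
  refine absurd hZ (not_le.2 ((hmax (center v)).drop_lt hG hT hZne (isRelabeling_mix _ _ _) ?_ ?_))
  · intro a ha u hu
    refine hgood center hmpx u ((edist_triangle_le (hYball a (hZY ha)) hu).trans ?_)
    exact_mod_cast hℓ
  · exact fun a ha b hb => ⟨_, hZdiam a ha b hb, hD⟩

end LOP

/-! ### Exponential shifts -/

section Shifts

open MeasureTheory ProbabilityTheory

section Exponential

variable {β : ℝ}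

theorem expMeasure_Ioi (hβ : 0 < β) (x : ℝ) :
    expMeasure β (Set.Ioi x) = ENNReal.ofReal (if 0 ≤ x then Real.exp (-(β * x)) else 1) := by
  have := isProbabilityMeasure_expMeasure hβ
  rw [← Set.compl_Iic, ← ofReal_measureReal, probReal_compl_eq_one_sub measurableSet_Iic,
    ← cdf_eq_real, cdf_expMeasure_eq hβ]
  congr 1
  split_ifs <;> ring

theorem expMeasure_singleton (x : ℝ) : expMeasure β {x} = 0 :=
  withDensity_absolutelyContinuous volume _ Real.volume_singleton

/-- The exponential distribution loses at most a factor `exp (β t)` when a threshold is raised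
by `t`. -/
theorem expMeasure_Ici_le (hβ : 0 < β) {t : ℝ} (ht : 0 ≤ t) (x : ℝ) :
    expMeasure β (Set.Ici x) ≤
      ENNReal.ofReal (Real.exp (β * t)) * expMeasure β (Set.Ioi (x + t)) := by
  rw [← Set.Ioi_insert, Set.insert_eq]
  refine (measure_union_le _ _).trans ?_
  rw [expMeasure_singleton, zero_add, expMeasure_Ioi hβ, expMeasure_Ioi hβ,
    ← ENNReal.ofReal_mul (Real.exp_pos _).le]
  apply ENNReal.ofReal_le_ofReal
  have hone : 1 ≤ Real.exp (β * t) := Real.one_le_exp (by positivity)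
  split_ifs with h1 h2 h2
  · rw [← Real.exp_add]
    exact Real.exp_le_exp.2 (by ring_nf; exact le_rfl)
  · linarith
  · rw [← Real.exp_add]
    exact Real.one_le_exp (by ring_nf; nlinarith)
  · linarith

theorem expMeasure_compl_Icc_le (hβ : 0 < β) {T : ℝ} (hT : 0 ≤ T) :
    expMeasure β (Set.Icc 0 T)ᶜ ≤ ENNReal.ofReal (Real.exp (-(β * T))) := by
  have := isProbabilityMeasure_expMeasure hβ
  have h0 : expMeasure β (Set.Iio 0) = 0 := by
    have h : expMeasure β (Set.Iic 0) = 0 := by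
      rw [← ofReal_measureReal, ← cdf_eq_real, cdf_expMeasure_eq hβ]
      simp
    exact measure_mono_null Set.Iio_subset_Iic_self h
  have hsub : (Set.Icc 0 T)ᶜ ⊆ Set.Iio 0 ∪ Set.Ioi T := by
    intro x hx
    by_contra h
    simp only [Set.mem_union, Set.mem_Iio, Set.mem_Ioi, not_or, not_lt] at h
    exact hx h
  refine (measure_mono hsub).trans ((measure_union_le _ _).trans ?_)
  rw [h0, zero_add, expMeasure_Ioi hβ, if_pos hT]

theorem expMeasure_forall_le (hβ : 0 < β) {t : ℝ} (ht : 0 ≤ t) {ι : Type} (S : Finset ι)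
    (a : ι → ℝ) : expMeasure β {y | ∀ i ∈ S, a i ≤ y} ≤
      ENNReal.ofReal (Real.exp (β * t)) * expMeasure β {y | ∀ i ∈ S, a i + t < y} := by
  have := isProbabilityMeasure_expMeasure hβ
  rcases S.eq_empty_or_nonempty with rfl | hS
  · have hone : 1 ≤ Real.exp (β * t) := Real.one_le_exp (by positivity)
    simpa using hone
  · obtain ⟨j, hj, hmax⟩ := S.exists_max_image a hS
    refine (measure_mono fun y hy => ?_).trans ((expMeasure_Ici_le hβ ht (a j)).trans ?_)
    · exact hy j hj
    · refine mul_le_mul' le_rfl (measure_mono fun y hy i hi => ?_)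
      have hy : a j + t < y := hy
      exact lt_of_le_of_lt (by linarith [hmax i hi]) hy

end Exponential

section Gap

variable {V : Type}

/-- The shifted value `s u - d u` exceeds all others with index in `K` by more than `t`. -/
def gapSet (K : Finset V) (d : V → ℝ) (t : ℝ) (u : V) : Set (V → ℝ) :=
  {s | ∀ w ∈ K, w ≠ u → s w - d w + t < s u - d u}

theorem measurableSet_gapSet (K : Finset V) (d : V → ℝ) (t : ℝ) (u : V) :
    MeasurableSet (gapSet K d t u) := by
  have : gapSet K d t u = ⋂ w ∈ K, ⋂ (_ : w ≠ u), {s : V → ℝ | s w - d w + t < s u - d u} := by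
    ext s; simp [gapSet]
  rw [this]
  refine Finset.measurableSet_biInter _ fun w _ => MeasurableSet.iInter fun _ => ?_
  exact measurableSet_lt (by fun_prop) (by fun_prop)

/-- The probability that the largest shifted value exceeds all others by more than `t` is at least
`exp (-β t)`, because the exponential distribution is memoryless. -/
theorem expMeasure_pi_gap_le [Fintype V] {β : ℝ} (hβ : 0 < β) {t : ℝ} (ht : 0 ≤ t) {K : Finset V}
    (hK : K.Nonempty) (d : V → ℝ) :
    Measure.pi (fun _ : V => expMeasure β) (⋃ u ∈ K, gapSet K d t u)ᶜ ≤
      ENNReal.ofReal (β * t) := by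
  classical
  have := isProbabilityMeasure_expMeasure hβ
  set ν := Measure.pi (fun _ : V => expMeasure β) with hν
  let F : V → Set (V → ℝ) := fun u => {s | ∀ w ∈ K, w ≠ u → s w - d w ≤ s u - d u}
  have hFmeas : ∀ u, MeasurableSet (F u) := by
    intro u
    have : F u = ⋂ w ∈ K, ⋂ (_ : w ≠ u), {s : V → ℝ | s w - d w ≤ s u - d u} := by
      ext s; simp [F]
    rw [this]
    refine Finset.measurableSet_biInter _ fun w _ => MeasurableSet.iInter fun _ => ?_
    exact measurableSet_le (by fun_prop) (by fun_prop)
  -- Integrating over the shift of `u` first compares the two events.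
  have hslice : ∀ u, ν (F u) ≤ ENNReal.ofReal (Real.exp (β * t)) * ν (gapSet K d t u) := by
    intro u
    have hE := measurableSet_gapSet K d t u
    rw [← lintegral_indicator_one (hFmeas u), ← lintegral_indicator_one hE,
      ← lintegral_const_mul _ (measurable_one.indicator hE), hν,
      lintegral_eq_lmarginal_univ (fun _ => 0), lintegral_eq_lmarginal_univ (fun _ => 0),
      lmarginal_erase' _ (measurable_one.indicator (hFmeas u)) (Finset.mem_univ u),
      lmarginal_erase' _ ((measurable_one.indicator hE).const_mul _) (Finset.mem_univ u)]
    refine lmarginal_mono (fun x => ?_) _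
    have hmeas : Measurable fun y : ℝ => Function.update x u y := measurable_update x
    have e1 : ∀ y, (F u).indicator (1 : (V → ℝ) → ℝ≥0∞) (Function.update x u y) =
        ((fun y => Function.update x u y) ⁻¹' F u).indicator 1 y := fun y => rfl
    have e2 : ∀ y, (gapSet K d t u).indicator (1 : (V → ℝ) → ℝ≥0∞) (Function.update x u y) =
        ((fun y => Function.update x u y) ⁻¹' gapSet K d t u).indicator 1 y := fun y => rfl
    simp only [e1, e2]
    rw [lintegral_const_mul _ (measurable_one.indicator (hmeas hE)),
      lintegral_indicator_one (hmeas (hFmeas u)), lintegral_indicator_one (hmeas hE)]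
    convert expMeasure_forall_le hβ ht (K.erase u) (fun w => x w - d w + d u) using 2
    · ext y
      simp only [F, Set.mem_preimage, Set.mem_ofPred_eq, Finset.mem_erase]
      refine forall_congr' fun w => ?_
      by_cases hw : w = u
      · simp [hw]
      · simp only [hw, ne_eq, not_false_eq_true, Function.update_of_ne, Function.update_self,
          true_and, forall_const]
        refine imp_congr_right fun _ => ?_
        constructor <;> intro h <;> linarith
    · congr 1
      ext y
      simp only [gapSet, Set.mem_preimage, Set.mem_ofPred_eq, Finset.mem_erase]
      refine forall_congr' fun w => ?_
      by_cases hw : w = u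
      · simp [hw]
      · simp only [hw, ne_eq, not_false_eq_true, Function.update_of_ne, Function.update_self,
          true_and, forall_const]
        refine imp_congr_right fun _ => ?_
        constructor <;> intro h <;> linarith
  have hcover : (Set.univ : Set (V → ℝ)) ⊆ ⋃ u ∈ K, F u := by
    intro s _
    obtain ⟨u, hu, hmax⟩ := K.exists_max_image (fun u => s u - d u) hK
    exact Set.mem_biUnion hu fun w hw _ => hmax w hw
  have hdisj : (K : Set V).PairwiseDisjoint (gapSet K d t) := by
    intro u hu w hw huw
    refine Set.disjoint_left.2 fun s hs hs' => ?_
    have h1 := hs w hw huw.symm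
    have h2 := hs' u hu huw
    linarith
  have hmeasU : MeasurableSet (⋃ u ∈ K, gapSet K d t u) :=
    Finset.measurableSet_biUnion _ fun u _ => measurableSet_gapSet K d t u
  have h1 : 1 ≤ ENNReal.ofReal (Real.exp (β * t)) * ν (⋃ u ∈ K, gapSet K d t u) := by
    calc (1 : ℝ≥0∞) = ν Set.univ := measure_univ.symm
      _ ≤ ∑ u ∈ K, ν (F u) := (measure_mono hcover).trans (measure_biUnion_finset_le _ _)
      _ ≤ ∑ u ∈ K, ENNReal.ofReal (Real.exp (β * t)) * ν (gapSet K d t u) :=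
          Finset.sum_le_sum fun u _ => hslice u
      _ = _ := by
          rw [← Finset.mul_sum, measure_biUnion_finset hdisj fun u _ => measurableSet_gapSet K d t u]
  rw [← ofReal_measureReal, probReal_compl_eq_one_sub hmeasU]
  apply ENNReal.ofReal_le_ofReal
  rw [← ofReal_measureReal (measure_ne_top ν _), ← ENNReal.ofReal_mul (Real.exp_pos _).le,
    ← ENNReal.ofReal_one,
    ENNReal.ofReal_le_ofReal_iff (by positivity)] at h1
  have h2 : Real.exp (-(β * t)) ≤ ν.real (⋃ u ∈ K, gapSet K d t u) := by
    rw [Real.exp_neg, inv_le_iff_one_le_mul₀' (Real.exp_pos _)]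
    exact h1
  linarith [Real.add_one_le_exp (-(β * t))]

/-- If the best shifted value at `v` exceeds all others by more than `2 ℓ`, then the ball of radius
`ℓ` around `v` lies in a single cluster. -/
theorem IsMPX.center_eq_of_gap {G : SimpleGraph V} {s : V → ℝ} {v : V} {ℓ : ℕ} {K : Finset V}
    (hK : ∀ u, u ∈ K ↔ G.Reachable u v)
    (hs : s ∈ ⋃ u ∈ K, gapSet K (fun u => (G.dist u v : ℝ)) (2 * ℓ) u) {center : V → V}
    (h : IsMPX G s center) {w : V} (hw : G.edist v w ≤ ℓ) : center w = center v := by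
  simp only [Set.mem_iUnion] at hs
  obtain ⟨u, hu, hgap⟩ := hs
  have key : ∀ w, G.edist v w ≤ ℓ → center w = u := by
    intro w hw
    by_contra hne
    have hvw : G.Reachable v w := SimpleGraph.edist_ne_top_iff_reachable.1
      (ne_top_of_le_ne_top (ENat.natCast_ne_top ℓ) hw)
    have huv := (hK u).1 hu
    have hd : (G.dist v w : ℝ) ≤ ℓ := by
      rw [← hvw.coe_dist_eq_edist] at hw
      exact_mod_cast hw
    obtain ⟨h1, h2⟩ := h w
    have h3 := h2 u (huv.trans hvw)
    have h4 := hgap (center w) ((hK _).2 (h1.trans hvw.symm)) hne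
    have h5 : (G.dist u w : ℝ) ≤ G.dist u v + G.dist v w := by
      exact_mod_cast huv.dist_triangle_left w
    have h6 : (G.dist (center w) v : ℝ) ≤ G.dist (center w) w + G.dist v w := by
      rw [SimpleGraph.dist_comm (u := v)]
      exact_mod_cast h1.dist_triangle_left v
    linarith
  rw [key w hw, key v (by simp)]

end Gap

section Union

variable {V I : Type} [Fintype V] [Fintype I]

/-- Exchanging the two indices of a doubly indexed family of independent variables. -/
theorem map_swap_pi (μ : Measure ℝ) [IsProbabilityMeasure μ] :
    Measure.map (fun (s : V → I → ℝ) i v => s v i)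
      (Measure.pi fun _ : V => Measure.pi fun _ : I => μ) =
        Measure.pi fun _ : I => Measure.pi fun _ : V => μ := by
  symm
  refine Measure.pi_eq_generateFrom (fun _ => generateFrom_pi) (fun _ => isPiSystem_pi)
    (fun _ => ⟨fun _ => Set.univ, fun _ => ⟨fun _ => Set.univ, by simp, by simp⟩,
      fun _ => measure_lt_top _ _, Set.iUnion_const _⟩) ?_
  intro S hS
  choose t ht ht' using hS
  have hmeas : Measurable fun (s : V → I → ℝ) i v => s v i := by fun_prop
  have hSm : MeasurableSet (Set.univ.pi S) := by
    refine MeasurableSet.univ_pi fun i => ?_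
    rw [← ht' i]
    exact MeasurableSet.univ_pi fun v => ht i v trivial
  rw [Measure.map_apply hmeas hSm]
  have hpre : (fun (s : V → I → ℝ) i v => s v i) ⁻¹' Set.univ.pi S =
      Set.univ.pi fun v => Set.univ.pi fun i => t i v := by
    ext s
    simp only [← ht', Set.mem_preimage, Set.mem_univ_pi]
    exact forall_comm
  rw [hpre, Measure.pi_pi]
  simp_rw [Measure.pi_pi, ← ht', Measure.pi_pi]
  exact Finset.prod_comm

theorem pi_pi_union_bound {β : ℝ} (hβ : 0 < β) {B : V → Set (V → ℝ)}
    (hB : ∀ v, MeasurableSet (B v)) {q : ℝ≥0∞}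
    (hq : ∀ v, Measure.pi (fun _ : V => expMeasure β) (B v) ≤ q) {T : ℝ} (hT : 0 ≤ T) :
    (Measure.pi fun _ : V => Measure.pi fun _ : I => expMeasure β)
      {s | (∃ v, ∀ i, (fun u => s u i) ∈ B v) ∨ ∃ v i, s v i ∉ Set.Icc 0 T} ≤
        Fintype.card V * q ^ Fintype.card I +
          Fintype.card V * (Fintype.card I * ENNReal.ofReal (Real.exp (-(β * T)))) := by
  have := isProbabilityMeasure_expMeasure hβ
  set ν := (Measure.pi fun _ : V => Measure.pi fun _ : I => expMeasure β) with hν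
  have h1 : ∀ v, ν {s | ∀ i, (fun u => s u i) ∈ B v} ≤ q ^ Fintype.card I := by
    intro v
    have hmeas : Measurable fun (s : V → I → ℝ) i v => s v i := by fun_prop
    have : {s : V → I → ℝ | ∀ i, (fun u => s u i) ∈ B v} =
        (fun (s : V → I → ℝ) i v => s v i) ⁻¹' Set.univ.pi fun _ => B v := by
      ext s; simp
    rw [this, ← Measure.map_apply hmeas (MeasurableSet.univ_pi fun _ => hB v), hν, map_swap_pi,
      Measure.pi_pi, Finset.prod_const, Finset.card_univ]
    exact pow_le_pow_left' (hq v) _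
  have h2 : ∀ v i, ν {s | s v i ∉ Set.Icc 0 T} ≤ ENNReal.ofReal (Real.exp (-(β * T))) := by
    intro v i
    refine le_trans (le_of_eq ?_) (expMeasure_compl_Icc_le hβ hT)
    have hA : MeasurableSet (Set.Icc 0 T)ᶜ := measurableSet_Icc.compl
    rw [← (measurePreserving_eval (fun _ : I => expMeasure β) i).measure_preimage
        hA.nullMeasurableSet,
      ← (measurePreserving_eval (fun _ : V => Measure.pi fun _ : I => expMeasure β) v).measure_preimage
        ((measurable_pi_apply i) hA).nullMeasurableSet]
    rfl
  have hsub : {s : V → I → ℝ | (∃ v, ∀ i, (fun u => s u i) ∈ B v) ∨ ∃ v i, s v i ∉ Set.Icc 0 T} ⊆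
      (⋃ v ∈ (Finset.univ : Finset V), {s | ∀ i, (fun u => s u i) ∈ B v}) ∪
        ⋃ v ∈ (Finset.univ : Finset V), ⋃ i ∈ (Finset.univ : Finset I),
          {s | s v i ∉ Set.Icc 0 T} := by
    rintro s (⟨v, hv⟩ | ⟨v, i, hvi⟩)
    · left; simp only [Set.mem_iUnion]; exact ⟨v, Finset.mem_univ v, hv⟩
    · right; simp only [Set.mem_iUnion]; exact ⟨v, Finset.mem_univ v, i, Finset.mem_univ i, hvi⟩
  refine (measure_mono hsub).trans ((measure_union_le _ _).trans (add_le_add ?_ ?_))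
  · refine (measure_biUnion_finset_le _ _).trans ((Finset.sum_le_sum fun v _ => h1 v).trans ?_)
    simp
  · refine (measure_biUnion_finset_le _ _).trans ((Finset.sum_le_sum fun v _ =>
      (measure_biUnion_finset_le _ _).trans (Finset.sum_le_sum fun i _ => h2 v i)).trans ?_)
    simp

end Union

end Shifts

/-! ### A canonical choice of maximal sequences -/

section Choice

/-- Transport of a labeling along an isomorphism. -/
def Labeling.comap {V W N H : Type} {F : SimpleGraph V} {F' : SimpleGraph W} (e : F ≃g F')
    (l : Labeling F' N H) : Labeling F N H where
  node v := l.node (e v)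
  half u v h := l.half (e u) (e v) (e.map_adj_iff.2 h)

theorem Labeling.half_congr {V N H : Type} {F : SimpleGraph V} (l : Labeling F N H) {u u' v v' : V}
    (hu : u = u') (hv : v = v') (h : F.Adj u v) :
    l.half u v h = l.half u' v' (by rw [← hu, ← hv]; exact h) := by
  subst hu hv; rfl

theorem Labeling.comap_symm_comap {V W N H : Type} {F : SimpleGraph V} {F' : SimpleGraph W}
    (e : F ≃g F') (l : Labeling F' N H) : (l.comap e).comap e.symm = l := by
  ext v
  · simp [Labeling.comap]
  · exact l.half_congr (e.apply_symm_apply _) (e.apply_symm_apply _) _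

variable {Vin Ein Vout Eout : Type} {r Δ : ℕ}

variable (Vin Ein Vout Eout Δ) in
/-- The part of the state of the algorithm that determines what happens in a single cluster: the
graph induced by the cluster with identifiers and labels, the nodes that are sufficiently far
from the boundary, and the pairs of nodes that are sufficiently close to each other. -/
structure Cluster where
  W : Type
  finite : Finite W
  graph : SimpleGraph W
  degreeLE : DegreeLE graph Δ
  id : W → ℕ
  id_injective : Function.Injective id
  inp : Labeling graph Vin Ein
  out : Labeling graph Vout Eout
  core : W → Prop
  close : W → W → Prop

namespace Cluster

instance (I : Cluster Vin Ein Vout Eout Δ) : Finite I.W := I.finite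

/-- `e` is an isomorphism of clusters. -/
structure IsIso {I J : Cluster Vin Ein Vout Eout Δ} (e : I.graph ≃g J.graph) : Prop where
  id_eq : ∀ w, J.id (e w) = I.id w
  inp_eq : J.inp.comap e = I.inp
  out_eq : J.out.comap e = I.out
  core_iff : ∀ w, J.core (e w) ↔ I.core w
  close_iff : ∀ w w', J.close (e w) (e w') ↔ I.close w w'

theorem IsIso.symm {I J : Cluster Vin Ein Vout Eout Δ} {e : I.graph ≃g J.graph} (h : IsIso e) :
    IsIso e.symm where
  id_eq w := by rw [← h.id_eq, e.apply_symm_apply]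
  inp_eq := by rw [← h.inp_eq, Labeling.comap_symm_comap]
  out_eq := by rw [← h.out_eq, Labeling.comap_symm_comap]
  core_iff w := by rw [← h.core_iff, e.apply_symm_apply]
  close_iff w w' := by rw [← h.close_iff, e.apply_symm_apply, e.apply_symm_apply]

theorem IsIso.trans {I J K : Cluster Vin Ein Vout Eout Δ} {e : I.graph ≃g J.graph}
    {e' : J.graph ≃g K.graph} (h : IsIso e) (h' : IsIso e') :
    IsIso (I := I) (J := K) (e.trans e') where
  id_eq w := (h'.id_eq _).trans (h.id_eq _)
  inp_eq := by rw [← h.inp_eq, ← h'.inp_eq]; rfl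
  out_eq := by rw [← h.out_eq, ← h'.out_eq]; rfl
  core_iff w := (h'.core_iff _).trans (h.core_iff _)
  close_iff w w' := (h'.close_iff _ _).trans (h.close_iff _ _)

theorem IsIso.eq {I J : Cluster Vin Ein Vout Eout Δ} {e e' : I.graph ≃g J.graph} (h : IsIso e)
    (h' : IsIso e') : e = e' :=
  RelIso.ext fun w => J.id_injective ((h.id_eq w).trans (h'.id_eq w).symm)

/-- Clusters up to isomorphism. -/
instance isoSetoid : Setoid (Cluster Vin Ein Vout Eout Δ) where
  r I J := ∃ e : I.graph ≃g J.graph, IsIso e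
  iseqv :=
    { refl := fun _ => ⟨RelIso.refl _, fun _ => rfl, rfl, rfl, fun _ => Iff.rfl,
        fun _ _ => Iff.rfl⟩
      symm := fun ⟨_, h⟩ => ⟨_, h.symm⟩
      trans := fun ⟨_, h⟩ ⟨_, h'⟩ => ⟨_, h.trans h'⟩ }

variable (P : LOP Vin Ein Vout Eout r Δ) (R : ℝ)

/-- A step of a sequence of improving sets in a cluster. -/
def Step (I : Cluster Vin Ein Vout Eout Δ) (o o' : Labeling I.graph Vout Eout) : Prop :=
  ∃ A : Finset I.W, P.IsImprovingSet I.graph I.inp A o o' ∧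
    R ≤ P.improvingRatio I.graph I.inp A o o' ∧
    (∀ a ∈ A, I.core a) ∧ ∀ a ∈ A, ∀ b ∈ A, I.close a b

/-- A maximal sequence of steps in a cluster. -/
def Maximal (I : Cluster Vin Ein Vout Eout Δ) (o o' : Labeling I.graph Vout Eout) : Prop :=
  Relation.ReflTransGen (I.Step P R) o o' ∧ ¬ ∃ o'', I.Step P R o' o''

variable {P R}

theorem pot_comap {I J : Cluster Vin Ein Vout Eout Δ} {e : I.graph ≃g J.graph} (h : IsIso e)
    (o : Labeling J.graph Vout Eout) :
    pot P.Ψ r I.graph (I.inp.prod (o.comap e)) = pot P.Ψ r J.graph (J.inp.prod o) := by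
  rw [pot, pot, ← h.inp_eq]
  refine finsum_eq_of_bijective e e.bijective fun u => ?_
  exact cost_eq_of_lift (f := e) P.Ψ_iso J.degreeLE e.injective (fun _ _ h => e.map_adj_iff.2 h)
    (fun w _ x hx => ⟨e.symm x, e.apply_symm_apply x, by
      rw [← e.map_adj_iff, e.apply_symm_apply]; exact hx⟩)
    (fun _ => rfl) fun _ _ _ => rfl

theorem Step.comap {I J : Cluster Vin Ein Vout Eout Δ} {e : I.graph ≃g J.graph} (h : IsIso e)
    {o o' : Labeling J.graph Vout Eout} (hs : J.Step P R o o') :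
    I.Step P R (o.comap e) (o'.comap e) := by
  obtain ⟨A, ⟨hrel, hpot⟩, hratio, hcore, hclose⟩ := hs
  have hmem : ∀ a, a ∈ A.map e.symm.toEquiv.toEmbedding ↔ e a ∈ A := by
    intro a
    rw [Finset.mem_map_equiv]
    rfl
  refine ⟨A.map e.symm.toEquiv.toEmbedding, ⟨?_, ?_⟩, ?_, ?_, ?_⟩
  · intro v hv
    have hv' : e v ∉ (A : Set J.W) := fun hA => hv ((hmem v).2 hA)
    exact ⟨(hrel _ hv').1, fun w hw => (hrel _ hv').2 _ _⟩
  · rw [pot_comap h, pot_comap h]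
    exact hpot
  · rwa [LOP.improvingRatio, LOP.imp, pot_comap h, pot_comap h, Finset.card_map]
  · exact fun a ha => (h.core_iff a).1 (hcore _ ((hmem a).1 ha))
  · exact fun a ha b hb => (h.close_iff a b).1 (hclose _ ((hmem a).1 ha) _ ((hmem b).1 hb))

theorem Maximal.comap {I J : Cluster Vin Ein Vout Eout Δ} {e : I.graph ≃g J.graph} (h : IsIso e)
    {o o' : Labeling J.graph Vout Eout} (hs : J.Maximal P R o o') :
    I.Maximal P R (o.comap e) (o'.comap e) := by
  refine ⟨hs.1.lift (fun x => Labeling.comap e x) fun _ _ => Step.comap h, ?_⟩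
  rintro ⟨o'', ho''⟩
  refine hs.2 ⟨o''.comap e.symm, ?_⟩
  have := ho''.comap h.symm
  rwa [Labeling.comap_symm_comap] at this

theorem exists_maximal [Finite Vout] [Finite Eout] (P : LOP Vin Ein Vout Eout r Δ) (R : ℝ)
    (I : Cluster Vin Ein Vout Eout Δ) (o : Labeling I.graph Vout Eout) :
    ∃ o', I.Maximal P R o o' := by
  obtain ⟨o', ho', hmin⟩ := Set.exists_min_image {o' | Relation.ReflTransGen (I.Step P R) o o'}
    (fun o' => pot P.Ψ r I.graph (I.inp.prod o')) (Set.toFinite _) ⟨o, Relation.ReflTransGen.refl⟩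
  refine ⟨o', ho', ?_⟩
  rintro ⟨o'', h⟩
  have h1 := hmin o'' (ho'.tail h)
  obtain ⟨A, ⟨-, hpot⟩, -⟩ := h
  exact absurd h1 (not_le.2 hpot)

variable [Finite Vout] [Finite Eout] (P R)

/-- The result of some maximal sequence in the cluster, chosen for a representative of the
isomorphism class, so that isomorphic clusters have corresponding results. -/
noncomputable def result (I : Cluster Vin Ein Vout Eout Δ) : Labeling I.graph Vout Eout :=
  (exists_maximal P R (⟦I⟧ : Quotient isoSetoid).out (⟦I⟧ : Quotient isoSetoid).out.out).choose.comap
    (Setoid.symm (Quotient.mk_out I)).choose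

theorem maximal_result (I : Cluster Vin Ein Vout Eout Δ) :
    I.Maximal P R I.out (I.result P R) := by
  have h := (Setoid.symm (Quotient.mk_out I)).choose_spec
  have := (exists_maximal P R (⟦I⟧ : Quotient isoSetoid).out
    (⟦I⟧ : Quotient isoSetoid).out.out).choose_spec.comap h
  rwa [h.out_eq] at this

theorem result_eq_comap {I J : Cluster Vin Ein Vout Eout Δ} {e : I.graph ≃g J.graph}
    (h : IsIso e) : I.result P R = (J.result P R).comap e := by
  have key : ∀ (K K' : Cluster Vin Ein Vout Eout Δ) (_ : K = K') (hK : I ≈ K) (hK' : J ≈ K'),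
      (K.exists_maximal P R K.out).choose.comap hK.choose =
        ((K'.exists_maximal P R K'.out).choose.comap hK'.choose).comap e := by
    rintro K _ rfl hK hK'
    rw [hK.choose_spec.eq (h.trans hK'.choose_spec)]
    rfl
  have hIJ : (⟦I⟧ : Quotient isoSetoid) = ⟦J⟧ := Quotient.sound ⟨e, h⟩
  exact key _ _ (congrArg Quotient.out hIJ) (Setoid.symm (Quotient.mk_out I))
    (Setoid.symm (Quotient.mk_out J))

end Cluster

section Canonical

variable {V : Type} [Fintype V] {G : SimpleGraph V}

/-- `u` is the center of the cluster of `v`: it minimizes the shifted distance to `v`, and ties are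
broken by the identifiers. -/
def IsBest (G : SimpleGraph V) (id : V → ℕ) (s : V → ℝ) (v u : V) : Prop :=
  G.Reachable u v ∧ ∀ w, G.Reachable w v →
    (G.dist u v : ℝ) - s u < G.dist w v - s w ∨
      ((G.dist u v : ℝ) - s u = G.dist w v - s w ∧ id u ≤ id w)

theorem exists_isBest (G : SimpleGraph V) (id : V → ℕ) (s : V → ℝ) (v : V) :
    ∃ u, IsBest G id s v u := by
  obtain ⟨u₀, hu₀, hmin₀⟩ := Set.exists_min_image {u | G.Reachable u v}
    (fun u => (G.dist u v : ℝ) - s u) (Set.toFinite _) ⟨v, SimpleGraph.Reachable.refl v⟩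
  obtain ⟨u, ⟨hu, hu'⟩, hmin⟩ := Set.exists_min_image
    {u | G.Reachable u v ∧ (G.dist u v : ℝ) - s u = G.dist u₀ v - s u₀} id (Set.toFinite _)
    ⟨u₀, hu₀, rfl⟩
  refine ⟨u, hu, fun w hw => ?_⟩
  rcases (hmin₀ w hw).lt_or_eq with h | h
  · left; rw [hu']; exact h
  · right; exact ⟨hu'.trans h, hmin w ⟨hw, h.symm⟩⟩

/-- The canonical MPX clustering. -/
noncomputable def canonCenter (G : SimpleGraph V) (id : V → ℕ) (s : V → ℝ) (v : V) : V :=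
  (exists_isBest G id s v).choose

theorem isBest_canonCenter (G : SimpleGraph V) (id : V → ℕ) (s : V → ℝ) (v : V) :
    IsBest G id s v (canonCenter G id s v) :=
  (exists_isBest G id s v).choose_spec

theorem isMPX_canonCenter (G : SimpleGraph V) (id : V → ℕ) (s : V → ℝ) :
    IsMPX G s (canonCenter G id s) := by
  intro v
  refine ⟨(isBest_canonCenter G id s v).1, fun u hu => ?_⟩
  rcases (isBest_canonCenter G id s v).2 u hu with h | h
  exacts [h.le, h.1.le]

/-- The cluster with center `u` of a network. -/
def mkCluster (r : ℕ) (hG : DegreeLE G Δ) (id : V → ℕ) (hid : Function.Injective id)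
    (inp : Labeling G Vin Ein) (D : ℝ) (out : Labeling G Vout Eout) (center : V → V) (u : V) :
    Cluster Vin Ein Vout Eout Δ where
  W := {v | center v = u}
  finite := inferInstance
  graph := G.induce {v | center v = u}
  degreeLE := hG.of_injective (f := fun v : {v | center v = u} => (v : V))
    Subtype.val_injective fun _ _ h => h
  id v := id v
  id_injective := hid.comp Subtype.val_injective
  inp := inp.restrict _
  out := out.restrict _
  core a := ∀ w : V, G.edist a w ≤ (2 * r + 1 : ℕ) → center w = u
  close a b := G.Reachable (a : V) b ∧ (G.dist (a : V) b : ℝ) ≤ D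

variable [Finite Vout] [Finite Eout] (P : LOP Vin Ein Vout Eout r Δ)

open Classical in
/-- The labeling after a phase with the canonical choices. -/
noncomputable def canonPhase (hG : DegreeLE G Δ) (id : V → ℕ) (hid : Function.Injective id)
    (inp : Labeling G Vin Ein) (s : V → ℝ) (R D : ℝ) (out : Labeling G Vout Eout) :
    Labeling G Vout Eout where
  node v := ((mkCluster r hG id hid inp D out (canonCenter G id s)
    (canonCenter G id s v)).result P R).node ⟨v, rfl⟩
  half v w h := if hvw : canonCenter G id s w = canonCenter G id s v then
      ((mkCluster r hG id hid inp D out (canonCenter G id s)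
        (canonCenter G id s v)).result P R).half ⟨v, rfl⟩ ⟨w, hvw⟩ h
    else out.half v w h

theorem restrict_canonPhase (hG : DegreeLE G Δ) (id : V → ℕ) (hid : Function.Injective id)
    (inp : Labeling G Vin Ein) (s : V → ℝ) (R D : ℝ) (out : Labeling G Vout Eout) (u : V) :
    (canonPhase P hG id hid inp s R D out).restrict {v | canonCenter G id s v = u} =
      (mkCluster r hG id hid inp D out (canonCenter G id s) u).result P R := by
  ext v
  · obtain ⟨v, rfl⟩ := v
    rfl
  · rename_i w h
    obtain ⟨v, rfl⟩ := v
    obtain ⟨w, hw⟩ := w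
    have hw' : canonCenter G id s w = canonCenter G id s v := hw
    simp only [Labeling.restrict, canonPhase, hw', dif_pos]

theorem phase_canonPhase (hG : DegreeLE G Δ) (id : V → ℕ) (hid : Function.Injective id)
    (inp : Labeling G Vin Ein) (s : V → ℝ) (R D : ℝ) (out : Labeling G Vout Eout) :
    P.Phase G inp s R D out (canonPhase P hG id hid inp s R D out) := by
  refine ⟨canonCenter G id s, isMPX_canonCenter G id s, fun u => ?_, fun v w h hvw => ?_⟩
  · rw [restrict_canonPhase]
    exact (mkCluster r hG id hid inp D out (canonCenter G id s) u).maximal_result P R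
  · simp only [canonPhase, dif_neg (Ne.symm hvw)]

/-- The labelings after the first phases with the canonical choices and the initial labels `o`. -/
noncomputable def canonOut (hG : DegreeLE G Δ) (id : V → ℕ) (hid : Function.Injective id)
    (inp : Labeling G Vin Ein) {k : ℕ} (s : V → Fin k → ℝ) (R : ℕ → ℝ) (D : ℝ) (o : Vout × Eout) :
    ℕ → Labeling G Vout Eout
  | 0 => ⟨fun _ => o.1, fun _ _ _ => o.2⟩
  | i + 1 => if h : i < k then
      canonPhase P hG id hid inp (fun v => s v ⟨i, h⟩) (R i) D
        (canonOut hG id hid inp s R D o i)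
    else canonOut hG id hid inp s R D o i

end Canonical

end Choice

/-! ### Views and locality of the canonical result -/

section ByPort

variable {V : Type} {G : SimpleGraph V} {Δ a : ℕ} (N : Network G Δ a) {X : Type}

theorem Network.byPort_port (v : V) (f : ∀ w, G.Adj v w → X) (w : V) (h : G.Adj v w) :
    N.byPort v f (N.port v w h) = some (f w h) := by
  have hex : ∃ w', ∃ hw : G.Adj v w', N.port v w' hw = N.port v w h := ⟨w, h, rfl⟩
  have key : ∀ w' (hw : G.Adj v w'), N.port v w' hw = N.port v w h → f w' hw = f w h := by
    intro w' hw heq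
    obtain rfl := N.port_injective v w' w hw h heq
    rfl
  unfold Network.byPort
  rw [dif_pos hex, key _ _ hex.choose_spec.choose_spec]

theorem Network.exists_of_byPort_eq_some {v : V} {f : ∀ w, G.Adj v w → X} {p : Fin Δ} {x : X}
    (h : N.byPort v f p = some x) : ∃ w, ∃ hw : G.Adj v w, N.port v w hw = p ∧ f w hw = x := by
  unfold Network.byPort at h
  split_ifs at h with hex
  exact ⟨_, _, hex.choose_spec.choose_spec, Option.some.inj h⟩

end ByPort

/-- What a node can learn about a network: its own data and, at each port, what the neighbor has
learned before; `none` stands for an unused port, or for what has not been learned yet. -/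
inductive View (Δ : ℕ) (X : Type) : Type
  | none : View Δ X
  | node (x : X) (c : Fin Δ → View Δ X) : View Δ X

/-- A network together with the input labels and the random values of its nodes. -/
structure Net (Δ : ℕ) (Vin Ein S : Type) where
  V : Type
  fintype : Fintype V
  G : SimpleGraph V
  degreeLE : DegreeLE G Δ
  a : ℕ
  net : Network G Δ a
  inp : Labeling G Vin Ein
  rand : V → S

namespace Net

variable {Δ : ℕ} {Vin Ein S : Type}

instance (X : Net Δ Vin Ein S) : Fintype X.V := X.fintype

/-- The identifier of a node. -/
abbrev id (X : Net Δ Vin Ein S) : X.V → ℕ := X.net.id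

/-- The initial knowledge of a node. -/
noncomputable def data (X : Net Δ Vin Ein S) (v : X.V) : ℕ × Vin × (Fin Δ → Option Ein) × S :=
  (X.net.id v, X.inp.node v, X.net.byPort v fun w h => X.inp.half v w h, X.rand v)

/-- The knowledge of a node after `t` rounds. -/
noncomputable def view (X : Net Δ Vin Ein S) :
    ℕ → X.V → View Δ (ℕ × Vin × (Fin Δ → Option Ein) × S)
  | 0, v => .node (X.data v) fun _ => .none
  | t + 1, v => .node (X.data v) fun p => (X.net.byPort v (fun w _ => X.view t w) p).getD .none

variable {X Y : Net Δ Vin Ein S}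

theorem view_ne_none (X : Net Δ Vin Ein S) (t : ℕ) (v : X.V) : X.view t v ≠ .none := by
  cases t <;> simp [view]

theorem data_eq {t : ℕ} {v : X.V} {w : Y.V} (h : X.view t v = Y.view t w) :
    X.data v = Y.data w := by
  cases t <;> exact (View.node.inj h).1

theorem id_eq {t : ℕ} {v : X.V} {w : Y.V} (h : X.view t v = Y.view t w) : X.id v = Y.id w :=
  congrArg Prod.fst (data_eq h)

theorem rand_eq {t : ℕ} {v : X.V} {w : Y.V} (h : X.view t v = Y.view t w) : X.rand v = Y.rand w :=
  congrArg (fun x => x.2.2.2) (data_eq h)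

theorem exists_adj_of_view {t : ℕ} {v v' : X.V} {w : Y.V} (h : X.view (t + 1) v = Y.view (t + 1) w)
    (hv : X.G.Adj v v') : ∃ w', ∃ hw : Y.G.Adj w w',
      Y.net.port w w' hw = X.net.port v v' hv ∧ X.view t v' = Y.view t w' := by
  have h1 := congrFun (View.node.inj h).2 (X.net.port v v' hv)
  rw [Network.byPort_port, Option.getD_some] at h1
  cases h2 : Y.net.byPort w (fun w' _ => Y.view t w') (X.net.port v v' hv) with
  | none => rw [h2] at h1; exact absurd h1 (X.view_ne_none t v')
  | some x =>
    rw [h2, Option.getD_some] at h1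
    obtain ⟨w', hw, hp, rfl⟩ := Y.net.exists_of_byPort_eq_some h2
    exact ⟨w', hw, hp, h1⟩

theorem view_of_succ {t : ℕ} : ∀ {v : X.V} {w : Y.V}, X.view (t + 1) v = Y.view (t + 1) w →
    X.view t v = Y.view t w := by
  induction t with
  | zero =>
    intro v w h
    simp only [view]
    rw [data_eq h]
  | succ t ih =>
    intro v w h
    rw [view, view, data_eq h]
    congr 1
    funext p
    cases h1 : X.net.byPort v (fun v' _ => X.view t v') p with
    | some x =>
      obtain ⟨v', hv, rfl, rfl⟩ := X.net.exists_of_byPort_eq_some h1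
      obtain ⟨w', hw, hp, h2⟩ := exists_adj_of_view h hv
      rw [← hp, Network.byPort_port, Option.getD_some, Option.getD_some, ih h2]
    | none =>
      cases h2 : Y.net.byPort w (fun w' _ => Y.view t w') p with
      | none => rfl
      | some x =>
        obtain ⟨w', hw, rfl, rfl⟩ := Y.net.exists_of_byPort_eq_some h2
        obtain ⟨v', hv, hp, -⟩ := exists_adj_of_view h.symm hw
        rw [← hp, Network.byPort_port] at h1
        cases h1

theorem view_mono {s t : ℕ} (hst : s ≤ t) {v : X.V} {w : Y.V} (h : X.view t v = Y.view t w) :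
    X.view s v = Y.view s w := by
  induction t, hst using Nat.le_induction with
  | base => exact h
  | succ t _ ih => exact ih (view_of_succ h)

/-- Nodes with equal views see the same nodes nearby, and these have equal views up to the
remaining distance. -/
theorem exists_of_edist_le (d : ℕ) : ∀ {t : ℕ} {v v' : X.V} {w : Y.V},
    X.view (t + d) v = Y.view (t + d) w → X.G.edist v v' ≤ d →
      ∃ w', Y.G.edist w w' ≤ d ∧ X.view t v' = Y.view t w' := by
  induction d with
  | zero =>
    intro t v v' w h hd
    obtain rfl := edist_le_zero hd
    exact ⟨w, by simp, h⟩
  | succ d ih =>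
    intro t v v' w h hd
    rcases edist_le_succ hd with rfl | ⟨x, hx, hadj⟩
    · exact ⟨w, by simp, view_mono (by omega) h⟩
    · rw [show t + (d + 1) = t + 1 + d by ring] at h
      obtain ⟨y, hy, hxy⟩ := ih h hx
      obtain ⟨w', hw, -, h'⟩ := exists_adj_of_view hxy hadj
      exact ⟨w', edist_adj_le hy hw, h'⟩

theorem of_edist_le {s d t : ℕ} (ht : s + d ≤ t) {v v' : X.V} {w w' : Y.V}
    (h : X.view t v = Y.view t w) (hd : X.G.edist v v' ≤ d) (hid : X.id v' = Y.id w') :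
    Y.G.edist w w' ≤ d ∧ X.view s v' = Y.view s w' := by
  obtain ⟨y, hy, h'⟩ := exists_of_edist_le (t := s) d (view_mono ht h) hd
  obtain rfl := Y.net.id_injective ((id_eq h').symm.trans hid)
  exact ⟨hy, h'⟩

theorem adj_of_view {t : ℕ} {v v' : X.V} {w w' : Y.V} (h : X.view (t + 1) v = Y.view (t + 1) w)
    (hv : X.G.Adj v v') (hid : X.id v' = Y.id w') :
    ∃ hw : Y.G.Adj w w', Y.net.port w w' hw = X.net.port v v' hv ∧ X.view t v' = Y.view t w' := by
  obtain ⟨y, hy, hp, h'⟩ := exists_adj_of_view h hv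
  obtain rfl := Y.net.id_injective ((id_eq h').symm.trans hid)
  exact ⟨hy, hp, h'⟩

/-- The labels of `v` and of its half-edges correspond to those of `w`. -/
def LabelsAgree {N H : Type} (l : Labeling X.G N H) (l' : Labeling Y.G N H) (v : X.V) (w : Y.V) :
    Prop :=
  l.node v = l'.node w ∧ ∀ v' w' (hv : X.G.Adj v v') (hw : Y.G.Adj w w'),
    X.id v' = Y.id w' → l.half v v' hv = l'.half w w' hw

theorem labelsAgree_inp {t : ℕ} {v : X.V} {w : Y.V} (h : X.view (t + 1) v = Y.view (t + 1) w) :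
    LabelsAgree X.inp Y.inp v w := by
  refine ⟨congrArg (fun x => x.2.1) (data_eq h), fun v' w' hv hw hid => ?_⟩
  obtain ⟨hw', hp, -⟩ := adj_of_view h hv hid
  have h1 := congrFun (congrArg (fun x => x.2.2.1) (data_eq h)) (X.net.port v v' hv)
  simp only [data] at h1
  rw [Network.byPort_port, ← hp, Network.byPort_port] at h1
  exact Option.some.inj h1

end Net

section Locality

variable {Δ : ℕ} {Vin Ein S : Type} {X Y : Net Δ Vin Ein S}

theorem edist_canonCenter_le {V : Type} [Fintype V] {G : SimpleGraph V} {id : V → ℕ} {s : V → ℝ}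
    {T : ℕ} (hs : ∀ v, s v ∈ Set.Icc (0 : ℝ) T) (v : V) :
    G.edist v (canonCenter G id s v) ≤ T := by
  obtain ⟨h1, h2⟩ := isMPX_canonCenter G id s v
  have h3 := h2 v (SimpleGraph.Reachable.refl v)
  rw [SimpleGraph.dist_self] at h3
  rw [SimpleGraph.edist_comm, ← h1.coe_dist_eq_edist]
  have h4 := (hs v).1
  have h5 := (hs (canonCenter G id s v)).2
  have : (G.dist (canonCenter G id s v) v : ℝ) ≤ T := by push_cast at h3; linarith
  exact_mod_cast this

/-- A node with the same view sees a counterpart of `u` whose shifted distance is no larger; this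
holds in both directions, so the minima coincide. -/
theorem exists_shifted_dist_le {f : S → ℝ} {T : ℕ} {v u : X.V} {w : Y.V}
    (h : X.view T v = Y.view T w) (hu : X.G.edist v u ≤ T) :
    ∃ u', Y.G.Reachable u' w ∧ X.id u = Y.id u' ∧
      (Y.G.dist u' w : ℝ) - f (Y.rand u') ≤ X.G.dist u v - f (X.rand u) := by
  have hr : X.G.Reachable v u := SimpleGraph.edist_ne_top_iff_reachable.1
    (ne_top_of_le_ne_top (ENat.natCast_ne_top T) hu)
  have hd : X.G.dist v u ≤ T := by
    rw [← hr.coe_dist_eq_edist] at hu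
    exact_mod_cast hu
  obtain ⟨u', h1, h2⟩ := Net.exists_of_edist_le (t := T - X.G.dist v u) (X.G.dist v u)
    (Net.view_mono (by omega) h) hr.coe_dist_eq_edist.ge
  have hr' : Y.G.Reachable w u' := SimpleGraph.edist_ne_top_iff_reachable.1
    (ne_top_of_le_ne_top (ENat.natCast_ne_top _) h1)
  refine ⟨u', hr'.symm, Net.id_eq h2, ?_⟩
  rw [← hr'.coe_dist_eq_edist] at h1
  have h3 : Y.G.dist w u' ≤ X.G.dist v u := by exact_mod_cast h1
  rw [Net.rand_eq h2, SimpleGraph.dist_comm, SimpleGraph.dist_comm (G := X.G)]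
  have : (Y.G.dist w u' : ℝ) ≤ X.G.dist v u := by exact_mod_cast h3
  linarith

/-- The center of the cluster of a node is determined by the view of the node up to the maximum
shift. -/
theorem id_canonCenter_eq {f : S → ℝ} {T : ℕ} (hX : ∀ v, f (X.rand v) ∈ Set.Icc (0 : ℝ) T)
    (hY : ∀ v, f (Y.rand v) ∈ Set.Icc (0 : ℝ) T) {v : X.V} {w : Y.V}
    (h : X.view T v = Y.view T w) :
    X.id (canonCenter X.G X.id (fun u => f (X.rand u)) v) =
      Y.id (canonCenter Y.G Y.id (fun u => f (Y.rand u)) w) := by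
  obtain ⟨u', hu', hid, hle⟩ := exists_shifted_dist_le (f := f) h
    (edist_canonCenter_le (id := X.id) (s := fun u => f (X.rand u)) hX v)
  obtain ⟨u, hu, hid', hle'⟩ := exists_shifted_dist_le (f := f) h.symm
    (edist_canonCenter_le (id := Y.id) (s := fun u => f (Y.rand u)) hY w)
  have h1 := (isBest_canonCenter X.G X.id (fun u => f (X.rand u)) v).2 u hu
  have h2 := (isBest_canonCenter Y.G Y.id (fun u => f (Y.rand u)) w).2 u' hu'
  rw [← hid'] at h1
  rw [← hid] at h2
  rcases h1 with h1 | ⟨h1, h1'⟩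
  · rcases h2 with h2 | ⟨h2, -⟩ <;> linarith
  · rcases h2 with h2 | ⟨-, h2'⟩
    · linarith
    · exact le_antisymm h1' h2'

/-- Two networks with shifts in `[0, T]` and nodes `v`, `w` whose views agree up to the distance
that is needed for the simulation of a phase with node radius `r`. -/
structure PhaseAgree (f : S → ℝ) (T r : ℕ) (v : X.V) (w : Y.V) : Prop where
  left : ∀ v, f (X.rand v) ∈ Set.Icc (0 : ℝ) T
  right : ∀ v, f (Y.rand v) ∈ Set.Icc (0 : ℝ) T
  view_eq : X.view (4 * T + 2 * r + 2) v = Y.view (4 * T + 2 * r + 2) w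

namespace PhaseAgree

variable {f : S → ℝ} {T r : ℕ} {v : X.V} {w : Y.V}

theorem symm (h : PhaseAgree f T r v w) : PhaseAgree f T r w v :=
  ⟨h.right, h.left, h.view_eq.symm⟩

theorem id_center_eq (h : PhaseAgree f T r v w) :
    X.id (canonCenter X.G X.id (fun u => f (X.rand u)) v) =
      Y.id (canonCenter Y.G Y.id (fun u => f (Y.rand u)) w) :=
  id_canonCenter_eq h.left h.right (Net.view_mono (by omega) h.view_eq)

theorem center_eq {s : ℕ} (h : PhaseAgree f T r v w) {x : X.V} {y : Y.V}
    (hx : canonCenter X.G X.id (fun u => f (X.rand u)) x =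
      canonCenter X.G X.id (fun u => f (X.rand u)) v) (hs : T ≤ s)
    (hxy : X.view s x = Y.view s y) :
    canonCenter Y.G Y.id (fun u => f (Y.rand u)) y =
      canonCenter Y.G Y.id (fun u => f (Y.rand u)) w := by
  apply Y.net.id_injective
  have h1 := id_canonCenter_eq h.left h.right (Net.view_mono hs hxy)
  rw [hx] at h1
  exact h1.symm.trans h.id_center_eq

theorem edist_le (h : PhaseAgree f T r v w) {x x' : X.V}
    (hx : canonCenter X.G X.id (fun u => f (X.rand u)) x =
      canonCenter X.G X.id (fun u => f (X.rand u)) x') : X.G.edist x x' ≤ (T + T : ℕ) := by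
  have h1 := edist_canonCenter_le (G := X.G) (id := X.id) (s := fun u => f (X.rand u)) h.left x
  have h2 := edist_canonCenter_le (G := X.G) (id := X.id) (s := fun u => f (X.rand u)) h.left x'
  rw [hx] at h1
  exact edist_triangle_le h1 (SimpleGraph.edist_comm.trans_le h2)

theorem exists_mem (h : PhaseAgree f T r v w) {x : X.V}
    (hx : canonCenter X.G X.id (fun u => f (X.rand u)) x =
      canonCenter X.G X.id (fun u => f (X.rand u)) v) :
    ∃ y, canonCenter Y.G Y.id (fun u => f (Y.rand u)) y =
      canonCenter Y.G Y.id (fun u => f (Y.rand u)) w ∧ X.id x = Y.id y := by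
  obtain ⟨y, -, hxy⟩ := Net.exists_of_edist_le (t := 2 * T + 2 * r + 2) (T + T)
    (Net.view_mono (by omega) h.view_eq) (h.edist_le hx.symm)
  exact ⟨y, h.center_eq hx (by omega) hxy, Net.id_eq hxy⟩

theorem view_mem (h : PhaseAgree f T r v w) {x : X.V} {y : Y.V}
    (hx : canonCenter X.G X.id (fun u => f (X.rand u)) x =
      canonCenter X.G X.id (fun u => f (X.rand u)) v) (hid : X.id x = Y.id y) :
    X.view (2 * T + 2 * r + 2) x = Y.view (2 * T + 2 * r + 2) y :=
  (Net.of_edist_le (s := 2 * T + 2 * r + 2) (by omega) h.view_eq (h.edist_le hx.symm) hid).2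

variable {Vout Eout : Type} {D : ℝ} {o : Labeling X.G Vout Eout} {o' : Labeling Y.G Vout Eout}

theorem core_of_core (h : PhaseAgree f T r v w) {x : X.V} {y : Y.V}
    (hxy : X.view (2 * T + 2 * r + 2) x = Y.view (2 * T + 2 * r + 2) y)
    (hcore : ∀ q, X.G.edist x q ≤ (2 * r + 1 : ℕ) →
      canonCenter X.G X.id (fun u => f (X.rand u)) q =
        canonCenter X.G X.id (fun u => f (X.rand u)) v) (q : Y.V)
    (hq : Y.G.edist y q ≤ (2 * r + 1 : ℕ)) :
    canonCenter Y.G Y.id (fun u => f (Y.rand u)) q =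
      canonCenter Y.G Y.id (fun u => f (Y.rand u)) w := by
  obtain ⟨p, hp, hpq⟩ := Net.exists_of_edist_le (t := 2 * T + 1) (2 * r + 1)
    (Net.view_mono (by omega) hxy.symm) hq
  exact h.center_eq (hcore p hp) (by omega) hpq.symm

theorem close_of_close (h : PhaseAgree f T r v w) {x₁ x₂ : X.V} {y₁ y₂ : Y.V}
    (hx₁ : canonCenter X.G X.id (fun u => f (X.rand u)) x₁ =
      canonCenter X.G X.id (fun u => f (X.rand u)) v)
    (hx₂ : canonCenter X.G X.id (fun u => f (X.rand u)) x₂ =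
      canonCenter X.G X.id (fun u => f (X.rand u)) v)
    (h₁ : X.id x₁ = Y.id y₁) (h₂ : X.id x₂ = Y.id y₂)
    (hclose : X.G.Reachable x₁ x₂ ∧ (X.G.dist x₁ x₂ : ℝ) ≤ D) :
    Y.G.Reachable y₁ y₂ ∧ (Y.G.dist y₁ y₂ : ℝ) ≤ D := by
  obtain ⟨hr, hD⟩ := hclose
  have hle := h.edist_le (hx₁.trans hx₂.symm)
  rw [← hr.coe_dist_eq_edist] at hle
  have hle' : X.G.dist x₁ x₂ ≤ T + T := by exact_mod_cast hle
  obtain ⟨h3, -⟩ := Net.of_edist_le (s := 0) (by omega) (h.view_mem hx₁ h₁)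
    hr.coe_dist_eq_edist.ge h₂
  have hr' : Y.G.Reachable y₁ y₂ := SimpleGraph.edist_ne_top_iff_reachable.1
    (ne_top_of_le_ne_top (ENat.natCast_ne_top _) h3)
  refine ⟨hr', le_trans ?_ hD⟩
  rw [← hr'.coe_dist_eq_edist] at h3
  exact_mod_cast h3

/-- The clusters of `v` and `w` are isomorphic if the views of `v` and `w` and the labels around
them agree. -/
theorem exists_isIso (h : PhaseAgree f T r v w)
    (hlab : ∀ x y, X.G.edist v x ≤ (T + T : ℕ) → X.id x = Y.id y → Net.LabelsAgree o o' x y) :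
    ∃ e, Cluster.IsIso
      (I := mkCluster r X.degreeLE X.id X.net.id_injective X.inp D o
        (canonCenter X.G X.id fun u => f (X.rand u))
        (canonCenter X.G X.id (fun u => f (X.rand u)) v))
      (J := mkCluster r Y.degreeLE Y.id Y.net.id_injective Y.inp D o'
        (canonCenter Y.G Y.id fun u => f (Y.rand u))
        (canonCenter Y.G Y.id (fun u => f (Y.rand u)) w)) e := by
  let CX : Set X.V := {x | canonCenter X.G X.id (fun u => f (X.rand u)) x =
    canonCenter X.G X.id (fun u => f (X.rand u)) v}
  let CY : Set Y.V := {y | canonCenter Y.G Y.id (fun u => f (Y.rand u)) y =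
    canonCenter Y.G Y.id (fun u => f (Y.rand u)) w}
  have hex : ∀ x : CX, ∃ y : CY, X.id x = Y.id y := fun x => by
    obtain ⟨y, hy, hid⟩ := h.exists_mem x.2
    exact ⟨⟨y, hy⟩, hid⟩
  choose φ hφ using hex
  have hbij : Function.Bijective φ := by
    constructor
    · intro x x' hxx
      apply Subtype.ext
      apply X.net.id_injective
      change X.id x = X.id x'
      rw [hφ, hφ, hxx]
    · intro y
      obtain ⟨x, hx, hid⟩ := h.symm.exists_mem y.2
      refine ⟨⟨x, hx⟩, Subtype.ext (Y.net.id_injective ?_)⟩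
      exact (hφ ⟨x, hx⟩).symm.trans hid.symm
  have hview : ∀ x : CX, X.view (2 * T + 2 * r + 2) x = Y.view (2 * T + 2 * r + 2) (φ x : Y.V) :=
    fun x => h.view_mem x.2 (hφ x)
  have hadj : ∀ x x' : CX, Y.G.Adj (φ x) (φ x') ↔ X.G.Adj x x' := fun x x' =>
    ⟨fun hy => (Net.adj_of_view (hview x).symm hy (hφ x').symm).choose,
      fun hx => (Net.adj_of_view (hview x) hx (hφ x')).choose⟩
  refine ⟨⟨Equiv.ofBijective φ hbij, fun {x x'} => hadj x x'⟩, ?_, ?_, ?_, ?_, ?_⟩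
  · exact fun x => (hφ x).symm
  · refine Labeling.ext ?_ ?_
    · funext x
      exact (Net.labelsAgree_inp (hview x)).1.symm
    · funext x x' hx
      exact ((Net.labelsAgree_inp (hview x)).2 _ _ hx _ (hφ x')).symm
  · have hl : ∀ x : CX, Net.LabelsAgree o o' (x : X.V) (φ x : Y.V) := fun x =>
      hlab _ _ (h.edist_le (Eq.symm x.2)) (hφ x)
    refine Labeling.ext ?_ ?_
    · funext x
      exact (hl x).1.symm
    · funext x x' hx
      exact ((hl x).2 _ _ hx _ (hφ x')).symm
  · exact fun x => ⟨h.symm.core_of_core (hview x).symm, h.core_of_core (hview x)⟩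
  · exact fun x x' => ⟨h.symm.close_of_close (φ x).2 (φ x').2 (hφ x).symm (hφ x').symm,
      h.close_of_close x.2 x'.2 (hφ x) (hφ x')⟩

theorem labelsAgree_canonPhase [Finite Vout] [Finite Eout] (P : LOP Vin Ein Vout Eout r Δ) (R : ℝ)
    (h : PhaseAgree f T r v w)
    (hlab : ∀ x y, X.G.edist v x ≤ (T + T : ℕ) → X.id x = Y.id y → Net.LabelsAgree o o' x y) :
    Net.LabelsAgree
      (canonPhase P X.degreeLE X.id X.net.id_injective X.inp (fun u => f (X.rand u)) R D o)
      (canonPhase P Y.degreeLE Y.id Y.net.id_injective Y.inp (fun u => f (Y.rand u)) R D o')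
      v w := by
  obtain ⟨e, he⟩ := h.exists_isIso (D := D) hlab
  have hres := Cluster.result_eq_comap P R he
  have hev : ∀ x y (hx : canonCenter X.G X.id (fun u => f (X.rand u)) x =
      canonCenter X.G X.id (fun u => f (X.rand u)) v)
      (hy : canonCenter Y.G Y.id (fun u => f (Y.rand u)) y =
        canonCenter Y.G Y.id (fun u => f (Y.rand u)) w),
      X.id x = Y.id y → e ⟨x, hx⟩ = ⟨y, hy⟩ := fun x y hx hy hid =>
    Subtype.ext (Y.net.id_injective ((he.id_eq ⟨x, hx⟩).trans hid))
  have hvw := Net.id_eq h.view_eq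
  constructor
  · simp only [canonPhase]
    rw [hres]
    change Labeling.node (Cluster.result P R _) (e ⟨v, rfl⟩) = _
    rw [hev v w rfl rfl hvw]
  · intro v' w' hv hw hid
    have hview : X.view T v' = Y.view T w' := by
      obtain ⟨-, -, h'⟩ := Net.adj_of_view h.view_eq hv hid
      exact Net.view_mono (by omega) h'
    simp only [canonPhase]
    by_cases hc : canonCenter X.G X.id (fun u => f (X.rand u)) v' =
        canonCenter X.G X.id (fun u => f (X.rand u)) v
    · have hc' := h.center_eq hc le_rfl hview
      rw [dif_pos hc, dif_pos hc', hres]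
      change Labeling.half (Cluster.result P R _) (e ⟨v, rfl⟩) (e ⟨v', hc⟩)
        (e.map_adj_iff.2 hv) = _
      exact Labeling.half_congr _ (hev v w rfl rfl hvw) (hev v' w' hc hc' hid) _
    · have hc' := fun hc' => hc (h.symm.center_eq hc' le_rfl hview.symm)
      rw [dif_neg hc, dif_neg hc']
      exact (hlab v w (by simp) hvw).2 _ _ hv hw hid

end PhaseAgree

/-- The canonical labels after `i` phases are determined by the views up to `i` times the distance
needed for a single phase. -/
theorem labelsAgree_canonOut {k : ℕ} {X Y : Net Δ Vin Ein (Fin k → ℝ)} {Vout Eout : Type}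
    [Finite Vout] [Finite Eout] {r : ℕ} (P : LOP Vin Ein Vout Eout r Δ) {T : ℕ}
    (hX : ∀ v i, X.rand v i ∈ Set.Icc (0 : ℝ) T) (hY : ∀ v i, Y.rand v i ∈ Set.Icc (0 : ℝ) T)
    (R : ℕ → ℝ) (D : ℝ) (o : Vout × Eout) (i : ℕ) : ∀ {v : X.V} {w : Y.V},
      X.view (i * (4 * T + 2 * r + 2)) v = Y.view (i * (4 * T + 2 * r + 2)) w →
      Net.LabelsAgree (canonOut P X.degreeLE X.id X.net.id_injective X.inp X.rand R D o i)
        (canonOut P Y.degreeLE Y.id Y.net.id_injective Y.inp Y.rand R D o i) v w := by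
  induction i with
  | zero => exact fun _ => ⟨rfl, fun _ _ _ _ _ => rfl⟩
  | succ i ih =>
    intro v w h
    rw [Nat.succ_mul] at h
    simp only [canonOut]
    split_ifs with hi
    · have hp : PhaseAgree (fun s => s ⟨i, hi⟩) T r v w :=
        ⟨fun v => hX v _, fun v => hY v _, Net.view_mono (by omega) h⟩
      refine hp.labelsAgree_canonPhase P (R i) fun x y hx hid => ih ?_
      exact (Net.of_edist_le (by omega) h hx hid).2
    · exact ih (Net.view_mono (by omega) h)

end Locality

/-! ### The LOCAL algorithm -/

section Algorithm

variable {Δ : ℕ} {Vin Ein Vout Eout S : Type}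

/-- The algorithm that collects the view of each node for `T` rounds and then determines the
output of the node from its view. -/
def viewAlgorithm (T : ℕ)
    (output : View Δ (ℕ × Vin × (Fin Δ → Option Ein) × S) → Vout × (Fin Δ → Eout)) :
    LocalAlgorithm Δ Vin Ein Vout Eout S where
  State := ℕ × View Δ (ℕ × Vin × (Fin Δ → Option Ein) × S)
  Msg := View Δ (ℕ × Vin × (Fin Δ → Option Ein) × S)
  init i x h s := (0, .node (i, x, h, s) fun _ => .none)
  send s _ := s.2
  receive s m := if s.1 < T then
      (s.1 + 1, match s.2 with
        | .none => .none
        | .node x _ => .node x fun p => (m p).getD .none)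
    else s
  output s := if s.1 < T then none else some (output s.2)
  output_stable s m o h := by
    split_ifs at h ⊢ with h1
    simp_all

theorem viewAlgorithm_state (X : Net Δ Vin Ein S) (T : ℕ)
    (output : View Δ (ℕ × Vin × (Fin Δ → Option Ein) × S) → Vout × (Fin Δ → Eout)) :
    ∀ t ≤ T, ∀ v, (viewAlgorithm T output).state X.net X.inp X.rand t v = (t, X.view t v) := by
  intro t
  induction t with
  | zero => exact fun _ _ => rfl
  | succ t ih =>
    intro ht v
    have hs : ∀ v, (viewAlgorithm T output).state X.net X.inp X.rand t v = (t, X.view t v) :=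
      ih (by omega)
    have hd : ∃ c, X.view t v = .node (X.data v) c := by cases t <;> exact ⟨_, rfl⟩
    obtain ⟨c, hc⟩ := hd
    have hreceive : ∀ m, (viewAlgorithm (Vout := Vout) (Eout := Eout) T output).receive
        (t, X.view t v) m = (t + 1, .node (X.data v) fun p => (m p).getD .none) := by
      intro m
      rw [hc]
      exact if_pos (by omega)
    have hsend : (fun w (h : X.G.Adj v w) => (viewAlgorithm T output).send
        ((viewAlgorithm T output).state X.net X.inp X.rand t w) (X.net.port w v h.symm)) =
          fun w _ => X.view t w := by
      funext w h
      rw [hs]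
      rfl
    rw [LocalAlgorithm.state, hs v, hreceive, hsend]
    rfl

end Algorithm

section Algorithm

variable {Vin Ein Vout Eout : Type} {r Δ : ℕ} [Finite Vout] [Finite Eout]

/-- The canonical result at the node `v` of a network. -/
noncomputable def canonOutput (P : LOP Vin Ein Vout Eout r Δ) {k : ℕ} (R : ℕ → ℝ) (D : ℝ)
    (o : Vout × Eout) (X : Net Δ Vin Ein (Fin k → ℝ)) (v : X.V) : Vout × (Fin Δ → Eout) :=
  ((canonOut P X.degreeLE X.id X.net.id_injective X.inp X.rand R D o k).node v,
    fun p => (X.net.byPort v (fun w h =>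
      (canonOut P X.degreeLE X.id X.net.id_injective X.inp X.rand R D o k).half v w h) p).getD o.2)

open Classical in
/-- The output of a node with view `x`: the canonical result at an arbitrary node with the same
view in an arbitrary network with shifts in `[0, T₀]`. -/
noncomputable def decideOutput (P : LOP Vin Ein Vout Eout r Δ) {k : ℕ} (T₀ T : ℕ) (R : ℕ → ℝ)
    (D : ℝ) (o : Vout × Eout) (x : View Δ (ℕ × Vin × (Fin Δ → Option Ein) × (Fin k → ℝ))) :
    Vout × (Fin Δ → Eout) :=
  if h : ∃ (X : Net Δ Vin Ein (Fin k → ℝ)) (v : X.V),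
      (∀ v i, X.rand v i ∈ Set.Icc (0 : ℝ) T₀) ∧ X.view T v = x then
    canonOutput P R D o h.choose h.choose_spec.choose
  else (o.1, fun _ => o.2)

/-- The choice of the network does not matter, because the view determines the canonical result. -/
theorem canonOutput_of_view_eq (P : LOP Vin Ein Vout Eout r Δ) {k T₀ T : ℕ}
    (hT : k * (4 * T₀ + 2 * r + 2) + 1 ≤ T) (R : ℕ → ℝ) (D : ℝ) (o : Vout × Eout)
    {X Y : Net Δ Vin Ein (Fin k → ℝ)} (hX : ∀ v i, X.rand v i ∈ Set.Icc (0 : ℝ) T₀)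
    (hY : ∀ v i, Y.rand v i ∈ Set.Icc (0 : ℝ) T₀) {v : X.V} {w : Y.V}
    (hview : Y.view T w = X.view T v) :
    (canonOutput P R D o Y w).1 =
        (canonOut P X.degreeLE X.id X.net.id_injective X.inp X.rand R D o k).node v ∧
      ∀ v' h, (canonOutput P R D o Y w).2 (X.net.port v v' h) =
        (canonOut P X.degreeLE X.id X.net.id_injective X.inp X.rand R D o k).half v v' h := by
  obtain ⟨h1, h2⟩ := labelsAgree_canonOut P hY hX R D o k (Net.view_mono (by omega) hview)
  refine ⟨h1, fun v' hv => ?_⟩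
  obtain ⟨w', hw, hp, h3⟩ := Net.exists_adj_of_view
    (Net.view_mono (by omega : 0 + 1 ≤ T) hview.symm) hv
  simp only [canonOutput]
  rw [← hp, Network.byPort_port, Option.getD_some]
  exact h2 _ _ hw hv (Net.id_eq h3).symm

theorem outputsWithin_canonOut (P : LOP Vin Ein Vout Eout r Δ) {k T₀ T : ℕ}
    (hT : k * (4 * T₀ + 2 * r + 2) + 1 ≤ T) (R : ℕ → ℝ) (D : ℝ) (o : Vout × Eout)
    (X : Net Δ Vin Ein (Fin k → ℝ)) (hX : ∀ v i, X.rand v i ∈ Set.Icc (0 : ℝ) T₀) :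
    (viewAlgorithm T (decideOutput P T₀ T R D o)).OutputsWithin X.net X.inp X.rand T
      (canonOut P X.degreeLE X.id X.net.id_injective X.inp X.rand R D o k) := by
  intro v
  refine ⟨decideOutput P T₀ T R D o (X.view T v), ?_, ?_⟩
  · rw [viewAlgorithm_state X T _ T le_rfl v]
    exact if_neg (lt_irrefl T)
  · have hex : ∃ (Y : Net Δ Vin Ein (Fin k → ℝ)) (w : Y.V),
      (∀ v i, Y.rand v i ∈ Set.Icc (0 : ℝ) T₀) ∧ Y.view T w = X.view T v := ⟨X, v, hX, rfl⟩
    rw [decideOutput, dif_pos hex]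
    obtain ⟨hY, hview⟩ := hex.choose_spec.choose_spec
    exact canonOutput_of_view_eq P hT R D o hX hY hview

theorem isResult_canonOut (P : LOP Vin Ein Vout Eout r Δ) (k : Constants) (n : ℕ) {V : Type}
    [Fintype V] {G : SimpleGraph V} (hG : DegreeLE G Δ) (id : V → ℕ)
    (hid : Function.Injective id) (inp : Labeling G Vin Ein) (s : V → Fin (k.phases n) → ℝ)
    (o : Vout × Eout) :
    P.IsResult k n G inp s (canonOut P hG id hid inp s (P.threshold k n) (P.diamBound k n) o
      (k.phases n)) := by
  refine ⟨canonOut P hG id hid inp s (P.threshold k n) (P.diamBound k n) o, fun i => ?_, rfl⟩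
  have : canonOut P hG id hid inp s (P.threshold k n) (P.diamBound k n) o (i + 1) =
      canonPhase P hG id hid inp (fun v => s v i) (P.threshold k n i) (P.diamBound k n)
        (canonOut P hG id hid inp s (P.threshold k n) (P.diamBound k n) o i) := by
    rw [canonOut, dif_pos i.2]
  rw [this]
  exact phase_canonPhase P hG id hid inp _ _ _ _

end Algorithm

/-! ### The choice of the constants -/

/-- `log B / ε` steps of growth by a factor `1 + ε` suffice to exceed `B`, up to a constant. -/
theorem exists_lt_one_add_pow {ε B : ℝ} (hε : 0 < ε) (hε1 : ε ≤ 1) (hB : 1 ≤ B) :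
    ∃ J : ℕ, B < (1 + ε) ^ J ∧ (J : ℝ) ≤ 2 * Real.log B / ε + 1 := by
  have hlog := Real.log_nonneg hB
  refine ⟨⌊2 * Real.log B / ε⌋₊ + 1, ?_, ?_⟩
  · have h1 : Real.exp (ε / 2) ≤ 1 + ε := by
      have h := Real.add_one_le_exp (-(ε / 2))
      rw [Real.exp_neg, le_inv_comm₀ (by linarith) (Real.exp_pos _)] at h
      refine h.trans ?_
      rw [inv_le_iff_one_le_mul₀ (by linarith)]
      nlinarith
    have h2 : 2 * Real.log B / ε < (⌊2 * Real.log B / ε⌋₊ + 1 : ℕ) := by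
      push_cast
      exact Nat.lt_floor_add_one _
    rw [div_lt_iff₀ hε] at h2
    calc B = Real.exp (Real.log B) := (Real.exp_log (by linarith)).symm
      _ < Real.exp ((⌊2 * Real.log B / ε⌋₊ + 1 : ℕ) * (ε / 2)) :=
          Real.exp_lt_exp.2 (by linarith)
      _ = Real.exp (ε / 2) ^ (⌊2 * Real.log B / ε⌋₊ + 1) := by rw [Real.exp_nat_mul]
      _ ≤ _ := pow_le_pow_left₀ (Real.exp_pos _).le h1 _
  · push_cast
    have := Nat.floor_le (by positivity : 0 ≤ 2 * Real.log B / ε)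
    linarith

theorem half_le_log {n : ℕ} (hn : 2 ≤ n) : 1 / 2 ≤ Real.log n := by
  have h1 : Real.log 2 ≤ Real.log n :=
    Real.log_le_log (by norm_num) (by exact_mod_cast hn)
  linarith [Real.log_two_gt_d9]

/-- The numerical parameters of the correctness proof: the growth parameter, the numbers of
steps of the two ball growing arguments, and the radius
`ℓ` of the ball that has to lie inside a cluster; here `y` is `log n / ε` for the `ε` of the
algorithm, and `ℓ` is of order `y ^ 2`. -/
theorem exists_parameters {lam M b : ℝ} (hlam : 0 < lam) (hM : 0 ≤ M) (hb : 0 ≤ b) (r : ℕ) :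
    ∃ c₃ C : ℝ, 0 < c₃ ∧ 0 < C ∧ ∀ n : ℕ, 2 ≤ n → ∀ y : ℝ, y = 300 * Real.log n ^ 2 / lam →
      ∃ (ε : ℝ) (J₁ J₂ ℓ : ℕ), 0 ≤ ε ∧ (6 * M * b + lam) * ε ≤ lam / (60 * Real.log n) ∧
        (∀ R, lam / 4 ≤ R → M * n / R < (1 + ε) ^ J₁) ∧ (n : ℝ) < (1 + ε) ^ J₂ ∧
        ((J₂ * (r + r) + J₂ * (r + r) : ℕ) : ℝ) ≤ c₃ * y ∧
        J₁ * (⌊c₃ * y⌋₊ + 2 * r) + ⌊c₃ * y⌋₊ + r + (2 * r + 1) ≤ ℓ ∧ (ℓ : ℝ) ≤ C * y ^ 2 := by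
  set Q := 6 * M * b + lam with hQ
  have hQlam : lam ≤ Q := by have : 0 ≤ 6 * M * b := by positivity
                             linarith
  have hQpos : 0 < Q := hlam.trans_le hQlam
  set B₀ := 4 * M / lam + 1 with hB₀
  have hB₀1 : 1 ≤ B₀ := by have : 0 ≤ 4 * M / lam := by positivity
                           linarith
  have hlogB := Real.log_nonneg hB₀1
  set c₃ := 4 * r * (2 * Q + lam) + 1 with hc₃
  set A := 2 * (1 + 2 * Real.log B₀) * Q + lam with hA
  have hc₃pos : 0 < c₃ := by positivity
  have hApos : 0 < A := by positivity
  refine ⟨c₃, A * (c₃ + 2 * r * lam) + lam * (c₃ + (3 * r + 1) * lam), hc₃pos, by positivity, ?_⟩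
  intro n hn y hy
  have hlog := half_le_log hn
  have hn1 : (1 : ℝ) ≤ n := by exact_mod_cast (by omega : 1 ≤ n)
  set x := Real.log n with hx
  have hx0 : 0 < x := by linarith
  set ε := lam / (300 * x) / Q with hε
  have hεpos : 0 < ε := by positivity
  have hε1 : ε ≤ 1 := by
    rw [hε, div_div, div_le_one (by positivity)]
    nlinarith
  have hypos : 0 < y := by rw [hy]; positivity
  have hxε : x / ε = Q * y := by rw [hε, hy]; field_simp
  have hly : 1 ≤ lam * y := by
    rw [hy, mul_div_cancel₀ _ hlam.ne']
    nlinarith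
  obtain ⟨J₂, hJ₂, hJ₂'⟩ := exists_lt_one_add_pow hεpos hε1 hn1
  obtain ⟨J₁, hJ₁, hJ₁'⟩ := exists_lt_one_add_pow hεpos hε1
    (one_le_mul_of_one_le_of_one_le hn1 hB₀1)
  have hJ₂y : (J₂ : ℝ) ≤ (2 * Q + lam) * y := by
    rw [mul_div_assoc, hxε] at hJ₂'
    linarith
  have hJ₁y : (J₁ : ℝ) ≤ A * y := by
    rw [Real.log_mul (by linarith) (by linarith), mul_div_assoc] at hJ₁'
    have h1 : (x + Real.log B₀) / ε ≤ (1 + 2 * Real.log B₀) * (Q * y) := by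
      rw [← hxε, ← mul_div_assoc]
      refine div_le_div_of_nonneg_right ?_ hεpos.le
      nlinarith
    calc (J₁ : ℝ) ≤ _ := hJ₁'
      _ ≤ 2 * ((1 + 2 * Real.log B₀) * (Q * y)) + lam * y := by linarith
      _ = A * y := by rw [hA]; ring
  refine ⟨ε, J₁, J₂, _, hεpos.le, ?_, ?_, hJ₂, ?_, le_rfl, ?_⟩
  · rw [hε, mul_div_cancel₀ _ hQpos.ne']
    exact div_le_div_of_nonneg_left hlam.le (by positivity) (by linarith)
  · intro R hR
    refine lt_of_le_of_lt ?_ hJ₁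
    rw [div_le_iff₀ (by linarith)]
    have h1 : M ≤ B₀ * R := by
      have : B₀ * (lam / 4) = M + lam / 4 := by rw [hB₀]; field_simp
      nlinarith
    nlinarith
  · push_cast
    calc (J₂ * (r + r) + J₂ * (r + r) : ℝ) = 4 * r * J₂ := by ring
      _ ≤ 4 * r * ((2 * Q + lam) * y) := by gcongr
      _ ≤ c₃ * y := by rw [hc₃]; nlinarith
  · have hfl : (⌊c₃ * y⌋₊ : ℝ) ≤ c₃ * y := Nat.floor_le (by positivity)
    push_cast
    have hr : (0 : ℝ) ≤ r := Nat.cast_nonneg r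
    have e0 : (2 : ℝ) * r ≤ 2 * r * (lam * y) := le_mul_of_one_le_right (by positivity) hly
    have e1 : (⌊c₃ * y⌋₊ : ℝ) + 2 * r ≤ (c₃ + 2 * r * lam) * y := by linarith
    have e2 : (J₁ : ℝ) * (⌊c₃ * y⌋₊ + 2 * r) ≤ (A * y) * ((c₃ + 2 * r * lam) * y) :=
      mul_le_mul hJ₁y e1 (by positivity) (by positivity)
    have e3' : (3 : ℝ) * r + 1 ≤ (3 * r + 1) * (lam * y) :=
      le_mul_of_one_le_right (by positivity) hly
    have e3 : (⌊c₃ * y⌋₊ : ℝ) + r + (2 * r + 1) ≤ (c₃ + (3 * r + 1) * lam) * y := by linarith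
    have e4 : (c₃ + (3 * r + 1) * lam) * y ≤ (c₃ + (3 * r + 1) * lam) * y * (lam * y) :=
      le_mul_of_one_le_right (by positivity) hly
    calc _ = (J₁ : ℝ) * (⌊c₃ * y⌋₊ + 2 * r) + (⌊c₃ * y⌋₊ + r + (2 * r + 1)) := by ring
      _ ≤ (A * y) * ((c₃ + 2 * r * lam) * y) +
          (c₃ + (3 * r + 1) * lam) * y * (lam * y) := by linarith
      _ = _ := by ring

/-- The bound on the failure probability that results from the union bound. -/
theorem failure_bound {n : ℕ} (hn : 2 ≤ n) {q β T : ℝ} (hq0 : 0 ≤ q) (hq : q ≤ Real.exp (-1))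
    (hT : 6 * Real.log n ≤ β * T) :
    (n : ℝ≥0∞) * ENNReal.ofReal q ^ ⌈3 * Real.log n⌉₊ +
      n * (⌈3 * Real.log n⌉₊ * ENNReal.ofReal (Real.exp (-(β * T)))) ≤ (n : ℝ≥0∞)⁻¹ := by
  have hn2 : (2 : ℝ) ≤ n := by exact_mod_cast hn
  have hn0 : (0 : ℝ) < n := by linarith
  have hexp : ∀ j : ℕ, Real.exp (-(j * Real.log n)) = ((n : ℝ) ^ j)⁻¹ := by
    intro j
    rw [Real.exp_neg, Real.exp_nat_mul, Real.exp_log hn0]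
  -- The two summands are at most `n ^ (-2)` and `4 * n ^ (-4)`.
  have h1 : q ^ ⌈3 * Real.log n⌉₊ ≤ ((n : ℝ) ^ 3)⁻¹ := by
    refine (pow_le_pow_left₀ hq0 hq _).trans ?_
    rw [← Real.exp_nat_mul, ← hexp 3]
    apply Real.exp_le_exp.2
    have := Nat.le_ceil (3 * Real.log n)
    push_cast
    linarith
  have h2 : Real.exp (-(β * T)) ≤ ((n : ℝ) ^ 6)⁻¹ := by
    rw [← hexp 6]
    apply Real.exp_le_exp.2
    push_cast
    linarith
  have h3 : (⌈3 * Real.log n⌉₊ : ℝ) ≤ 4 * n := by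
    have := Nat.ceil_lt_add_one (a := 3 * Real.log n) (by have := half_le_log hn; linarith)
    have := Real.log_le_sub_one_of_pos hn0
    linarith
  have hfin : (n : ℝ) * q ^ ⌈3 * Real.log n⌉₊ +
      n * (⌈3 * Real.log n⌉₊ * Real.exp (-(β * T))) ≤ (n : ℝ)⁻¹ := by
    calc _ ≤ (n : ℝ) * ((n : ℝ) ^ 3)⁻¹ + n * ((4 * n) * ((n : ℝ) ^ 6)⁻¹) := by gcongr
      _ = ((n : ℝ) ^ 2 + 4) / n ^ 4 := by field_simp
      _ ≤ n ^ 3 / n ^ 4 := by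
          refine div_le_div_of_nonneg_right ?_ (by positivity)
          nlinarith [mul_nonneg (sub_nonneg.2 hn2) (sq_nonneg (n : ℝ))]
      _ = (n : ℝ)⁻¹ := by field_simp
  calc _ = ENNReal.ofReal ((n : ℝ) * q ^ ⌈3 * Real.log n⌉₊ +
        n * (⌈3 * Real.log n⌉₊ * Real.exp (-(β * T)))) := by
        rw [ENNReal.ofReal_add (by positivity) (by positivity), ENNReal.ofReal_mul hn0.le,
          ENNReal.ofReal_mul hn0.le, ENNReal.ofReal_mul (by positivity), ENNReal.ofReal_pow hq0,
          ENNReal.ofReal_natCast, ENNReal.ofReal_natCast]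
    _ ≤ ENNReal.ofReal (n : ℝ)⁻¹ := ENNReal.ofReal_le_ofReal hfin
    _ = (n : ℝ≥0∞)⁻¹ := by rw [ENNReal.ofReal_inv_of_pos hn0, ENNReal.ofReal_natCast]

/-- `c₁ log n` phases, each simulated with radius `O(log ^ 5 n)`, take `O(log ^ 6 n)` rounds. -/
theorem exists_round_bound (C : ℝ) (r : ℕ) :
    ∃ K : ℝ, ∀ n : ℕ, 2 ≤ n → ∀ T₀ : ℕ, (T₀ : ℝ) ≤ C * Real.log n ^ 5 + 1 →
      ⌈3 * Real.log n⌉₊ * (4 * T₀ + 2 * r + 2) + 1 ≤ ⌊K * Real.log n ^ 6⌋₊ := by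
  refine ⟨5 * (4 * C + 32 * (2 * r + 6)) + 64, fun n hn T₀ hT₀ => Nat.le_floor ?_⟩
  have hlog := half_le_log hn
  set x := Real.log n
  have hx5 : 1 ≤ 32 * x ^ 5 := by
    have := pow_le_pow_left₀ (by norm_num) hlog 5
    norm_num at this
    linarith
  have hx6 : 1 ≤ 64 * x ^ 6 := by
    have := pow_le_pow_left₀ (by norm_num) hlog 6
    norm_num at this
    linarith
  have hk : (⌈3 * x⌉₊ : ℝ) ≤ 5 * x := by
    have := Nat.ceil_lt_add_one (a := 3 * x) (by linarith)
    linarith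
  have hr : (0 : ℝ) ≤ r := Nat.cast_nonneg r
  have h1 : (4 * T₀ + 2 * r + 2 : ℝ) ≤ (4 * C + 32 * (2 * r + 6)) * x ^ 5 := by nlinarith
  push_cast
  calc (⌈3 * x⌉₊ : ℝ) * (4 * T₀ + 2 * r + 2) + 1
      ≤ (5 * x) * ((4 * C + 32 * (2 * r + 6)) * x ^ 5) + 64 * x ^ 6 := by
        refine add_le_add (mul_le_mul hk h1 (by positivity) (by linarith)) hx6
    _ = _ := by ring

/-! ### The probability of failure -/

namespace LOP

variable {Vin Ein Vout Eout : Type} {r Δ : ℕ} [Finite Vin] [Finite Ein] [Finite Vout]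
  [Finite Eout]

open Classical in
/-- The shifts of a phase for which the two best shifted values at `v` differ by at most `2 * ℓ`;
for all other shifts the ball of radius `ℓ` around `v` lies in a single cluster. -/
def cutSet {V : Type} [Fintype V] (G : SimpleGraph V) (ℓ : ℕ) (v : V) : Set (V → ℝ) :=
  (⋃ u ∈ Finset.univ.filter fun u => G.Reachable u v,
    gapSet (Finset.univ.filter fun u => G.Reachable u v) (fun u => (G.dist u v : ℝ)) (2 * ℓ) u)ᶜ

theorem measurableSet_cutSet {V : Type} [Fintype V] (G : SimpleGraph V) (ℓ : ℕ) (v : V) :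
    MeasurableSet (cutSet G ℓ v) :=
  (Finset.measurableSet_biUnion _ fun u _ => measurableSet_gapSet _ _ _ u).compl

theorem measure_cutSet_le {V : Type} [Fintype V] (G : SimpleGraph V) (ℓ : ℕ) (v : V) {β : ℝ}
    (hβ : 0 < β) : MeasureTheory.Measure.pi (fun _ : V => ProbabilityTheory.expMeasure β)
      (cutSet G ℓ v) ≤ ENNReal.ofReal (β * (2 * ℓ)) := by
  classical
  exact expMeasure_pi_gap_le hβ (by positivity)
    ⟨v, by simp⟩ _

theorem center_eq_of_notMem_cutSet {V : Type} [Fintype V] {G : SimpleGraph V} {ℓ : ℕ} {v : V}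
    {s : V → ℝ} (hs : s ∉ cutSet G ℓ v) {center : V → V} (h : IsMPX G s center) (u : V)
    (hu : G.edist v u ≤ ℓ) : center u = center v :=
  h.center_eq_of_gap (by simp) (Set.notMem_compl_iff.1 hs) hu

/-- If every ball of radius `ℓ` is contained in a single cluster in some phase, then every possible
result of the algorithm is a solution. -/
theorem solves_of_forall_exists_notMem_cutSet (P : LOP Vin Ein Vout Eout r Δ) {k : Constants}
    {n : ℕ} (hn : 2 ≤ n) {V : Type} [Fintype V] (hcard : Fintype.card V = n) {G : SimpleGraph V}
    (hG : DegreeLE G Δ) {inp : Labeling G Vin Ein} {s : V → Fin (k.phases n) → ℝ} {ℓ : ℕ}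
    (hs : ∀ v, ∃ i, (fun u => s u i) ∉ cutSet G ℓ v) {M : ℝ}
    (hM : ∀ l v, cost P.Ψ r G l v ≤ M) (hc₁ : k.c₁ = 3) {ε : ℝ} {J₁ J₂ : ℕ}
    (hε : 0 ≤ ε)
    (hε' : (6 * M * ((Δ + 1) ^ r : ℕ) + P.minRatio) * ε ≤ P.minRatio / (60 * Real.log n))
    (hJ₁ : ∀ R, P.minRatio / 4 ≤ R → M * n / R < (1 + ε) ^ J₁) (hJ₂ : (n : ℝ) < (1 + ε) ^ J₂)
    (hD : ((J₂ * (r + r) + J₂ * (r + r) : ℕ) : ℝ) ≤ P.diamBound k n)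
    (hℓ : J₁ * (⌊P.diamBound k n⌋₊ + 2 * r) + ⌊P.diamBound k n⌋₊ + r + (2 * r + 1) ≤ ℓ)
    {out : Labeling G Vout Eout} (hout : P.IsResult k n G inp s out) : P.Solves G inp out := by
  obtain ⟨o, ho, rfl⟩ := hout
  intro v
  obtain ⟨i, hi⟩ := hs v
  have hlam := P.minRatio_pos
  have hlog := half_le_log hn
  set x := Real.log n with hx
  have hstep : 0 < P.minRatio / (60 * x) := by positivity
  have hT : ∀ j : ℕ, P.threshold k n j = P.minRatio / 4 + j * (P.minRatio / (60 * x)) := by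
    intro j
    rw [threshold, hc₁, ← hx]
    norm_num
  have hR : P.minRatio / 4 ≤ P.threshold k n (i + 1) := by
    rw [hT]
    have : 0 ≤ ((i + 1 : ℕ) : ℝ) * (P.minRatio / (60 * x)) := by positivity
    linarith
  have hRlam : P.threshold k n (i + 1) ≤ P.minRatio := by
    have h1 : ((i + 1 : ℕ) : ℝ) ≤ 3 * x + 1 := by
      have h2 : ((i + 1 : ℕ) : ℝ) ≤ (⌈k.c₁ * Real.log n⌉₊ : ℕ) := Nat.cast_le.2 i.2
      have h3 := Nat.ceil_lt_add_one (a := k.c₁ * Real.log n) (by rw [hc₁]; linarith)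
      rw [hc₁] at h2 h3
      linarith
    have h4 : (3 * x + 1) * (P.minRatio / (60 * x)) ≤ P.minRatio / 2 := by
      rw [← mul_div_assoc, div_le_iff₀ (by positivity)]
      nlinarith
    have h5 := mul_le_mul_of_nonneg_right h1 hstep.le
    rw [hT]
    linarith
  refine P.mem_constraints_of_good_phase hG hM (m := k.phases n)
    (s := fun j v => if h : j < k.phases n then s v ⟨j, h⟩ else 0) (T := P.threshold k n)
    (D := P.diamBound k n) (out := o) ?_ i.2 (ε := ε) (R := P.threshold k n (i + 1)) (J₁ := J₁)
    (J₂ := J₂) (ℓ := ℓ) ?_ ?_ ?_ hε ?_ hRlam ?_ ?_ ?_ hD hℓ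
  · intro j hj
    have := ho ⟨j, hj⟩
    simp only [hj, dif_pos]
    exact this
  · intro center hc u hu
    refine center_eq_of_notMem_cutSet hi ?_ u hu
    simpa using hc
  · rw [hT]; positivity
  · rw [hT, hT]; push_cast; linarith
  · intro j hij _
    rw [hT, hT]
    have : ((i + 1 : ℕ) : ℝ) ≤ j := by exact_mod_cast hij
    have := mul_le_mul_of_nonneg_right this hstep.le
    linarith
  · have h1 : P.threshold k n (i + 1) * ε ≤ P.minRatio * ε := mul_le_mul_of_nonneg_right hRlam hε
    have h2 : P.threshold k n (i + 1) - P.threshold k n i = P.minRatio / (60 * x) := by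
      rw [hT, hT]; push_cast; ring
    rw [h2]
    linarith
  · rw [hcard]; exact hJ₁ _ hR
  · rw [hcard]; exact hJ₂

end LOP

end LocalOpt

open LocalOpt
theorem mainTheorem1 {Vin Ein Vout Eout : Type} [Finite Vin] [Finite Ein] [Finite Vout]
    [Finite Eout] [Nonempty Vout] [Nonempty Eout] (r Δ : ℕ) (P : LOP Vin Ein Vout Eout r Δ) :
    ∃ (k : Constants) (K : ℝ)
      (𝒜 : ∀ n : ℕ, LocalAlgorithm Δ Vin Ein Vout Eout (Fin (k.phases n) → ℝ)),
      ∀ n : ℕ, 2 ≤ n →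
      ∀ (V : Type) [Fintype V] (G : SimpleGraph V) (a : ℕ) (N : Network G Δ a)
        (inp : Labeling G Vin Ein), Fintype.card V = n → DegreeLE G Δ →
        P.shiftLaw k n V
          {s | ¬ ((∃ out, (𝒜 n).OutputsWithin N inp s ⌊K * Real.log n ^ 6⌋₊ out ∧
                    P.IsResult k n G inp s out) ∧
                  ∀ out, P.IsResult k n G inp s out → P.Solves G inp out)}
          ≤ (n : ENNReal)⁻¹ := by
  obtain ⟨M, hM0, hM⟩ := P.exists_cost_bound
  have hlam := P.minRatio_pos
  obtain ⟨c₃, C, hc₃, hC, hpar⟩ := exists_parameters hlam hM0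
    (Nat.cast_nonneg ((Δ + 1) ^ r) : (0 : ℝ) ≤ ((Δ + 1) ^ r : ℕ)) r
  let k : Constants := ⟨30 * C, 3, 1, c₃, by positivity, by norm_num, one_pos, hc₃⟩
  -- With `y = log n / ε`, the rate of the shifts is `ρ / 2 = 5 / (c * y ^ 2)`.
  have hrate : ∀ n : ℕ, 2 ≤ n → P.rho k n / 2 =
      1 / (6 * C * (300 * Real.log n ^ 2 / P.minRatio) ^ 2) := by
    intro n hn
    have hlog := half_le_log hn
    have hx : Real.log n ≠ 0 := by linarith
    simp only [LOP.rho, LOP.eps, k]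
    field_simp
    ring
  have hdiam : ∀ n : ℕ, 2 ≤ n → P.diamBound k n =
      c₃ * (300 * Real.log n ^ 2 / P.minRatio) := by
    intro n hn
    have hlog := half_le_log hn
    have hx : Real.log n ≠ 0 := by linarith
    simp only [LOP.diamBound, LOP.eps, k]
    field_simp
    ring
  let T₀ : ℕ → ℕ := fun n => ⌈6 * Real.log n / (P.rho k n / 2)⌉₊
  obtain ⟨K, hK⟩ := exists_round_bound (36 * C * (300 / P.minRatio) ^ 2) r
  let T : ℕ → ℕ := fun n => ⌊K * Real.log n ^ 6⌋₊
  let o : Vout × Eout := Classical.arbitrary _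
  refine ⟨k, K, fun n => viewAlgorithm (T n)
    (decideOutput P (T₀ n) (T n) (P.threshold k n) (P.diamBound k n) o), ?_⟩
  intro n hn V _ G a N inp hcard hG
  have hlog := half_le_log hn
  have hx0 : 0 < Real.log n := by linarith
  have hβ : 0 < P.rho k n / 2 := by rw [hrate n hn]; positivity
  obtain ⟨ε, J₁, J₂, ℓ, hε, hε', hJ₁, hJ₂, hD, hℓ, hℓC⟩ := hpar n hn _ rfl
  rw [← hdiam n hn] at hD hℓ
  have hrounds : k.phases n * (4 * T₀ n + 2 * r + 2) + 1 ≤ T n := by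
    refine hK n hn (T₀ n) ?_
    refine (Nat.ceil_lt_add_one (by positivity)).le.trans ?_
    rw [hrate n hn]
    refine add_le_add (le_of_eq ?_) le_rfl
    field_simp
    ring
  have hsub : {s : V → Fin (k.phases n) → ℝ |
      ¬ ((∃ out, (viewAlgorithm (T n) (decideOutput P (T₀ n) (T n) (P.threshold k n)
        (P.diamBound k n) o)).OutputsWithin N inp s ⌊K * Real.log n ^ 6⌋₊ out ∧
          P.IsResult k n G inp s out) ∧
        ∀ out, P.IsResult k n G inp s out → P.Solves G inp out)} ⊆
      {s | (∃ v, ∀ i, (fun u => s u i) ∈ LOP.cutSet G ℓ v) ∨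
        ∃ v i, s v i ∉ Set.Icc (0 : ℝ) (T₀ n)} := by
    intro s hs
    by_contra hgood
    simp only [Set.mem_ofPred_eq, not_or, not_exists, not_forall, not_not] at hgood
    refine hs ⟨?_, fun out hout => ?_⟩
    · exact ⟨_, outputsWithin_canonOut P hrounds (P.threshold k n) (P.diamBound k n) o
        ⟨V, inferInstance, G, hG, a, N, inp, s⟩ hgood.2,
        isResult_canonOut P k n hG N.id N.id_injective inp s o⟩
    · exact P.solves_of_forall_exists_notMem_cutSet hn hcard hG hgood.1 (hM V G hG) rfl hε hε'
        hJ₁ hJ₂ hD hℓ hout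
  refine (MeasureTheory.measure_mono hsub).trans ?_
  refine (pi_pi_union_bound hβ (fun v => LOP.measurableSet_cutSet G ℓ v)
    (fun v => LOP.measure_cutSet_le G ℓ v hβ) (Nat.cast_nonneg (T₀ n))).trans ?_
  rw [hcard, Fintype.card_fin]
  refine failure_bound hn (by positivity) ?_ ?_
  · have h1 : P.rho k n / 2 * (2 * ℓ) ≤ 1 / 3 := by
      rw [hrate n hn, one_div_mul_eq_div, div_le_iff₀ (by positivity)]
      linarith
    have h2 : 1 / 3 ≤ Real.exp (-1) := by
      rw [Real.exp_neg, one_div]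
      exact inv_anti₀ (Real.exp_pos _) (by linarith [Real.exp_one_lt_d9])
    linarith
  · exact (div_le_iff₀' hβ).1 (Nat.le_ceil _)
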